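/- Let $A\in\mathbb R^{2\times2}$, $B\in\mathbb R^{2}$, $C\in\mathbb R^{3\times2}$, $\Lambda^+=\operatorname{diag}(\lambda_1,\lambda_2,\lambda_3)$ with $\lambda_i>0$, $\Lambda^->0$, $\Sigma^{++}\in\mathbb R^{3\times3}$, $\Sigma^{+-},Q\in\mathbb R^{3\times1}$, $\Sigma^{-+},R\in\mathbb R^{1\times3}$, $\Sigma^{--}\in\mathbb R$ be constant, and consider, for $t\ge0$ and $x\in[0,1]$, the system with states $X(t)\in\mathbb R^2$, $w(x,t)\in\mathbb R^3$, $z(x,t)\in\mathbb R$ and control $U(t)\in\mathbb R$ $$\dot X=AX+Bz(0,t),\quad w_t=-\Lambda^+w_x+\Sigma^{++}w+\Sigma^{+-}z,\quad z_t=\Lambda^-z_x+\Sigma^{-+}w+\Sigma^{--}z,$$ $$w(0,t)=Qz(0,t)+CX(t),\qquad z(1,t)=Rw(1,t)+U(t).$$ Assume that $(A,B)$ is stabilizable and let $\kappa\in\mathbb R^{1\times2}$ be such that $A+B\kappa$ is Hurwitz. Let $\mathcal T=\{(x,\xi):0\le\xi\le x\le1\}$. (i) There are $C^1$ functions $K:\mathcal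 T\to\mathbb R^{1\times3}$, $N:\mathcal T\to\mathbb R$, $\gamma:[0,1]\to\mathbb R^{1\times2}$ that satisfy the kernel equations $$\Lambda^-K_x=K_\xi\Lambda^++N\Sigma^{-+}+K(\Sigma^{++}-\Sigma^{--}I_3),\qquad \Lambda^-N_x+\Lambda^-N_\xi=K\Sigma^{+-}\quad\text{on }\mathcal T,$$ $$K(x,x)(\Lambda^-I_3+\Lambda^+)=-\Sigma^{-+},\qquad \Lambda^-N(x,0)-K(x,0)\Lambda^+Q=\gamma(x)B,$$ $$\Lambda^-\gamma'(x)=\gamma(x)A-\Sigma^{--}\gamma(x)+K(x,0)\Lambda^+C,\qquad \gamma(0)=\kappa,\qquad x\in[0,1].$$ (ii) Let $(K,N,\gamma)$ satisfy these equations and close the loop with $$U(t)=-Rw(1,t)+\int_0^1K(1,\xi)w(\xi,t)\,d\xi+\int_0^1N(1,\xi)z(\xi,t)\,d\xi+\gamma(1)X(t).$$ Then the zero state is an equilibrium of the closed loop and is exponentially stable in $L^2$: for every initial state $(X_0,w_0,z_0)\in\mathbb R^2\times L^2([0,1],\mathbb R^3)\times L^2([0,1],\mathbb R)$ there is a weak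 solution on $[0,\infty)$, and there are constants $M,\eta>0$ such that every weak solution satisfies, for all $t\ge0$, $$\|w(t)\|_{L^2}+\|z(t)\|_{L^2}+|X(t)|\le M e^{-\eta t}\big(\|w(0)\|_{L^2}+\|z(0)\|_{L^2}+|X(0)|\big).$$ Here a weak solution is a continuous curve $t\mapsto(X,w,z)(t)$ from $[0,\infty)$ to $\mathbb R^2\times L^2\times L^2$, together with boundary values $w(0,\cdot),w(1,\cdot),z(0,\cdot),z(1,\cdot)\in L^2_{loc}([0,\infty))$ that satisfy the boundary conditions for almost every $t$, such that the ODE holds in integrated form and the two transport equations hold after multiplication by any $\varphi\in C^1(\mathbb R)$, integration over $x\in[0,1]$ (by parts in the terms $w_x$, $z_x$, with these boundary values) and integration over $[0,t]$, for all $t\ge 0$. -/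

import Mathlib

open Set MeasureTheory
open scoped ENNReal

/-- Lebesgue measure on the spatial interval `[0,1]`. -/
noncomputable abbrev unitMeasure : Measure ℝ := volume.restrict (Icc (0 : ℝ) 1)

/-- The ODE state space `ℝ²`. -/
abbrev OdeState : Type := EuclideanSpace ℝ (Fin 2)

/-- The state space `L²([0,1], ℝ³)` of the three rightward transport equations. -/
noncomputable abbrev RightState : Type := Lp (EuclideanSpace ℝ (Fin 3)) 2 unitMeasure

/-- The state space `L²([0,1], ℝ)` of the leftward transport equation. -/
noncomputable abbrev LeftState : Type := Lp ℝ 2 unitMeasure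

/-- Coefficients of the nominal coupled system
`X' = A X + B z(0,t)`,
`w_t = - Λ⁺ w_x + Σ⁺⁺ w + Σ⁺⁻ z`,  `z_t = Λ⁻ z_x + Σ⁻⁺ w + Σ⁻⁻ z`,
`w(0,t) = Q z(0,t) + C X`,  `z(1,t) = R w(1,t) + U`.
`Λ⁺` is diagonal and is given by its diagonal; columns and rows are plain vectors. -/
structure NominalSystem where
  A : Matrix (Fin 2) (Fin 2) ℝ
  B : Fin 2 → ℝ
  C : Matrix (Fin 3) (Fin 2) ℝ
  lamP : Fin 3 → ℝ
  lamM : ℝ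
  sigPP : Matrix (Fin 3) (Fin 3) ℝ
  sigPM : Fin 3 → ℝ
  sigMP : Fin 3 → ℝ
  sigMM : ℝ
  Q : Fin 3 → ℝ
  R : Fin 3 → ℝ

/-- A real matrix is Hurwitz if all its complex eigenvalues have negative real part. -/
def IsHurwitz (M : Matrix (Fin 2) (Fin 2) ℝ) : Prop :=
  ∀ μ ∈ spectrum ℂ (M.map (algebraMap ℝ ℂ)), μ.re < 0

/-- The closed-loop matrix `A + B κ` for a feedback row `κ`. -/
def feedbackMatrix (A : Matrix (Fin 2) (Fin 2) ℝ) (B κ : Fin 2 → ℝ) :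
    Matrix (Fin 2) (Fin 2) ℝ :=
  A + Matrix.vecMulVec B κ

/-- `(A, B)` is stabilizable. -/
def IsStabilizable (A : Matrix (Fin 2) (Fin 2) ℝ) (B : Fin 2 → ℝ) : Prop :=
  ∃ F : Fin 2 → ℝ, IsHurwitz (feedbackMatrix A B F)

/-- The triangle `0 ≤ ξ ≤ x ≤ 1`; its points are the pairs `(x, ξ)`. -/
def triangle : Set (ℝ × ℝ) := {p | 0 ≤ p.2 ∧ p.2 ≤ p.1 ∧ p.1 ≤ 1}

/-- Partial derivative on the triangle with respect to the first variable `x`. -/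
noncomputable def partialX (f : ℝ × ℝ → ℝ) (p : ℝ × ℝ) : ℝ :=
  fderivWithin ℝ f triangle p (1, 0)

/-- Partial derivative on the triangle with respect to the second variable `ξ`. -/
noncomputable def partialXi (f : ℝ × ℝ → ℝ) (p : ℝ × ℝ) : ℝ :=
  fderivWithin ℝ f triangle p (0, 1)

/-- The functions entering the backstepping transformation
`ρ(x) = z(x) - ∫₀ˣ K(x,ξ) w(ξ) dξ - ∫₀ˣ N(x,ξ) z(ξ) dξ - γ(x) X`. -/
structure BacksteppingKernels where
  K : ℝ × ℝ → Fin 3 → ℝ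
  N : ℝ × ℝ → ℝ
  γ : ℝ → Fin 2 → ℝ

/-- The kernel equations, in the classical (`C¹` up to the boundary) sense, with `γ(0) = κ`. -/
structure IsKernelSolution (S : NominalSystem) (κ : Fin 2 → ℝ) (k : BacksteppingKernels) :
    Prop where
  contDiff_K : ∀ i, ContDiffOn ℝ 1 (fun p => k.K p i) triangle
  contDiff_N : ContDiffOn ℝ 1 k.N triangle
  contDiff_γ : ∀ j, ContDiffOn ℝ 1 (fun x => k.γ x j) (Icc 0 1)
  eq_K : ∀ p ∈ triangle, ∀ i,
    S.lamM * partialX (fun q => k.K q i) p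
      = partialXi (fun q => k.K q i) p * S.lamP i + k.N p * S.sigMP i
        + ∑ j, k.K p j * S.sigPP j i - S.sigMM * k.K p i
  eq_N : ∀ p ∈ triangle,
    S.lamM * partialX k.N p + S.lamM * partialXi k.N p = ∑ i, k.K p i * S.sigPM i
  diag_K : ∀ x ∈ Icc (0 : ℝ) 1, ∀ i, k.K (x, x) i * (S.lamM + S.lamP i) = - S.sigMP i
  bdry_N : ∀ x ∈ Icc (0 : ℝ) 1,
    S.lamM * k.N (x, 0) - ∑ i, k.K (x, 0) i * S.lamP i * S.Q i = ∑ j, k.γ x j * S.B j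
  eq_γ : ∀ x ∈ Icc (0 : ℝ) 1, ∀ j,
    S.lamM * derivWithin (fun y => k.γ y j) (Icc 0 1) x
      = ∑ l, k.γ x l * S.A l j - S.sigMM * k.γ x j
        + ∑ i, k.K (x, 0) i * S.lamP i * S.C i j
  init_γ : k.γ 0 = κ

/-- The backstepping feedback
`U = - R w(1) + ∫₀¹ K(1,ξ) w(ξ) dξ + ∫₀¹ N(1,ξ) z(ξ) dξ + γ(1) X`,
where `wOne` stands for the boundary value `w(1)`. -/
noncomputable def backsteppingControl (S : NominalSystem) (k : BacksteppingKernels)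
    (wOne : Fin 3 → ℝ) (X : OdeState) (w : RightState) (z : LeftState) : ℝ :=
  - ∑ i, S.R i * wOne i
    + ∫ ξ, (∑ i, k.K (1, ξ) i * w ξ i) ∂unitMeasure
    + ∫ ξ, k.N (1, ξ) * z ξ ∂unitMeasure
    + ∑ j, k.γ 1 j * X j

/-- A function of time which is square integrable on every bounded interval `[0,T]`. -/
def IsLocallyL2 (f : ℝ → ℝ) : Prop :=
  ∀ T : ℝ, MemLp f 2 (volume.restrict (Icc 0 T))

/-- `(X, w, z)` satisfies the two transport equations and the ODE on `[0,∞)` weakly in space,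
with boundary values `w(0,·) = wZero`, `w(1,·) = wOne`, `z(0,·) = zZero`, `z(1,·) = zOne`
(these are determined almost everywhere by the integral identities). -/
structure IsWeakSolution (S : NominalSystem) (X : ℝ → OdeState) (w : ℝ → RightState)
    (z : ℝ → LeftState) (wZero wOne : ℝ → Fin 3 → ℝ) (zZero zOne : ℝ → ℝ) : Prop where
  cont_X : ContinuousOn X (Ici 0)
  cont_w : ContinuousOn w (Ici 0)
  cont_z : ContinuousOn z (Ici 0)
  wZero_L2 : ∀ i, IsLocallyL2 (fun t => wZero t i)
  wOne_L2 : ∀ i, IsLocallyL2 (fun t => wOne t i)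
  zZero_L2 : IsLocallyL2 zZero
  zOne_L2 : IsLocallyL2 zOne
  eq_X : ∀ t : ℝ, 0 ≤ t → ∀ j,
    X t j = X 0 j + ∫ s in (0 : ℝ)..t, (∑ l, S.A j l * X s l + S.B j * zZero s)
  eq_w : ∀ φ : ℝ → ℝ, ContDiff ℝ 1 φ → ∀ t : ℝ, 0 ≤ t → ∀ i,
    ∫ x, w t x i * φ x ∂unitMeasure
      = (∫ x, w 0 x i * φ x ∂unitMeasure)
        + ∫ s in (0 : ℝ)..t,
            (S.lamP i * (wZero s i * φ 0 - wOne s i * φ 1)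
              + ∫ x, (S.lamP i * w s x i * deriv φ x
                  + (∑ j, S.sigPP i j * w s x j + S.sigPM i * z s x) * φ x) ∂unitMeasure)
  eq_z : ∀ φ : ℝ → ℝ, ContDiff ℝ 1 φ → ∀ t : ℝ, 0 ≤ t →
    ∫ x, z t x * φ x ∂unitMeasure
      = (∫ x, z 0 x * φ x ∂unitMeasure)
        + ∫ s in (0 : ℝ)..t,
            (S.lamM * (zOne s * φ 1 - zZero s * φ 0)
              + ∫ x, (- (S.lamM * z s x * deriv φ x)
                  + (∑ j, S.sigMP j * w s x j + S.sigMM * z s x) * φ x) ∂unitMeasure)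

/-- `(X, w, z)` is a solution on `[0,∞)` of the nominal system in closed loop with the
backstepping feedback: it solves the equations weakly, and its boundary values satisfy
`w(0,t) = Q z(0,t) + C X(t)` and `z(1,t) = R w(1,t) + U(t)` for almost every `t ≥ 0`. -/
def IsClosedLoopSolution (S : NominalSystem) (k : BacksteppingKernels)
    (X : ℝ → OdeState) (w : ℝ → RightState) (z : ℝ → LeftState) : Prop :=
  ∃ (wZero wOne : ℝ → Fin 3 → ℝ) (zZero zOne : ℝ → ℝ),
    IsWeakSolution S X w z wZero wOne zZero zOne ∧
    (∀ᵐ t ∂(volume.restrict (Ici (0 : ℝ))), ∀ i,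
      wZero t i = S.Q i * zZero t + ∑ j, S.C i j * X t j) ∧
    (∀ᵐ t ∂(volume.restrict (Ici (0 : ℝ))),
      zOne t = ∑ i, S.R i * wOne t i + backsteppingControl S k (wOne t) (X t) (w t) (z t))

/-! The feedback is designed through the substitution ρ = z - ∫K w - ∫N z - γ X. The kernel
equations say exactly that ρ solves the autonomous transport equation ρ_t = Λ⁻ρ_x + Σ⁻⁻ρ, the
control makes ρ(1) = 0, and γ(0) = κ turns the ODE into X' = (A + Bκ)X + Bρ(0). So ρ drives X, and
both drive w. The loop that remains inside the domain (w and z act on each other pointwise in x) is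
harmless, because z is recovered from ρ, w and X by a Volterra relation, which is small in L² with
weight exp(-νx) once ν is large.

Kernels. K, N and γ form one linear transport system on the triangle: each component is transported
along straight lines on which x increases, starting from a part of the boundary where its value is
prescribed. Integration along these lines gains a factor x/(n+1) at the n-th iteration, for values
and for first derivatives, so the Picard series converges in C¹ up to the boundary. This is
`exists_transport_solution`, specialised in `exists_isKernelSolution`.

Decay. `IsGenerator.exists_backstep_primitive` carries out the change of variables for a state in
the domain of the generator. The functional V is a sum of the exp(μx)-weighted norm of ρ, a
quadratic Lyapunov form of A + Bκ in X, and the exp(-νx)-weighted norm of w.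
`exists_lyapunov_functional` chooses the weights so that V(Y,G) ≤ -c(V(Y,Y) + z(0)² + |w(1)|²)
whenever G is the derivative at Y. The two boundary terms on the right are as important as the decay
itself: they control the traces.

Existence. With respect to V the generator is dissipative, and it is maximal: the resolvent equation
is an ODE in x with three unknown initial parameters and three closing conditions, so uniqueness
gives solvability (`isMaxDissipative_generatorGraph`). Yosida approximation, done for relations in a
Hilbert space with an equivalent form V, yields differentiable solutions for data in the dense
domain (`exists_strict_solution`). The dissipated energy bounds the L² norm in time of their traces,
so both the states and the traces pass to the limit for arbitrary L² data
(`exists_isIntegratedSolution`).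

Every weak solution. Weak solutions need not be differentiable, but a solution integrated in time
satisfies the generator relation exactly. Hence the averages of a solution over [s, s+δ] are
differentiable and obey the Lyapunov inequality; δ → 0 gives the decay of the solution itself
(`IsIntegratedSolution.lyapunov_decay`). No uniqueness theorem is needed. -/

set_option linter.unusedSectionVars false

/-! ### Maximal dissipative relations in a Hilbert space and Yosida approximation. -/

section DissipativeRelations

open Filter Topology

variable {H : Type*} [NormedAddCommGroup H] [InnerProductSpace ℝ H]

/-- A linear relation that is maximal dissipative with respect to a symmetric coercive form. -/
structure IsMaxDissipative (V : H →L[ℝ] H →L[ℝ] ℝ) (Γ : Submodule ℝ (H × H)) : Prop where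
  symm : ∀ x y, V x y = V y x
  coercive : ∃ c > 0, ∀ x, c * ‖x‖ ^ 2 ≤ V x x
  diss : ∀ x y, (x, y) ∈ Γ → V x y ≤ 0
  range : ∀ l : ℝ, 0 < l → ∀ g, ∃ x y, (x, y) ∈ Γ ∧ l • x - y = g
  single : ∀ y, (0, y) ∈ Γ → y = 0

namespace IsMaxDissipative

variable {V : H →L[ℝ] H →L[ℝ] ℝ} {Γ : Submodule ℝ (H × H)}

lemma nonneg (h : IsMaxDissipative V Γ) (x : H) : 0 ≤ V x x := by
  obtain ⟨c, hc, hV⟩ := h.coercive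
  exact le_trans (by positivity) (hV x)

/-- Continuity and coercivity make V equivalent to the squared norm. All later contraction estimates
are proved in V and transferred by this lemma. -/
lemma exists_norm_bound (h : IsMaxDissipative V Γ) :
    ∃ M : ℝ, 0 < M ∧ ∀ x y, V x x ≤ V y y → ‖x‖ ≤ M * ‖y‖ := by
  obtain ⟨c, hc, hV⟩ := h.coercive
  refine ⟨√(‖V‖ / c) + 1, by positivity, fun x y hxy => ?_⟩
  have h1 : V y y ≤ ‖V‖ * ‖y‖ ^ 2 := by
    have := (Real.le_norm_self _).trans (V.le_opNorm₂ y y)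
    rw [sq, ← mul_assoc]; exact this
  have h2 : ‖x‖ ^ 2 ≤ (√(‖V‖ / c) * ‖y‖) ^ 2 := by
    rw [mul_pow, Real.sq_sqrt (by positivity), div_mul_eq_mul_div, le_div_iff₀ hc]
    nlinarith [hV x]
  have h3 := abs_le_of_sq_le_sq h2 (by positivity)
  nlinarith [norm_nonneg y, abs_le.1 h3]

/-- Expanding the right side, the cross term -2l V(x,y) is nonnegative by dissipativity and V(y,y)
is nonnegative by coercivity. This is what makes the resolvent a V-contraction. -/
lemma sq_mul_le (h : IsMaxDissipative V Γ) {x y : H} (hxy : (x, y) ∈ Γ) {l : ℝ} (hl : 0 < l) :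
    V (l • x) (l • x) ≤ V (l • x - y) (l • x - y) := by
  have h1 := h.diss x y hxy
  have h2 := h.nonneg y
  have h3 := h.symm x y
  simp only [map_sub, map_smul, sub_apply, smul_apply,
    smul_eq_mul]
  nlinarith

lemma eq_zero_of_smul_sub (h : IsMaxDissipative V Γ) {x y : H} (hxy : (x, y) ∈ Γ) {l : ℝ}
    (hl : 0 < l) (h0 : l • x - y = 0) : x = 0 := by
  obtain ⟨M, hM, hb⟩ := h.exists_norm_bound
  have := hb _ _ (h.sq_mul_le hxy hl)
  rw [h0, norm_zero, mul_zero, norm_smul] at this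
  have h2 : ‖x‖ ≤ 0 := by
    by_contra! hx
    have := mul_pos (norm_pos_iff.2 hl.ne') hx
    linarith
  simpa using h2

/-- J is l(l - Γ)⁻¹, normalised to be a contraction in V. The range condition gives existence,
`sq_mul_le` gives uniqueness, and linearity follows from uniqueness because Γ is a subspace. -/
lemma exists_resolvent (h : IsMaxDissipative V Γ) {l : ℝ} (hl : 0 < l) :
    ∃ J : H →L[ℝ] H, (∀ g, (J g, l • (J g - g)) ∈ Γ) ∧
      (∀ x y, (x, y) ∈ Γ → J (l • x - y) = l • x) ∧ ∀ g, V (J g) (J g) ≤ V g g := by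
  have key : ∀ g, ∃ x, (x, l • (x - g)) ∈ Γ := by
    intro g
    obtain ⟨x, y, hxy, hg⟩ := h.range l hl (l • g)
    refine ⟨x, ?_⟩
    have : l • (x - g) = y := by rw [smul_sub, ← hg]; abel
    rwa [this]
  choose f hf using key
  have uniq : ∀ {x x' g : H}, (x, l • (x - g)) ∈ Γ → (x', l • (x' - g)) ∈ Γ → x = x' := by
    intro x x' g h1 h2
    have h3 := Γ.sub_mem h1 h2
    rw [← sub_eq_zero]
    refine h.eq_zero_of_smul_sub (y := l • (x - g) - l • (x' - g)) h3 hl ?_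
    simp only [smul_sub]; abel
  obtain ⟨M, hM, hb⟩ := h.exists_norm_bound
  have hVf : ∀ g, V (f g) (f g) ≤ V g g := by
    intro g
    have h1 := h.sq_mul_le (hf g) hl
    have h2 : l • f g - l • (f g - g) = l • g := by rw [smul_sub]; abel
    rw [h2] at h1
    simp only [map_smul, smul_apply, smul_eq_mul] at h1
    have : 0 < l * l := by positivity
    nlinarith
  refine ⟨LinearMap.mkContinuous
    { toFun := f
      map_add' := fun a b => by
        have h1 := Γ.add_mem (hf a) (hf b)
        refine uniq (hf (a + b)) (g := a + b) ?_
        convert h1 using 1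
        ext <;> simp only [Prod.fst_add, Prod.snd_add, smul_sub, smul_add]
        abel
      map_smul' := fun r a => by
        have h1 := Γ.smul_mem r (hf a)
        refine uniq (hf (r • a)) (g := r • a) ?_
        convert h1 using 1
        ext <;> simp only [Prod.smul_fst, Prod.smul_snd, smul_sub, RingHom.id_apply, smul_comm l r] }
    M (fun g => hb _ _ (hVf g)), hf, ?_, hVf⟩
  intro x y hxy
  refine uniq (hf _) ?_
  convert Γ.smul_mem l hxy using 1
  ext <;> simp

variable [CompleteSpace H]

/-- By Lax–Milgram a vector orthogonal to the domain is represented as V(v, ·). Writing v = x - y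
with (x, y) in Γ and testing with x itself gives V(x,x) = V(y,x) ≤ 0. Hence x = 0, then y = 0 since
Γ is single valued at 0, and v = 0. -/
lemma dense_domain (h : IsMaxDissipative V Γ) : Dense {x | ∃ y, (x, y) ∈ Γ} := by
  let D : Submodule ℝ H := Γ.map (LinearMap.fst ℝ H H)
  have hD : (D : Set H) = {x | ∃ y, (x, y) ∈ Γ} := by
    ext x
    simp [D]
  rw [← hD]
  rw [Submodule.dense_iff_topologicalClosure_eq_top, Submodule.topologicalClosure_eq_top_iff,
    Submodule.eq_bot_iff]
  intro u hu
  have hco : IsCoercive V := by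
    obtain ⟨c, hc, hV⟩ := h.coercive
    exact ⟨c, hc, fun u => by have := hV u; rwa [sq, ← mul_assoc] at this⟩
  obtain ⟨v, rfl⟩ := hco.continuousLinearEquivOfBilin.surjective u
  obtain ⟨x, y, hxy, hv⟩ := h.range 1 one_pos v
  have hxD : x ∈ D := by
    change x ∈ (D : Set H)
    rw [hD]; exact ⟨y, hxy⟩
  have h1 : V v x = 0 := by
    rw [← hco.continuousLinearEquivOfBilin_apply]
    rw [real_inner_comm]
    exact hu x hxD
  rw [← hv] at h1
  simp only [one_smul, map_sub, sub_apply] at h1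
  have h2 := h.diss x y hxy
  rw [h.symm] at h2
  obtain ⟨c, hc, hV⟩ := h.coercive
  have h3 : c * ‖x‖ ^ 2 ≤ 0 := (hV x).trans (by linarith)
  have h4 : x = 0 := by
    have : ‖x‖ ^ 2 ≤ 0 := by
      by_contra! h5
      nlinarith
    simpa using this
  subst h4
  rw [h.single y hxy] at hv
  rw [← hv]; simp

/-- The resolvent describes Γ as the solution set of an equation between continuous maps. -/
lemma isClosed (h : IsMaxDissipative V Γ) : IsClosed (Γ : Set (H × H)) := by
  obtain ⟨J, hJ, hJ', -⟩ := h.exists_resolvent (l := 1) one_pos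
  have : (Γ : Set (H × H)) = {p | J (p.1 - p.2) = p.1} := by
    ext ⟨x, y⟩
    refine ⟨fun hxy => by simpa using hJ' x y hxy, fun hp => ?_⟩
    have h1 := hJ (x - y)
    simp only [mem_ofPred_eq] at hp
    rw [hp] at h1
    simpa using h1
  rw [this]
  exact isClosed_eq (by fun_prop) (by fun_prop)

lemma _root_.HasDerivAt.quadratic {V : H →L[ℝ] H →L[ℝ] ℝ} (hV : ∀ x y, V x y = V y x)
    {Y : ℝ → H} {Y' : H} {s : ℝ} (hY : HasDerivAt Y Y' s) :
    HasDerivAt (fun s : ℝ => V (Y s) (Y s)) (2 * V (Y s) Y') s := by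
  refine ((V.hasFDerivAt.comp_hasDerivAt s hY).clm_apply hY).congr_deriv ?_
  rw [hV Y', Function.comp_apply, two_mul]

lemma hasDerivAt_exp_apply (A : H →L[ℝ] H) (x : H) (s : ℝ) :
    HasDerivAt (fun s : ℝ => NormedSpace.exp (s • A) x) (A (NormedSpace.exp (s • A) x)) s := by
  have := (hasDerivAt_exp_smul_const' A s).clm_apply (hasDerivAt_const s x)
  simpa using this

lemma exp_apply_comm (A : H →L[ℝ] H) (x : H) (s : ℝ) :
    A (NormedSpace.exp (s • A) x) = NormedSpace.exp (s • A) (A x) := by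
  have : Commute A (NormedSpace.exp (s • A)) := ((Commute.refl A).smul_right s).exp_right
  exact congrArg (fun B : H →L[ℝ] H => B x) this.eq

lemma exp_quadratic_le {V : H →L[ℝ] H →L[ℝ] ℝ} (hV : ∀ x y, V x y = V y x) {A : H →L[ℝ] H}
    (hA : ∀ x, V x (A x) ≤ 0) (x : H) {t : ℝ} (ht : 0 ≤ t) :
    V (NormedSpace.exp (t • A) x) (NormedSpace.exp (t • A) x) ≤ V x x := by
  have hanti : Antitone
      (fun s : ℝ => V (NormedSpace.exp (s • A) x) (NormedSpace.exp (s • A) x)) := by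
    have hd := fun s => (hasDerivAt_exp_apply A x s).quadratic hV
    refine antitone_of_deriv_nonpos (fun s => (hd s).differentiableAt) fun s => ?_
    rw [(hd s).deriv]
    linarith [hA (NormedSpace.exp (s • A) x)]
  simpa using hanti ht

/-- The Yosida approximations of a maximal dissipative relation. -/
lemma exists_yosida (h : IsMaxDissipative V Γ) :
    ∃ (M : ℝ) (J A : ℕ → H →L[ℝ] H), 0 < M ∧ (∀ n g, (J n g, A n g) ∈ Γ) ∧
      (∀ n g, J n g = g + (1 / ((n : ℝ) + 1)) • A n g) ∧
      (∀ n x y, (x, y) ∈ Γ → A n x = J n y) ∧ (∀ n g, ‖J n g‖ ≤ M * ‖g‖) ∧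
      ∀ n g (t : ℝ), 0 ≤ t → ‖NormedSpace.exp (t • A n) g‖ ≤ M * ‖g‖ := by
  obtain ⟨M, hM, hb⟩ := h.exists_norm_bound
  choose J hJ hJ' hJV using fun n : ℕ => h.exists_resolvent (l := (n : ℝ) + 1) (by positivity)
  obtain ⟨A, hA⟩ : ∃ A : ℕ → H →L[ℝ] H, ∀ n g, A n g = ((n : ℝ) + 1) • (J n g - g) :=
    ⟨fun n => ((n : ℝ) + 1) • (J n - 1), fun n g => by simp⟩
  have hmem : ∀ n g, (J n g, A n g) ∈ Γ := fun n g => by rw [hA]; exact hJ n g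
  have hJA : ∀ n g, J n g = g + (1 / ((n : ℝ) + 1)) • A n g := by
    intro n g
    have : ((n : ℝ) + 1) ≠ 0 := by positivity
    rw [hA, smul_smul, one_div_mul_cancel this, one_smul]; abel
  -- Since x = J x - A x/(n+1), the dissipativity of Γ at (J x, A x) leaves only the extra term
  -- -V(Ax,Ax)/(n+1).
  have hVA : ∀ n x, V x (A n x) ≤ 0 := by
    intro n x
    have h1 : V (J n x) (A n x) ≤ 0 := h.diss _ _ (hmem n x)
    have h2 : V x (A n x) = V (J n x) (A n x) - 1 / ((n : ℝ) + 1) * V (A n x) (A n x) := by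
      rw [hJA]; simp
    have h3 := h.nonneg (A n x)
    have h4 : 0 ≤ 1 / ((n : ℝ) + 1) * V (A n x) (A n x) := by positivity
    linarith
  refine ⟨M, J, A, hM, hmem, hJA, fun n x y hxy => ?_, fun n g => hb _ _ (hJV n g), ?_⟩
  · have := hJ' n x y hxy
    rw [map_sub, map_smul, sub_eq_iff_eq_add] at this
    rw [hA, smul_sub, this]; abel
  · intro n g t ht
    exact hb _ _ (exp_quadratic_le h.symm (hVA n) g ht)

/-- The difference D of two approximate flows differs by O(1/(n+1) + 1/(m+1)) from the difference of
their resolvent images, to which dissipativity applies. So the derivative of V(D,D) is bounded by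
that error times a constant depending on y. -/
lemma yosida_dist_le (h : IsMaxDissipative V Γ) {M : ℝ} {J A : ℕ → H →L[ℝ] H} (hM : 0 < M)
    (hJA : ∀ n g, (J n g, A n g) ∈ Γ) (hJ : ∀ n g, J n g = g + (1 / ((n : ℝ) + 1)) • A n g)
    (hA : ∀ n x y, (x, y) ∈ Γ → A n x = J n y) (hJb : ∀ n g, ‖J n g‖ ≤ M * ‖g‖)
    (hE : ∀ n g (t : ℝ), 0 ≤ t → ‖NormedSpace.exp (t • A n) g‖ ≤ M * ‖g‖) {x y : H}
    (hxy : (x, y) ∈ Γ) :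
    ∃ C : ℝ, 0 ≤ C ∧ ∀ n m (t : ℝ), 0 ≤ t →
      ‖NormedSpace.exp (t • A n) x - NormedSpace.exp (t • A m) x‖ ^ 2
        ≤ C * t * (1 / ((n : ℝ) + 1) + 1 / ((m : ℝ) + 1)) := by
  obtain ⟨c, hc, hV⟩ := h.coercive
  set B : ℝ := M * (M * ‖y‖) with hB
  have hB0 : 0 ≤ B := by positivity
  refine ⟨4 * ‖V‖ * B ^ 2 / c, by positivity, fun n m t ht => ?_⟩
  -- Uniformity in n comes from the domain: A x = J y there, and A commutes with its own flow.
  have hAE : ∀ n (t : ℝ), 0 ≤ t → ‖A n (NormedSpace.exp (t • A n) x)‖ ≤ B := by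
    intro n t ht
    rw [exp_apply_comm, hA n x y hxy]
    exact (hE n _ t ht).trans (mul_le_mul_of_nonneg_left (hJb n y) hM.le)
  set e : ℝ := 1 / ((n : ℝ) + 1) + 1 / ((m : ℝ) + 1) with he
  let D : ℝ → H := fun t => NormedSpace.exp (t • A n) x - NormedSpace.exp (t • A m) x
  have hD : ∀ s, HasDerivAt D
      (A n (NormedSpace.exp (s • A n) x) - A m (NormedSpace.exp (s • A m) x)) s :=
    fun s => (hasDerivAt_exp_apply _ x s).sub (hasDerivAt_exp_apply _ x s)
  have hd : ∀ s, HasDerivAt (fun s => V (D s) (D s) - 4 * ‖V‖ * B ^ 2 * e * s) _ s :=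
    fun s => ((hD s).quadratic h.symm).sub ((hasDerivAt_id s).const_mul (4 * ‖V‖ * B ^ 2 * e))
  have key : ∀ s, 0 ≤ s → 2 * V (D s)
      (A n (NormedSpace.exp (s • A n) x) - A m (NormedSpace.exp (s • A m) x))
      ≤ 4 * ‖V‖ * B ^ 2 * e := by
    intro s hs
    set p := A n (NormedSpace.exp (s • A n) x) with hp
    set q := A m (NormedSpace.exp (s • A m) x) with hq
    have hmem := Γ.sub_mem (hJA n (NormedSpace.exp (s • A n) x))
      (hJA m (NormedSpace.exp (s • A m) x))
    have h1 : V (J n (NormedSpace.exp (s • A n) x) - J m (NormedSpace.exp (s • A m) x)) (p - q)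
        ≤ 0 := h.diss _ _ hmem
    have h2 : D s = (J n (NormedSpace.exp (s • A n) x) - J m (NormedSpace.exp (s • A m) x))
        - ((1 / ((n : ℝ) + 1)) • p - (1 / ((m : ℝ) + 1)) • q) := by
      rw [hJ, hJ]; simp only [D, hp, hq]; abel
    have h3 : ‖(1 / ((n : ℝ) + 1)) • p - (1 / ((m : ℝ) + 1)) • q‖ ≤ e * B := by
      refine (norm_sub_le _ _).trans ?_
      rw [norm_smul, norm_smul, Real.norm_of_nonneg (by positivity),
        Real.norm_of_nonneg (by positivity), he, add_mul]
      gcongr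
      · exact hAE n s hs
      · exact hAE m s hs
    have h4 : ‖p - q‖ ≤ 2 * B := by
      refine (norm_sub_le _ _).trans ?_
      linarith [hAE n s hs, hAE m s hs]
    have h5 := (abs_le.1 (V.le_opNorm₂
      ((1 / ((n : ℝ) + 1)) • p - (1 / ((m : ℝ) + 1)) • q) (p - q))).1
    have h6 : ‖V‖ * ‖(1 / ((n : ℝ) + 1)) • p - (1 / ((m : ℝ) + 1)) • q‖ * ‖p - q‖
        ≤ ‖V‖ * (e * B) * (2 * B) := by gcongr
    have h7 : V (D s) (p - q) = V (J n (NormedSpace.exp (s • A n) x)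
        - J m (NormedSpace.exp (s • A m) x)) (p - q)
        - V ((1 / ((n : ℝ) + 1)) • p - (1 / ((m : ℝ) + 1)) • q) (p - q) := by
      rw [h2, map_sub V, sub_apply]
    rw [h7]
    linarith
  have hanti : AntitoneOn (fun s => V (D s) (D s) - 4 * ‖V‖ * B ^ 2 * e * s) (Ici 0) := by
    refine antitoneOn_of_deriv_nonpos (convex_Ici 0)
      (fun s _ => (hd s).continuousAt.continuousWithinAt)
      (fun s _ => (hd s).differentiableAt.differentiableWithinAt) fun s hs => ?_
    rw [(hd s).deriv]
    rw [interior_Ici] at hs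
    linarith [key s (le_of_lt hs)]
  have h7 := hanti (mem_Ici.2 le_rfl) (mem_Ici.2 ht) ht
  have h8 := hV (D t)
  simp only [D, zero_smul, NormedSpace.exp_zero, sub_self, map_zero, mul_zero] at h7
  rw [div_mul_eq_mul_div, div_mul_eq_mul_div, le_div_iff₀ hc]
  simp only [D] at h8
  nlinarith

/-- Strict solutions of `Y' ∈ Γ Y` for initial data in the domain. -/
theorem exists_strict_solution (h : IsMaxDissipative V Γ) {x y : H} (hxy : (x, y) ∈ Γ) :
    ∃ Y Yd : ℝ → H, Continuous Y ∧ Continuous Yd ∧ Y 0 = x ∧ (∀ t, (Y t, Yd t) ∈ Γ) ∧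
      ∀ t, 0 ≤ t → Y t = x + ∫ s in (0 : ℝ)..t, Yd s := by
  obtain ⟨M, J, A, hM, hJA, hJ, hA, hJb, hE⟩ := h.exists_yosida
  let E : ℕ → ℝ → H → H := fun n t x => NormedSpace.exp (t • A n) x
  have hEsub : ∀ n (t : ℝ) a b, 0 ≤ t → ‖E n t a - E n t b‖ ≤ M * ‖a - b‖ := by
    intro n t a b ht
    simp only [E, ← map_sub]
    exact hE n _ t ht
  have hlim0 : Tendsto (fun n : ℕ => 1 / ((n : ℝ) + 1)) atTop (𝓝 0) :=
    tendsto_one_div_add_atTop_nhds_zero_nat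
  -- On the domain J b - b = J b'/(n+1); the uniform bound on J extends the convergence by density.
  have hJlim : ∀ a, Tendsto (fun n => J n a) atTop (𝓝 a) := by
    intro a
    rw [Metric.tendsto_atTop]
    intro ε hε
    obtain ⟨b, hab, b', hb⟩ := Metric.dense_iff.1 h.dense_domain a (ε / (2 * (M + 1)))
      (by positivity)
    rw [Metric.mem_ball, dist_eq_norm, lt_div_iff₀ (by positivity)] at hab
    have h1 : Tendsto (fun n : ℕ => 1 / ((n : ℝ) + 1) * (M * ‖b'‖)) atTop (𝓝 0) := by
      simpa using hlim0.mul_const (M * ‖b'‖)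
    obtain ⟨N, hN⟩ := (h1.eventually (gt_mem_nhds (half_pos hε))).exists_forall_of_atTop
    refine ⟨N, fun n hn => ?_⟩
    have h2 : ‖J n b - b‖ ≤ 1 / ((n : ℝ) + 1) * (M * ‖b'‖) := by
      rw [hJ, add_sub_cancel_left, norm_smul, Real.norm_of_nonneg (by positivity), hA n b b' hb]
      gcongr
      exact hJb n b'
    have h3 : J n a - a = (b - a) - J n (b - a) + (J n b - b) := by
      rw [map_sub]; abel
    rw [dist_eq_norm, h3]
    have h4 := norm_add_le ((b - a) - J n (b - a)) (J n b - b)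
    have h5 := norm_sub_le (b - a) (J n (b - a))
    have h6 := hJb n (b - a)
    have h7 := hN n hn
    linarith
  have hcauchy : ∀ a T, UniformCauchySeqOn (fun n t => E n t a) atTop (Icc 0 T) := by
    intro a T
    rw [Metric.uniformCauchySeqOn_iff]
    intro ε hε
    obtain ⟨b, hab, b', hb⟩ := Metric.dense_iff.1 h.dense_domain a (ε / (3 * M))
      (by positivity)
    rw [Metric.mem_ball, dist_comm, dist_eq_norm, lt_div_iff₀ (by positivity)] at hab
    obtain ⟨C, hC0, hC⟩ := h.yosida_dist_le hM hJA hJ hA hJb hE hb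
    have h1 : Tendsto (fun n : ℕ => C * |T| * (2 * (1 / ((n : ℝ) + 1)))) atTop (𝓝 0) := by
      simpa using (hlim0.const_mul 2).const_mul (C * |T|)
    obtain ⟨N, hN⟩ := (h1.eventually (gt_mem_nhds (show 0 < (ε / 3) ^ 2 by positivity))).exists
    refine ⟨N, fun m hm n hn t ht => ?_⟩
    have h2 : ‖E m t b - E n t b‖ ^ 2 ≤ (ε / 3) ^ 2 := by
      refine (hC m n t ht.1).trans (le_trans ?_ hN.le)
      have hT : t ≤ |T| := ht.2.trans (le_abs_self T)
      rw [two_mul]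
      have := ht.1
      gcongr
    have h3 : ‖E m t b - E n t b‖ ≤ ε / 3 := le_of_sq_le_sq h2 (by positivity)
    have h4 := hEsub m t a b ht.1
    have h5 := hEsub n t a b ht.1
    have h6 : E m t a - E n t a
        = (E m t a - E m t b) + (E m t b - E n t b) - (E n t a - E n t b) := by abel
    rw [dist_eq_norm, h6]
    have h7 := norm_sub_le ((E m t a - E m t b) + (E m t b - E n t b)) (E n t a - E n t b)
    have h8 := norm_add_le (E m t a - E m t b) (E m t b - E n t b)
    linarith
  have hptw : ∀ a t, ∃ l, 0 ≤ t → Tendsto (fun n => E n t a) atTop (𝓝 l) := by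
    intro a t
    by_cases ht : 0 ≤ t
    · obtain ⟨l, hl⟩ := cauchySeq_tendsto_of_complete ((hcauchy a t).cauchySeq ⟨ht, le_rfl⟩)
      exact ⟨l, fun _ => hl⟩
    · exact ⟨0, fun h => absurd h ht⟩
  choose S hS using hptw
  have hcont : ∀ n a, Continuous fun t : ℝ => E n t a := fun n a =>
    continuous_iff_continuousAt.2 fun t => (hasDerivAt_exp_apply (A n) a t).continuousAt
  have hScont : ∀ a, Continuous fun t => S a (max t 0) := by
    intro a
    have h1 : ∀ T, ContinuousOn (S a) (Icc 0 T) := fun T =>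
      ((hcauchy a T).tendstoUniformlyOn_of_tendsto fun t ht => hS a t ht.1).continuousOn
        (Frequently.of_forall fun n => (hcont n a).continuousOn)
    have h2 : ContinuousOn (S a) (Ici 0) := by
      intro t ht
      refine (h1 (t + 1) t ⟨ht, by linarith⟩).mono_of_mem_nhdsWithin ?_
      rw [← Ici_inter_Iic]
      exact inter_mem self_mem_nhdsWithin (mem_nhdsWithin_of_mem_nhds (Iic_mem_nhds (by linarith)))
    exact h2.comp_continuous (by fun_prop) fun t => le_max_right t 0
  have hJS : ∀ t, 0 ≤ t → Tendsto (fun n => E n t (J n y)) atTop (𝓝 (S y t)) := by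
    intro t ht
    have h1 : Tendsto (fun n => E n t (J n y) - E n t y) atTop (𝓝 0) := by
      refine squeeze_zero_norm (fun n => hEsub n t (J n y) y ht) ?_
      have := ((hJlim y).sub_const y).norm.const_mul M
      simpa using this
    simpa using h1.add (hS y t ht)
  have hAE : ∀ n t, A n (E n t x) = E n t (J n y) := by
    intro n t
    simp only [E]
    rw [exp_apply_comm, hA n x y hxy]
  -- The derivative is the limit flow applied to y, because A E x = E (J y) and J y → y. Freezing
  -- time at 0 for negative t gives curves continuous on all of ℝ.
  refine ⟨fun t => S x (max t 0), fun t => S y (max t 0), hScont x, hScont y, ?_, ?_, ?_⟩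
  · have := hS x 0 le_rfl
    simp only [E, zero_smul, NormedSpace.exp_zero] at this
    simpa using tendsto_nhds_unique this tendsto_const_nhds
  · intro t
    have ht : 0 ≤ max t 0 := le_max_right t 0
    have h1 : Tendsto (fun n => J n (E n (max t 0) x)) atTop (𝓝 (S x (max t 0))) := by
      have h2 : ∀ n, J n (E n (max t 0) x)
          = E n (max t 0) x + (1 / ((n : ℝ) + 1)) • E n (max t 0) (J n y) := fun n => by
        rw [hJ n (E n (max t 0) x), hAE]
      simp only [h2]
      simpa using (hS x _ ht).add (hlim0.smul (hJS _ ht))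
    refine h.isClosed.mem_of_tendsto (h1.prodMk_nhds (hJS _ ht)) (Eventually.of_forall fun n => ?_)
    rw [← hAE]
    exact hJA n _
  · intro t ht
    have h1 : ∀ n, E n t x = x + ∫ s in (0 : ℝ)..t, E n s (J n y) := by
      intro n
      have := intervalIntegral.integral_eq_sub_of_hasDerivAt (a := 0) (b := t)
        (f := fun s => E n s x) (f' := fun s => E n s (J n y))
        (fun s _ => by rw [← hAE]; exact hasDerivAt_exp_apply (A n) x s)
        ((hcont n _).intervalIntegrable _ _)
      rw [this]
      simp [E]
    have h2 : Tendsto (fun n => x + ∫ s in (0 : ℝ)..t, E n s (J n y)) atTop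
        (𝓝 (x + ∫ s in (0 : ℝ)..t, S y (max s 0))) := by
      refine tendsto_const_nhds.add
        (intervalIntegral.tendsto_integral_filter_of_dominated_convergence
          (fun _ => M * (M * ‖y‖)) (Eventually.of_forall fun n => (hcont n _).aestronglyMeasurable)
          (Eventually.of_forall fun n => Eventually.of_forall fun s hs => ?_)
          intervalIntegrable_const (Eventually.of_forall fun s hs => ?_))
      · rw [uIoc_of_le ht] at hs
        refine (hE n _ s hs.1.le).trans ?_
        gcongr
        exact hJb n y
      · rw [uIoc_of_le ht] at hs
        rw [max_eq_left hs.1.le]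
        exact hJS s hs.1.le
    have h3 := hS x t ht
    simp only [h1] at h3
    simp only [max_eq_left ht]
    exact tendsto_nhds_unique h3 h2

end IsMaxDissipative
end DissipativeRelations

/-! ### Picard series for linear transport systems on the triangle. -/

section TransportSeries

open Filter Topology

lemma isClosed_triangle : IsClosed triangle :=
  (isClosed_le continuous_const continuous_snd).inter
    ((isClosed_le continuous_snd continuous_fst).inter (isClosed_le continuous_fst continuous_const))

lemma convex_triangle : Convex ℝ triangle := by
  intro p hp q hq a b ha hb hab
  obtain ⟨h1, h2, h3⟩ := hp
  obtain ⟨h4, h5, h6⟩ := hq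
  refine ⟨?_, ?_, ?_⟩ <;> simp only [Prod.fst_add, Prod.snd_add, Prod.smul_fst, Prod.smul_snd,
    smul_eq_mul] <;> nlinarith

lemma interior_triangle_nonempty : (interior triangle).Nonempty := by
  refine ⟨(1 / 2, 1 / 4), mem_interior.2 ⟨{p | 0 < p.2} ∩ ({p | p.2 < p.1} ∩ {p | p.1 < 1}),
    fun p hp => ⟨hp.1.le, hp.2.1.le, hp.2.2.le⟩, ?_, ?_⟩⟩
  · exact (isOpen_lt continuous_const continuous_snd).inter
      ((isOpen_lt continuous_snd continuous_fst).inter (isOpen_lt continuous_fst continuous_const))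
  · refine ⟨?_, ?_, ?_⟩ <;> norm_num

lemma closure_interior_triangle : closure (interior triangle) = triangle := by
  rw [convex_triangle.closure_interior_eq_closure_of_nonempty_interior interior_triangle_nonempty,
    isClosed_triangle.closure_eq]

lemma uniqueDiffOn_triangle : UniqueDiffOn ℝ triangle :=
  uniqueDiffOn_convex convex_triangle interior_triangle_nonempty

lemma triangle_fst_nonneg {p : ℝ × ℝ} (hp : p ∈ triangle) : 0 ≤ p.1 := hp.1.trans hp.2.1

/-- Termwise differentiation of a series of `C¹` functions on the closed triangle. -/
lemma tsum_triangle {f : ℕ → ℝ × ℝ → ℝ} (hf : ∀ n, ContDiff ℝ 1 (f n)) {a b : ℕ → ℝ}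
    (ha : Summable a) (hb : Summable b) (hfa : ∀ n, ∀ p ∈ triangle, ‖f n p‖ ≤ a n)
    (hfb : ∀ n, ∀ p ∈ triangle, ‖fderiv ℝ (f n) p‖ ≤ b n) :
    ContDiffOn ℝ 1 (fun p => ∑' n, f n p) triangle ∧
      ∀ p ∈ triangle, HasSum (fun n => fderiv ℝ (f n) p)
        (fderivWithin ℝ (fun p => ∑' n, f n p) triangle p) := by
  have hcont : ContinuousOn (fun p => ∑' n, f n p) triangle :=
    continuousOn_tsum (fun n => (hf n).continuous.continuousOn) ha hfa
  have hcont' : ContinuousOn (fun p => ∑' n, fderiv ℝ (f n) p) triangle :=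
    continuousOn_tsum (fun n => ((hf n).continuous_fderiv one_ne_zero).continuousOn) hb hfb
  have hint : ∀ p ∈ interior triangle,
      HasFDerivAt (fun p => ∑' n, f n p) (∑' n, fderiv ℝ (f n) p) p := by
    intro p hp
    refine hasFDerivAt_tsum_of_isPreconnected hb isOpen_interior
      convex_triangle.interior.isPreconnected
      (fun n q _ => ((hf n).differentiable one_ne_zero q).hasFDerivAt)
      (fun n q hq => hfb n q (interior_subset hq)) hp ?_ hp
    exact Summable.of_norm_bounded ha fun n => hfa n p (interior_subset hp)
  have hder : ∀ p ∈ triangle, HasFDerivWithinAt (fun p => ∑' n, f n p)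
      (∑' n, fderiv ℝ (f n) p) triangle p := by
    intro p hp
    -- Termwise differentiation is available on the open interior. It extends to the boundary
    -- because the interior is convex, its closure is the triangle, and the series of derivatives is
    -- continuous up to the boundary.
    have := hasFDerivWithinAt_closure_of_tendsto_fderiv (f := fun p => ∑' n, f n p)
      (s := interior triangle) (x := p) (f' := ∑' n, fderiv ℝ (f n) p)
      (fun q hq => (hint q hq).differentiableAt.differentiableWithinAt)
      convex_triangle.interior isOpen_interior
      (fun q hq => by
        rw [closure_interior_triangle] at hq
        exact (hcont q hq).mono interior_subset) ?_
    · rwa [closure_interior_triangle] at this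
    · refine Tendsto.congr' ?_ ((hcont' p hp).mono interior_subset)
      filter_upwards [self_mem_nhdsWithin] with q hq
      exact (hint q hq).fderiv.symm
  have hfd : ∀ p ∈ triangle, fderivWithin ℝ (fun p => ∑' n, f n p) triangle p
      = ∑' n, fderiv ℝ (f n) p := fun p hp => (hder p hp).fderivWithin (uniqueDiffOn_triangle p hp)
  refine ⟨?_, fun p hp => ?_⟩
  · rw [show (1 : WithTop ℕ∞) = 0 + 1 from rfl,
      contDiffOn_succ_iff_fderivWithin uniqueDiffOn_triangle]
    exact ⟨fun p hp => (hder p hp).differentiableWithinAt, by simp,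
      contDiffOn_zero.2 (hcont'.congr hfd)⟩
  · rw [hfd p hp]
    exact (Summable.of_norm_bounded hb fun n => hfb n p hp).hasSum

lemma hasFDerivAt_parametric {F : ℝ × ℝ → ℝ → ℝ} {F' : ℝ × ℝ → ℝ → ℝ × ℝ →L[ℝ] ℝ}
    (hF : Continuous (Function.uncurry F)) (hF' : Continuous (Function.uncurry F'))
    (hd : ∀ p θ, HasFDerivAt (fun p => F p θ) (F' p θ) p) (p : ℝ × ℝ) :
    HasFDerivAt (fun p => ∫ θ in (0 : ℝ)..1, F p θ) (∫ θ in (0 : ℝ)..1, F' p θ) p := by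
  obtain ⟨C, hC⟩ := ((isCompact_closedBall p 1).prod (isCompact_Icc (a := (0 : ℝ)) (b := 1))).exists_bound_of_continuousOn
    hF'.continuousOn
  have hFc : ∀ q, Continuous (F q) := fun q => hF.comp (by fun_prop : Continuous fun θ => (q, θ))
  have hFc' : ∀ q, Continuous (F' q) := fun q => hF'.comp (by fun_prop : Continuous fun θ => (q, θ))
  refine intervalIntegral.hasFDerivAt_integral_of_dominated_of_fderiv_le (bound := fun _ => C)
    (Metric.closedBall_mem_nhds p one_pos)
    (Eventually.of_forall fun q => (hFc q).aestronglyMeasurable)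
    ((hFc p).intervalIntegrable _ _) (hFc' p).aestronglyMeasurable ?_ intervalIntegrable_const
    (Eventually.of_forall fun θ _ q _ => hd q θ)
  refine Eventually.of_forall fun θ hθ q hq => ?_
  rw [uIoc_of_le zero_le_one] at hθ
  exact hC (q, θ) ⟨hq, hθ.1.le, hθ.2⟩

/-- The integral of `f` along the segment from `P p` back to `P p - τ p • v`. -/
noncomputable def charIntegral (P : ℝ × ℝ →L[ℝ] ℝ × ℝ) (τ : ℝ × ℝ →L[ℝ] ℝ) (v : ℝ × ℝ)
    (f : ℝ × ℝ → ℝ) (p : ℝ × ℝ) : ℝ :=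
  τ p * ∫ θ in (0 : ℝ)..1, f (P p - (θ * τ p) • v)

variable {P : ℝ × ℝ →L[ℝ] ℝ × ℝ} {τ : ℝ × ℝ →L[ℝ] ℝ} {v : ℝ × ℝ} {f : ℝ × ℝ → ℝ}

lemma hasFDerivAt_charIntegral (hf : ContDiff ℝ 1 f) (p : ℝ × ℝ) :
    HasFDerivAt (charIntegral P τ v f)
      (τ p • (∫ θ in (0 : ℝ)..1, (fderiv ℝ f (P p - (θ * τ p) • v)).comp
          (P - θ • τ.smulRight v))
        + (∫ θ in (0 : ℝ)..1, f (P p - (θ * τ p) • v)) • τ) p := by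
  have hf' : Continuous (fderiv ℝ f) := hf.continuous_fderiv one_ne_zero
  refine τ.hasFDerivAt.mul (hasFDerivAt_parametric
    (F := fun p θ => f (P p - (θ * τ p) • v))
    (F' := fun p θ => (fderiv ℝ f (P p - (θ * τ p) • v)).comp (P - θ • τ.smulRight v))
    ?_ ?_ ?_ p)
  · exact hf.continuous.comp (by fun_prop)
  · refine Continuous.clm_comp (hf'.comp (by fun_prop)) (by fun_prop)
  · intro q θ
    have h1 : HasFDerivAt (fun p => P p - (θ * τ p) • v) (P - θ • τ.smulRight v) q := by
      have := P.hasFDerivAt (x := q) |>.sub ((θ • τ.smulRight v).hasFDerivAt (x := q))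
      refine this.congr_of_eventuallyEq (Eventually.of_forall fun r => ?_)
      simp [mul_smul]
    exact ((hf.differentiable one_ne_zero _).hasFDerivAt).comp q h1

lemma contDiff_charIntegral (hf : ContDiff ℝ 1 f) : ContDiff ℝ 1 (charIntegral P τ v f) := by
  have hf' : Continuous (fderiv ℝ f) := hf.continuous_fderiv one_ne_zero
  rw [contDiff_one_iff_fderiv]
  refine ⟨fun p => (hasFDerivAt_charIntegral hf p).differentiableAt, ?_⟩
  have : fderiv ℝ (charIntegral P τ v f) = _ :=
    funext fun p => (hasFDerivAt_charIntegral hf p).fderiv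
  rw [this]
  refine Continuous.add (τ.continuous.smul ?_)
    (Continuous.smul (f := fun p => ∫ θ in (0 : ℝ)..1, f (P p - (θ * τ p) • v))
      (g := fun _ => τ) ?_ continuous_const)
  · refine intervalIntegral.continuous_parametric_intervalIntegral_of_continuous' ?_ 0 1
    exact Continuous.clm_comp (hf'.comp (by fun_prop)) (by fun_prop)
  · refine intervalIntegral.continuous_parametric_intervalIntegral_of_continuous' ?_ 0 1
    exact hf.continuous.comp (by fun_prop)

/-- Along v the derivative of the integrand carries the factor 1 - θ, so the two terms of the
product rule combine to the θ-derivative of (θ - 1) f(P p - θ τ(p) v). Only its value at θ = 0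
contributes. -/
lemma fderiv_charIntegral_apply (hf : ContDiff ℝ 1 f) (hP : P v = v) (hτ : τ v = 1) (p : ℝ × ℝ) :
    fderiv ℝ (charIntegral P τ v f) p v = f (P p) := by
  have hf' : Continuous (fderiv ℝ f) := hf.continuous_fderiv one_ne_zero
  have hc : Continuous fun θ : ℝ => (fderiv ℝ f (P p - (θ * τ p) • v)).comp
      (P - θ • τ.smulRight v) :=
    Continuous.clm_comp (hf'.comp (by fun_prop)) (by fun_prop)
  have hc2 : Continuous fun θ : ℝ => f (P p - (θ * τ p) • v) := hf.continuous.comp (by fun_prop)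
  rw [(hasFDerivAt_charIntegral hf p).fderiv]
  simp only [add_apply, smul_apply, smul_eq_mul, hτ, mul_one]
  rw [ContinuousLinearMap.intervalIntegral_apply (hc.intervalIntegrable _ _)]
  have hd : ∀ θ : ℝ, HasDerivAt (fun θ : ℝ => (θ - 1) * f (P p - (θ * τ p) • v))
      (f (P p - (θ * τ p) • v) + τ p * (fderiv ℝ f (P p - (θ * τ p) • v)).comp
      (P - θ • τ.smulRight v) v) θ := by
    intro θ
    have h1 : HasDerivAt (fun θ : ℝ => P p - (θ * τ p) • v) (-(τ p • v)) θ := by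
      have := (((hasDerivAt_id θ).mul_const (τ p)).smul_const v).const_sub (P p)
      simpa using this
    have h2 := ((hf.differentiable one_ne_zero
      (P p - (θ * τ p) • v)).hasFDerivAt).comp_hasDerivAt θ h1
    refine (((hasDerivAt_id θ).sub_const 1).mul h2).congr_deriv ?_
    simp [hP, hτ]
    ring
  have hc3 : Continuous fun θ : ℝ => τ p * (fderiv ℝ f (P p - (θ * τ p) • v)).comp
      (P - θ • τ.smulRight v) v := continuous_const.mul (hc.clm_apply continuous_const)
  have := intervalIntegral.integral_eq_sub_of_hasDerivAt (a := 0) (b := 1) (fun θ _ => hd θ)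
    ((hc2.add hc3).intervalIntegrable _ _)
  rw [intervalIntegral.integral_add (hc2.intervalIntegrable _ _) (hc3.intervalIntegrable _ _),
    intervalIntegral.integral_const_mul] at this
  rw [add_comm, this]
  simp

/-- A family of characteristic segments that stays in the triangle. -/
structure IsCharFamily (Λ : ℝ) (P : ℝ × ℝ →L[ℝ] ℝ × ℝ) (τ : ℝ × ℝ →L[ℝ] ℝ) (v : ℝ × ℝ) :
    Prop where
  nonneg : ∀ p ∈ triangle, 0 ≤ τ p
  mem : ∀ p ∈ triangle, ∀ θ ∈ Icc (0 : ℝ) 1, P p - (θ * τ p) • v ∈ triangle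
  fst : ∀ p, (P p).1 = p.1
  fst_v : v.1 = Λ
  τ_v : τ v = 1
  P_v : P v = v

/-- Along a characteristic the first coordinate decreases at rate Λ, so integrating its n-th power
gains 1/(n+1); the lower endpoint of the primitive has a favourable sign and is dropped. This gain
is the source of the factorials that make the Picard series converge. -/
lemma IsCharFamily.norm_integral_le {Λ : ℝ} (h : IsCharFamily Λ P τ v) (hΛ : 0 < Λ)
    {F : Type*} [NormedAddCommGroup F] [NormedSpace ℝ F] {g : ℝ → F} {A : ℝ} {n : ℕ}
    {p : ℝ × ℝ} (hp : p ∈ triangle)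
    (hg : ∀ θ ∈ Icc (0 : ℝ) 1, ‖g θ‖ ≤ A * (P p - (θ * τ p) • v).1 ^ n) (hA : 0 ≤ A) :
    ‖τ p • ∫ θ in (0 : ℝ)..1, g θ‖ ≤ Λ⁻¹ * A * (p.1 ^ (n + 1) / (n + 1)) := by
  have hτ := h.nonneg p hp
  have e : ∀ θ : ℝ, (P p - (θ * τ p) • v).1 = p.1 - θ * (Λ * τ p) := by
    intro θ
    simp only [Prod.fst_sub, h.fst, Prod.smul_fst, h.fst_v, smul_eq_mul]; ring
  have h1 : ‖∫ θ in (0 : ℝ)..1, g θ‖ ≤ ∫ θ in (0 : ℝ)..1, A * (p.1 - θ * (Λ * τ p)) ^ n := by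
    refine intervalIntegral.norm_integral_le_of_norm_le zero_le_one
      (Eventually.of_forall fun θ hθ => ?_) (Continuous.intervalIntegrable (by fun_prop) _ _)
    rw [← e]
    exact hg θ ⟨hθ.1.le, hθ.2⟩
  have hd : ∀ θ : ℝ, HasDerivAt
      (fun θ : ℝ => -(Λ⁻¹ * A * ((p.1 - θ * (Λ * τ p)) ^ (n + 1) / (n + 1))))
      (τ p * (A * (p.1 - θ * (Λ * τ p)) ^ n)) θ := by
    intro θ
    have := ((((hasDerivAt_id θ).mul_const (Λ * τ p)).const_sub p.1).pow (n + 1)).div_const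
      ((n : ℝ) + 1) |>.const_mul (Λ⁻¹ * A) |>.neg
    refine this.congr_deriv ?_
    have : ((n : ℝ) + 1) ≠ 0 := by positivity
    push_cast
    simp
    field_simp
  have h2 := intervalIntegral.integral_eq_sub_of_hasDerivAt (a := 0) (b := 1) (fun θ _ => hd θ)
    (Continuous.intervalIntegrable (by fun_prop) _ _)
  rw [intervalIntegral.integral_const_mul] at h2
  rw [norm_smul, Real.norm_of_nonneg hτ]
  refine (mul_le_mul_of_nonneg_left h1 hτ).trans ?_
  rw [h2]
  have h3 : 0 ≤ (p.1 - 1 * (Λ * τ p)) := by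
    rw [← e]; exact triangle_fst_nonneg (h.mem p hp 1 ⟨zero_le_one, le_rfl⟩)
  have h4 : 0 ≤ Λ⁻¹ * A * ((p.1 - 1 * (Λ * τ p)) ^ (n + 1) / (n + 1)) := by positivity
  simp only [zero_mul, sub_zero]
  linarith

lemma IsCharFamily.norm_charIntegral_le {Λ : ℝ} (h : IsCharFamily Λ P τ v) (hΛ : 0 < Λ)
    {A : ℝ} {n : ℕ} (hA : 0 ≤ A) (hf : ∀ q ∈ triangle, ‖f q‖ ≤ A * q.1 ^ n)
    {p : ℝ × ℝ} (hp : p ∈ triangle) :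
    ‖charIntegral P τ v f p‖ ≤ Λ⁻¹ * A * (p.1 ^ (n + 1) / (n + 1)) :=
  h.norm_integral_le hΛ hp (fun θ hθ => hf _ (h.mem p hp θ hθ)) hA

/-- Differentiating the length τ of the segment costs one value of f and gains no power;
differentiating the integrand gains a power as before. The separate exponents k and n allow both
contributions to have the same order when k = n + 1. -/
lemma IsCharFamily.norm_fderiv_charIntegral_le {Λ : ℝ} (h : IsCharFamily Λ P τ v) (hΛ : 0 < Λ)
    (hfd : ContDiff ℝ 1 f) {A A' : ℝ} {n k : ℕ} (hA : 0 ≤ A) (hA' : 0 ≤ A')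
    (hf : ∀ q ∈ triangle, ‖f q‖ ≤ A * q.1 ^ k)
    (hf' : ∀ q ∈ triangle, ‖fderiv ℝ f q‖ ≤ A' * q.1 ^ n)
    {p : ℝ × ℝ} (hp : p ∈ triangle) :
    ‖fderiv ℝ (charIntegral P τ v f) p‖
      ≤ ‖τ‖ * (A * p.1 ^ k) + Λ⁻¹ * (A' * (‖P‖ + ‖τ‖ * ‖v‖)) * (p.1 ^ (n + 1) / (n + 1)) := by
  rw [(hasFDerivAt_charIntegral hfd p).fderiv, add_comm]
  refine (norm_add_le _ _).trans (add_le_add ?_ ?_)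
  · rw [norm_smul, mul_comm]
    gcongr
    have := intervalIntegral.norm_integral_le_of_norm_le_const (a := 0) (b := 1)
      (f := fun θ => f (P p - (θ * τ p) • v)) (C := A * p.1 ^ k) ?_
    · simpa using this
    · intro θ hθ
      rw [uIoc_of_le zero_le_one] at hθ
      have hm := h.mem p hp θ ⟨hθ.1.le, hθ.2⟩
      refine (hf _ hm).trans ?_
      have h0 := triangle_fst_nonneg hm
      have : (P p - (θ * τ p) • v).1 ≤ p.1 := by
        simp only [Prod.fst_sub, h.fst, Prod.smul_fst, h.fst_v, smul_eq_mul]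
        have := mul_nonneg (mul_nonneg hθ.1.le (h.nonneg p hp)) hΛ.le
        linarith
      gcongr
  · refine h.norm_integral_le hΛ hp (fun θ hθ => ?_) (by positivity)
    refine (ContinuousLinearMap.opNorm_comp_le _ _).trans ?_
    have h1 := hf' _ (h.mem p hp θ hθ)
    have h2 : ‖P - θ • τ.smulRight v‖ ≤ ‖P‖ + ‖τ‖ * ‖v‖ := by
      refine (norm_sub_le _ _).trans ?_
      rw [norm_smul, ContinuousLinearMap.norm_smulRight_apply, Real.norm_of_nonneg hθ.1]
      have : θ * (‖τ‖ * ‖v‖) ≤ 1 * (‖τ‖ * ‖v‖) := by gcongr; exact hθ.2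
      linarith
    have h3 := triangle_fst_nonneg (h.mem p hp θ hθ)
    calc _ ≤ (A' * (P p - (θ * τ p) • v).1 ^ n) * (‖P‖ + ‖τ‖ * ‖v‖) := by gcongr
      _ = _ := by ring

lemma norm_sum_mul_le {ι : Type*} [Fintype ι] (m : ι → ι → ℝ) (c : ι) {F : Type*}
    [NormedAddCommGroup F] [NormedSpace ℝ F] {a : ι → F} {A : ℝ} (ha : ∀ e, ‖a e‖ ≤ A) :
    ‖∑ e, m c e • a e‖ ≤ (∑ c, ∑ e, |m c e|) * A := by
  have hA : ∀ e, |m c e| * ‖a e‖ ≤ |m c e| * A := fun e => by gcongr; exact ha e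
  refine (norm_sum_le _ _).trans ?_
  simp only [norm_smul, Real.norm_eq_abs]
  refine (Finset.sum_le_sum fun e _ => hA e).trans ?_
  rw [← Finset.sum_mul]
  by_cases hι : Nonempty ι
  · have hA0 : 0 ≤ A := (norm_nonneg _).trans (ha hι.some)
    exact mul_le_mul_of_nonneg_right (Finset.single_le_sum (f := fun c => ∑ e, |m c e|)
      (fun c _ => Finset.sum_nonneg fun e _ => abs_nonneg _) (Finset.mem_univ c)) hA0
  · rw [not_nonempty_iff] at hι
    simp

/-! ### The iteration: sources along characteristics and reflection through π. -/

section Iteration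

variable {ι : Type*} [Fintype ι] (P : ι → ℝ × ℝ →L[ℝ] ℝ × ℝ) (τ : ι → ℝ × ℝ →L[ℝ] ℝ)
  (v : ι → ℝ × ℝ) (m β : ι → ι → ℝ) (d : ι → ℝ) (π : ℝ × ℝ →L[ℝ] ℝ × ℝ)

/-- Integration of the sources along the characteristics. -/
noncomputable def sourceIntegral (u : ι → ℝ × ℝ → ℝ) (c : ι) : ℝ × ℝ → ℝ :=
  charIntegral (P c) (τ c) (v c) fun q => ∑ e, m c e • u e q

/-- The terms of the Picard series of a transport system on the triangle. -/
noncomputable def picardTerm : ℕ → ι → ℝ × ℝ → ℝ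
  | 0, c, _ => d c + ∑ e, β c e • d e
  | n + 1, c, p => sourceIntegral P τ v m (picardTerm n) c p
      + ∑ e, β c e • sourceIntegral P τ v m (picardTerm n) e (π p)

variable {P τ v m β d π}

lemma contDiff_sourceIntegral {u : ι → ℝ × ℝ → ℝ} (hu : ∀ c, ContDiff ℝ 1 (u c)) (c : ι) :
    ContDiff ℝ 1 (sourceIntegral P τ v m u c) :=
  contDiff_charIntegral (ContDiff.sum fun e _ => (hu e).const_smul (m c e))

lemma contDiff_picardTerm (n : ℕ) (c : ι) : ContDiff ℝ 1 (picardTerm P τ v m β d π n c) := by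
  induction n generalizing c with
  | zero => exact contDiff_const
  | succ n ih =>
    exact (contDiff_sourceIntegral ih c).add (ContDiff.sum fun e _ =>
      ((contDiff_sourceIntegral ih e).comp π.contDiff).const_smul (β c e))

lemma fderiv_picardTerm_succ (n : ℕ) (c : ι) (p : ℝ × ℝ) :
    fderiv ℝ (picardTerm P τ v m β d π (n + 1) c) p
      = fderiv ℝ (sourceIntegral P τ v m (picardTerm P τ v m β d π n) c) p
        + ∑ e, β c e • (fderiv ℝ (sourceIntegral P τ v m (picardTerm P τ v m β d π n) e)
          (π p)).comp π := by
  have hB := fun e => (contDiff_sourceIntegral (P := P) (τ := τ) (v := v) (m := m)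
    (contDiff_picardTerm (P := P) (τ := τ) (v := v) (m := m) (β := β) (d := d) (π := π) n)
    e).differentiable one_ne_zero
  refine HasFDerivAt.fderiv ?_
  refine (hB c p).hasFDerivAt.add (HasFDerivAt.fun_sum fun e _ => ?_)
  exact ((hB e (π p)).hasFDerivAt.comp p π.hasFDerivAt).const_smul (β c e)

/-- The reflected part depends on p only through π p, and π is constant along the characteristics of
every component that has a reflected part. So only the source integral is seen by this derivative.
-/
lemma fderiv_picardTerm_succ_apply {Λ : ℝ} (hchar : ∀ c, IsCharFamily Λ (P c) (τ c) (v c))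
    (hπv : ∀ c e, β c e ≠ 0 → π (v c) = 0) (n : ℕ) (c : ι) (p : ℝ × ℝ) :
    fderiv ℝ (picardTerm P τ v m β d π (n + 1) c) p (v c)
      = ∑ e, m c e • picardTerm P τ v m β d π n e (P c p) := by
  rw [fderiv_picardTerm_succ, add_apply, sum_apply]
  have h1 : ∀ e ∈ Finset.univ, (β c e • (fderiv ℝ (sourceIntegral P τ v m
      (picardTerm P τ v m β d π n) e) (π p)).comp π) (v c) = 0 := by
    intro e _
    by_cases h : β c e = 0
    · simp [h]
    · simp [hπv c e h]
  rw [Finset.sum_eq_zero h1, add_zero]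
  exact fderiv_charIntegral_apply (ContDiff.sum fun e _ =>
    (contDiff_picardTerm n e).const_smul (m c e)) (hchar c).P_v (hchar c).τ_v p

/-- A component entering a boundary condition has no reflection of its own. The boundary coupling
therefore closes after one step, and the explicit formula for the terms already satisfies it. -/
lemma picardTerm_succ_boundary (hββ : ∀ c e, β c e ≠ 0 → ∀ e', β e e' = 0) (n : ℕ) (c : ι)
    {p : ℝ × ℝ} (hp : τ c p = 0) :
    picardTerm P τ v m β d π (n + 1) c p
      = ∑ e, β c e • picardTerm P τ v m β d π (n + 1) e (π p) := by
  have h0 : sourceIntegral P τ v m (picardTerm P τ v m β d π n) c p = 0 := by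
    simp [sourceIntegral, charIntegral, hp]
  rw [picardTerm, h0, zero_add]
  refine Finset.sum_congr rfl fun e _ => ?_
  by_cases h : β c e = 0
  · simp [h]
  · simp [picardTerm, hββ c e h]

lemma picardTerm_zero_boundary (hββ : ∀ c e, β c e ≠ 0 → ∀ e', β e e' = 0) (c : ι) (p : ℝ × ℝ) :
    picardTerm P τ v m β d π 0 c p
      = d c + ∑ e, β c e • picardTerm P τ v m β d π 0 e (π p) := by
  rw [picardTerm]
  congr 1
  refine Finset.sum_congr rfl fun e _ => ?_
  by_cases h : β c e = 0
  · simp [h]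
  · simp [picardTerm, hββ c e h]

-- Values and derivatives are both bounded factorially with a matching power of x. The derivative
-- estimate starts one index later because the zeroth term is constant, and its base is 2M rather
-- than M because two contributions add up at each iteration.
set_option maxHeartbeats 1000000 in
lemma exists_picardTerm_bound {Λ : ℝ} (hΛ : 0 < Λ)
    (hchar : ∀ c, IsCharFamily Λ (P c) (τ c) (v c)) (hπ : ∀ p ∈ triangle, π p ∈ triangle)
    (hπ1 : ∀ p ∈ triangle, (π p).1 ≤ p.1) :
    ∃ D M : ℝ, 0 ≤ D ∧ 0 ≤ M ∧ ∀ n c, ∀ p ∈ triangle,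
      ‖picardTerm P τ v m β d π n c p‖ ≤ D * M ^ n / n.factorial * p.1 ^ n ∧
      ‖fderiv ℝ (picardTerm P τ v m β d π (n + 1) c) p‖
        ≤ D * (M * (2 * M) ^ n) / n.factorial * p.1 ^ n := by
  set mb : ℝ := ∑ c, ∑ e, |m c e| with hmb
  set bb : ℝ := ∑ c, ∑ e, |β c e| with hbb
  have hmb0 : 0 ≤ mb := Finset.sum_nonneg fun c _ => Finset.sum_nonneg fun e _ => abs_nonneg _
  have hbb0 : 0 ≤ bb := Finset.sum_nonneg fun c _ => Finset.sum_nonneg fun e _ => abs_nonneg _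
  set α : ℝ := Λ⁻¹ + ∑ c, ‖τ c‖ + ∑ c, Λ⁻¹ * (‖P c‖ + ‖τ c‖ * ‖v c‖) with hα
  have hs1 : 0 ≤ ∑ c, ‖τ c‖ := Finset.sum_nonneg fun c _ => norm_nonneg _
  have hs2 : 0 ≤ ∑ c, Λ⁻¹ * (‖P c‖ + ‖τ c‖ * ‖v c‖) :=
    Finset.sum_nonneg fun c _ => by positivity
  have hΛi : 0 < Λ⁻¹ := by positivity
  have hα0 : 0 ≤ α := by positivity
  have hα1 : Λ⁻¹ ≤ α := by linarith
  have hα2 : ∀ c, ‖τ c‖ ≤ α := fun c => by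
    have := Finset.single_le_sum (f := fun c => ‖τ c‖) (fun c _ => norm_nonneg _)
      (Finset.mem_univ c)
    linarith
  have hα3 : ∀ c, Λ⁻¹ * (‖P c‖ + ‖τ c‖ * ‖v c‖) ≤ α := fun c => by
    have := Finset.single_le_sum (f := fun c => Λ⁻¹ * (‖P c‖ + ‖τ c‖ * ‖v c‖))
      (fun c _ => by positivity) (Finset.mem_univ c)
    linarith
  set M : ℝ := (1 + bb * (1 + ‖π‖)) * (α * mb) with hM
  have hM0 : 0 ≤ M := by positivity
  set D : ℝ := ∑ c, ‖d c + ∑ e, β c e • d e‖ with hD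
  have hD0 : 0 ≤ D := Finset.sum_nonneg fun c _ => norm_nonneg _
  have hB : ∀ (u : ι → ℝ × ℝ → ℝ) (A : ℝ) (n : ℕ), 0 ≤ A →
      (∀ c, ∀ p ∈ triangle, ‖u c p‖ ≤ A * p.1 ^ n) → ∀ c, ∀ p ∈ triangle,
      ‖sourceIntegral P τ v m u c p‖ ≤ α * mb * (A / (n + 1)) * p.1 ^ (n + 1) := by
    intro u A n hA hu c p hp
    have := (hchar c).norm_charIntegral_le hΛ (A := mb * A) (n := n)
      (f := fun q => ∑ e, m c e • u e q) (by positivity) (fun q hq => by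
        rw [mul_assoc]
        exact norm_sum_mul_le m c fun e => hu e q hq) hp
    refine this.trans ?_
    have hx := triangle_fst_nonneg hp
    calc Λ⁻¹ * (mb * A) * (p.1 ^ (n + 1) / (n + 1))
        ≤ α * (mb * A) * (p.1 ^ (n + 1) / (n + 1)) := by gcongr
      _ = _ := by ring
  have hB' : ∀ (u : ι → ℝ × ℝ → ℝ) (A A' : ℝ) (n k : ℕ), 0 ≤ A → 0 ≤ A' →
      (∀ c, ContDiff ℝ 1 (u c)) →
      (∀ c, ∀ p ∈ triangle, ‖u c p‖ ≤ A * p.1 ^ k) →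
      (∀ c, ∀ p ∈ triangle, ‖fderiv ℝ (u c) p‖ ≤ A' * p.1 ^ n) → ∀ c, ∀ p ∈ triangle,
      ‖fderiv ℝ (sourceIntegral P τ v m u c) p‖
        ≤ α * mb * (A * p.1 ^ k + A' / (n + 1) * p.1 ^ (n + 1)) := by
    intro u A A' n k hA hA' hud hu hu' c p hp
    have := (hchar c).norm_fderiv_charIntegral_le hΛ (A := mb * A) (A' := mb * A') (n := n) (k := k)
      (f := fun q => ∑ e, m c e • u e q) (ContDiff.sum fun e _ => (hud e).const_smul (m c e))
      (by positivity) (by positivity) (fun q hq => by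
        rw [mul_assoc]
        exact norm_sum_mul_le m c fun e => hu e q hq) (fun q hq => by
        have h1 : fderiv ℝ (fun q => ∑ e, m c e • u e q) q = ∑ e, m c e • fderiv ℝ (u e) q :=
          (HasFDerivAt.fun_sum fun e _ =>
            ((hud e).differentiable one_ne_zero q).hasFDerivAt.const_smul (m c e)).fderiv
        rw [h1, mul_assoc]
        exact norm_sum_mul_le m c fun e => hu' e q hq) hp
    refine this.trans ?_
    have hx := triangle_fst_nonneg hp
    calc ‖τ c‖ * (mb * A * p.1 ^ k)
          + Λ⁻¹ * (mb * A' * (‖P c‖ + ‖τ c‖ * ‖v c‖)) * (p.1 ^ (n + 1) / (n + 1))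
        = ‖τ c‖ * (mb * A * p.1 ^ k)
          + (Λ⁻¹ * (‖P c‖ + ‖τ c‖ * ‖v c‖)) * (mb * A' * (p.1 ^ (n + 1) / (n + 1))) := by ring
      _ ≤ α * (mb * A * p.1 ^ k) + α * (mb * A' * (p.1 ^ (n + 1) / (n + 1))) := by
          gcongr
          · exact hα2 c
          · exact hα3 c
      _ = _ := by ring
  have hval : ∀ n c, ∀ p ∈ triangle,
      ‖picardTerm P τ v m β d π n c p‖ ≤ D * M ^ n / n.factorial * p.1 ^ n := by
    intro n
    induction n with
    | zero =>
      intro c p hp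
      simpa [picardTerm, hD] using Finset.single_le_sum (f := fun c => ‖d c + ∑ e, β c e • d e‖)
        (fun c _ => norm_nonneg _) (Finset.mem_univ c)
    | succ n ih =>
      intro c p hp
      have h1 := hB _ _ n (by positivity) ih
      have hx := triangle_fst_nonneg hp
      have h2 : ∀ e, ‖sourceIntegral P τ v m (picardTerm P τ v m β d π n) e (π p)‖
          ≤ α * mb * (D * M ^ n / n.factorial / (n + 1)) * p.1 ^ (n + 1) := by
        intro e
        refine (h1 e _ (hπ p hp)).trans ?_
        have := triangle_fst_nonneg (hπ p hp)
        gcongr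
        exact hπ1 p hp
      rw [picardTerm]
      refine (norm_add_le _ _).trans ((add_le_add (h1 c p hp) (norm_sum_mul_le β c h2)).trans ?_)
      rw [← hbb]
      have e1 : (1 + bb) * (α * mb) ≤ M := by
        rw [hM]; gcongr
        have := norm_nonneg π
        nlinarith
      have e2 : D * M ^ (n + 1) / (n + 1).factorial * p.1 ^ (n + 1)
          = M * (D * M ^ n / n.factorial / (n + 1) * p.1 ^ (n + 1)) := by
        rw [Nat.factorial_succ]; push_cast; field_simp; ring
      rw [e2]
      calc _ = (1 + bb) * (α * mb) * (D * M ^ n / n.factorial / (n + 1) * p.1 ^ (n + 1)) := by ring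
        _ ≤ _ := by gcongr
  have hfd : ∀ (u : ι → ℝ × ℝ →L[ℝ] ℝ) (w : ι → ℝ × ℝ →L[ℝ] ℝ) (A : ℝ), 0 ≤ A →
      (∀ e, ‖u e‖ ≤ α * mb * A) → (∀ e, ‖w e‖ ≤ α * mb * A) → ∀ c,
      ‖u c + ∑ e, β c e • (w e).comp π‖ ≤ M * A := by
    intro u w A hA hu hw c
    have h1 : ∀ e, ‖(w e).comp π‖ ≤ (1 + ‖π‖) * (α * mb * A) := by
      intro e
      refine (ContinuousLinearMap.opNorm_comp_le _ _).trans ?_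
      rw [mul_comm]
      gcongr
      · linarith
      · exact hw e
    refine (norm_add_le _ _).trans ((add_le_add (hu c) (norm_sum_mul_le β c h1)).trans ?_)
    rw [← hbb, hM]
    exact le_of_eq (by ring)
  have hder : ∀ n c, ∀ p ∈ triangle, ‖fderiv ℝ (picardTerm P τ v m β d π (n + 1) c) p‖
        ≤ D * (M * (2 * M) ^ n) / n.factorial * p.1 ^ n := by
    intro n
    induction n with
    | zero =>
      intro c p hp
      rw [fderiv_picardTerm_succ]
      have h0 := hB' (picardTerm P τ v m β d π 0) D 0 0 0 hD0 le_rfl (contDiff_picardTerm 0)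
        (fun c p hp => by simpa using hval 0 c p hp) (fun c p hp => by
          have : picardTerm P τ v m β d π 0 c = fun _ => d c + ∑ e, β c e • d e := by
            funext q; rw [picardTerm]
          rw [this]; simp)
      have := hfd _ (fun e => fderiv ℝ (sourceIntegral P τ v m (picardTerm P τ v m β d π 0) e)
          (π p)) D hD0 (fun e => by simpa using h0 e p hp)
        (fun e => by simpa using h0 e _ (hπ p hp)) c
      refine this.trans (le_of_eq ?_)
      simp; ring
    | succ n ih =>
      intro c p hp
      rw [fderiv_picardTerm_succ]
      have h0 := hB' (picardTerm P τ v m β d π (n + 1)) _ _ n (n + 1) (by positivity)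
        (by positivity) (contDiff_picardTerm (n + 1)) (hval (n + 1)) ih
      have hx := triangle_fst_nonneg hp
      have hx' := triangle_fst_nonneg (hπ p hp)
      set A : ℝ := D * M ^ (n + 1) / (n + 1).factorial * p.1 ^ (n + 1)
        + D * (M * (2 * M) ^ n) / n.factorial / (n + 1) * p.1 ^ (n + 1) with hA
      have := hfd _ (fun e => fderiv ℝ (sourceIntegral P τ v m
          (picardTerm P τ v m β d π (n + 1)) e) (π p)) A (by positivity) (fun e => h0 e p hp)
        (fun e => (h0 e _ (hπ p hp)).trans (by
          rw [hA]
          have := hπ1 p hp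
          gcongr)) c
      refine this.trans ?_
      have e1 : A = (M ^ (n + 1) + M * (2 * M) ^ n)
          * (D / (n + 1).factorial * p.1 ^ (n + 1)) := by
        rw [hA, Nat.factorial_succ]; push_cast; field_simp
      -- The contribution of the values is at most that of the derivatives, so the sum is at most
      -- twice the latter; this factor 2 turns (2M)^n into (2M)^(n+1).
      have e2 : M ^ (n + 1) ≤ M * (2 * M) ^ n := by
        rw [pow_succ']
        gcongr
        linarith
      rw [e1]
      calc _ ≤ M * ((M * (2 * M) ^ n + M * (2 * M) ^ n)
            * (D / (n + 1).factorial * p.1 ^ (n + 1))) := by gcongr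
        _ = _ := by ring
  exact ⟨D, M, hD0, hM0, fun n c p hp => ⟨hval n c p hp, hder n c p hp⟩⟩

/-- Linear transport systems on the triangle whose data are given on the inflow boundaries. -/
theorem exists_transport_solution {Λ : ℝ} (hΛ : 0 < Λ)
    (hchar : ∀ c, IsCharFamily Λ (P c) (τ c) (v c)) (hπ : ∀ p ∈ triangle, π p ∈ triangle)
    (hπ1 : ∀ p ∈ triangle, (π p).1 ≤ p.1) (hββ : ∀ c e, β c e ≠ 0 → ∀ e', β e e' = 0)
    (hπv : ∀ c e, β c e ≠ 0 → π (v c) = 0) (m : ι → ι → ℝ) (d : ι → ℝ) :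
    ∃ u : ι → ℝ × ℝ → ℝ, ∀ c, ContDiffOn ℝ 1 (u c) triangle ∧
      (∀ p ∈ triangle, P c p ∈ triangle →
        fderivWithin ℝ (u c) triangle p (v c) = ∑ e, m c e * u e (P c p)) ∧
      ∀ p ∈ triangle, τ c p = 0 → u c p = d c + ∑ e, β c e * u e (π p) := by
  obtain ⟨D, M, hD, hM, hb⟩ := exists_picardTerm_bound (m := m) (β := β) (d := d) hΛ hchar hπ hπ1
  set U := picardTerm P τ v m β d π with hU
  let a : ℕ → ℝ := fun n => D * M ^ n / n.factorial
  let b : ℕ → ℝ := fun n => Nat.casesOn n 0 fun n => D * (M * (2 * M) ^ n) / n.factorial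
  have ha : Summable a := by
    simpa only [a, mul_div_assoc] using (Real.summable_pow_div_factorial M).mul_left D
  have hbs : Summable b := by
    rw [← summable_nat_add_iff 1]
    simpa only [b, mul_div_assoc] using
      ((Real.summable_pow_div_factorial (2 * M)).mul_left M).mul_left D
  have hpow : ∀ n, ∀ p ∈ triangle, p.1 ^ n ≤ 1 := fun n p hp =>
    pow_le_one₀ (triangle_fst_nonneg hp) hp.2.2
  have hUa : ∀ c n, ∀ p ∈ triangle, ‖U n c p‖ ≤ a n := fun c n p hp =>
    ((hb n c p hp).1).trans (mul_le_of_le_one_right (by positivity) (hpow n p hp))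
  have hU0 : ∀ c p, fderiv ℝ (U 0 c) p = 0 := by
    intro c p
    have : U 0 c = fun _ => d c + ∑ e, β c e • d e := by
      funext q; rw [hU, picardTerm]
    rw [this]; simp
  have hUb : ∀ c n, ∀ p ∈ triangle, ‖fderiv ℝ (U n c) p‖ ≤ b n := by
    intro c n p hp
    cases n with
    | zero => simp [hU0, b]
    | succ n =>
      exact ((hb n c p hp).2).trans (mul_le_of_le_one_right (by positivity) (hpow n p hp))
  have hsum : ∀ c, ∀ p ∈ triangle, HasSum (fun n => U n c p) (∑' n, U n c p) := fun c p hp =>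
    (Summable.of_norm_bounded ha fun n => hUa c n p hp).hasSum
  refine ⟨fun c p => ∑' n, U n c p, fun c => ?_⟩
  obtain ⟨h1, h2⟩ := tsum_triangle (f := fun n => U n c) (fun n => contDiff_picardTerm n c) ha hbs
    (hUa c) (hUb c)
  refine ⟨h1, fun p hp hPp => ?_, fun p hp hτ => ?_⟩
  · have h3 : HasSum (fun n => fderiv ℝ (U n c) p (v c))
        (fderivWithin ℝ (fun p => ∑' n, U n c p) triangle p (v c)) :=
      (h2 p hp).mapL (ContinuousLinearMap.apply ℝ ℝ (v c))
    -- The zeroth term has zero derivative, so shifting the index turns the derivative of the n+1-st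
    -- term into the source built from the n-th.
    rw [← hasSum_nat_add_iff' 1] at h3
    simp only [Finset.range_one, Finset.sum_singleton, hU0, zero_apply, sub_zero] at h3
    refine h3.unique ?_
    simp only [hU, fderiv_picardTerm_succ_apply hchar hπv]
    exact hasSum_sum fun e _ => (hsum e _ hPp).mul_left (m c e)
  · have h3 := hsum c p hp
    rw [← hasSum_nat_add_iff' 1] at h3
    have h4 : HasSum (fun n => ∑ e, β c e * U n e (π p)) (∑ e, β c e * ∑' n, U n e (π p)) :=
      hasSum_sum fun e _ => (hsum e _ (hπ p hp)).mul_left (β c e)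
    rw [← hasSum_nat_add_iff' 1] at h4
    simp only [hU, picardTerm_succ_boundary hββ _ c hτ, smul_eq_mul] at h3
    simp only [hU] at h4
    have h5 := h3.unique h4
    simp only [Finset.range_one, Finset.sum_singleton] at h5
    rw [picardTerm_zero_boundary hββ c p] at h5
    simp only [smul_eq_mul] at h5
    linarith

end Iteration

end TransportSeries

/-! ### Existence of the backstepping kernels. -/

section KernelExistence

lemma fderivWithin_triangle_apply (f : ℝ × ℝ → ℝ) (p : ℝ × ℝ) (a b : ℝ) :
    fderivWithin ℝ f triangle p (a, b) = a * partialX f p + b * partialXi f p := by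
  have : ((a, b) : ℝ × ℝ) = a • (1, 0) + b • (0, 1) := by simp
  rw [this, map_add, map_smul, map_smul]
  rfl

lemma derivWithin_comp_bottom {f : ℝ × ℝ → ℝ} (hf : ContDiffOn ℝ 1 f triangle) {x : ℝ}
    (hx : x ∈ Icc (0 : ℝ) 1) :
    derivWithin (fun y => f (y, 0)) (Icc 0 1) x = partialX f (x, 0) := by
  have hp : ((x, 0) : ℝ × ℝ) ∈ triangle := ⟨le_rfl, hx.1, hx.2⟩
  have h1 := ((hf.differentiableOn one_ne_zero) _ hp).hasFDerivWithinAt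
  have h2 : HasDerivWithinAt (fun y : ℝ => ((y, 0) : ℝ × ℝ)) (1, 0) (Icc 0 1) x :=
    ((hasDerivAt_id x).prodMk (hasDerivAt_const x (0 : ℝ))).hasDerivWithinAt
  have hm : MapsTo (fun y : ℝ => ((y, 0) : ℝ × ℝ)) (Icc 0 1) triangle :=
    fun y hy => ⟨le_rfl, hy.1, hy.2⟩
  exact (h1.comp_hasDerivWithinAt x h2 hm).derivWithin
    (uniqueDiffOn_Icc zero_lt_one x hx)

/-- K, N and γ are the components of one transport system on the triangle, indexed by `Fin 3 ⊕ (Unit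
⊕ Fin 2)`. The function τ of a component vanishes where its data are given: on the diagonal for K,
on the bottom edge for N, at x = 0 for γ. Positivity of the speeds keeps the backward
characteristics inside the triangle. -/
theorem exists_isKernelSolution (S : NominalSystem) (hP : ∀ i, 0 < S.lamP i) (hM : 0 < S.lamM)
    (κ : Fin 2 → ℝ) : ∃ k : BacksteppingKernels, IsKernelSolution S κ k := by
  let fstL : ℝ × ℝ →L[ℝ] ℝ := ContinuousLinearMap.fst ℝ ℝ ℝ
  let sndL : ℝ × ℝ →L[ℝ] ℝ := ContinuousLinearMap.snd ℝ ℝ ℝ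
  -- For γ the base point is projected to (x, 0): γ becomes a function on the triangle whose
  -- equation has sources K(x,0) and γ(x) taken on the bottom edge.
  let P : Fin 3 ⊕ (Unit ⊕ Fin 2) → ℝ × ℝ →L[ℝ] ℝ × ℝ :=
    Sum.elim (fun _ => .id ℝ _) (Sum.elim (fun _ => .id ℝ _) fun _ => fstL.prod 0)
  let τ : Fin 3 ⊕ (Unit ⊕ Fin 2) → ℝ × ℝ →L[ℝ] ℝ :=
    Sum.elim (fun i => (S.lamM + S.lamP i)⁻¹ • (fstL - sndL))
      (Sum.elim (fun _ => S.lamM⁻¹ • sndL) fun _ => S.lamM⁻¹ • fstL)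
  let v : Fin 3 ⊕ (Unit ⊕ Fin 2) → ℝ × ℝ :=
    Sum.elim (fun i => (S.lamM, -S.lamP i))
      (Sum.elim (fun _ => (S.lamM, S.lamM)) fun _ => (S.lamM, 0))
  let m : Fin 3 ⊕ (Unit ⊕ Fin 2) → Fin 3 ⊕ (Unit ⊕ Fin 2) → ℝ :=
    Sum.elim
      (fun i => Sum.elim (fun j => S.sigPP j i - S.sigMM * if j = i then 1 else 0)
        (Sum.elim (fun _ => S.sigMP i) fun _ => 0))
      (Sum.elim (fun _ => Sum.elim (fun i => S.sigPM i) fun _ => 0)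
        fun j => Sum.elim (fun i => S.lamP i * S.C i j)
          (Sum.elim (fun _ => 0) fun l => S.A l j - S.sigMM * if l = j then 1 else 0))
  -- Only N has a coupled boundary condition, namely the one for N(x,0) solved for N; it involves K
  -- and γ, which have none.
  let β : Fin 3 ⊕ (Unit ⊕ Fin 2) → Fin 3 ⊕ (Unit ⊕ Fin 2) → ℝ :=
    Sum.elim (fun _ _ => 0)
      (Sum.elim (fun _ => Sum.elim (fun i => S.lamM⁻¹ * (S.lamP i * S.Q i))
        (Sum.elim (fun _ => 0) fun j => S.lamM⁻¹ * S.B j)) fun _ _ => 0)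
  let d : Fin 3 ⊕ (Unit ⊕ Fin 2) → ℝ :=
    Sum.elim (fun i => -S.sigMP i / (S.lamM + S.lamP i)) (Sum.elim (fun _ => 0) κ)
  -- The foot on the bottom edge of the characteristic of N through (x, ξ).
  let π : ℝ × ℝ →L[ℝ] ℝ × ℝ := (fstL - sndL).prod 0
  have hchar : ∀ c, IsCharFamily S.lamM (P c) (τ c) (v c) := by
    rintro (i | _ | j)
    · have hs : 0 < S.lamM + S.lamP i := add_pos hM (hP i)
      refine ⟨fun p hp => ?_, fun p hp θ hθ => ?_, fun p => rfl, rfl, ?_, rfl⟩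
      · simp only [τ, Sum.elim_inl, fstL, sndL, smul_apply, sub_apply, smul_eq_mul]
        have := sub_nonneg.2 hp.2.1
        simp only [ContinuousLinearMap.coe_fst', ContinuousLinearMap.coe_snd']
        positivity
      · have h1 := sub_nonneg.2 hp.2.1
        have hr : 0 ≤ (S.lamM + S.lamP i)⁻¹ * (p.1 - p.2) := by positivity
        have hr' : (S.lamM + S.lamP i) * ((S.lamM + S.lamP i)⁻¹ * (p.1 - p.2)) = p.1 - p.2 := by
          field_simp
        set r := (S.lamM + S.lamP i)⁻¹ * (p.1 - p.2) with hrdef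
        have e : P (Sum.inl i) p - (θ * τ (Sum.inl i) p) • v (Sum.inl i)
            = (p.1 - θ * r * S.lamM, p.2 + θ * r * S.lamP i) := by
          simp [P, τ, v, fstL, sndL, hrdef]
          ext <;> simp
        rw [e]
        have h2 := mul_nonneg hθ.1 hr
        have h3 := mul_nonneg h2 hM.le
        have h4 := mul_nonneg h2 (hP i).le
        have h5 := mul_le_of_le_one_left h1 hθ.2
        refine ⟨?_, ?_, ?_⟩ <;> simp only
        · linarith [hp.1]
        · have h6 : θ * r * S.lamM + θ * r * S.lamP i = θ * (p.1 - p.2) := by rw [← hr']; ring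
          linarith
        · linarith [hp.2.2]
      · simp [τ, v, fstL, sndL]
        field_simp
    · refine ⟨fun p hp => ?_, fun p hp θ hθ => ?_, fun p => rfl, rfl, ?_, rfl⟩
      · simp only [τ, Sum.elim_inl, Sum.elim_inr, sndL, smul_apply, smul_eq_mul]
        have := hp.1
        simp only [ContinuousLinearMap.coe_snd']
        positivity
      · have e : P (Sum.inr (Sum.inl ())) p - (θ * τ (Sum.inr (Sum.inl ())) p)
            • v (Sum.inr (Sum.inl ())) = (p.1 - θ * p.2, p.2 - θ * p.2) := by
          simp [P, τ, v, sndL]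
          ext <;> simp <;> field_simp
        rw [e]
        have h2 := mul_nonneg hθ.1 hp.1
        have h5 := mul_le_of_le_one_left hp.1 hθ.2
        refine ⟨?_, ?_, ?_⟩ <;> simp only
        · linarith
        · linarith [hp.2.1]
        · linarith [hp.2.2]
      · simp [τ, v, sndL]
        field_simp
    · refine ⟨fun p hp => ?_, fun p hp θ hθ => ?_, fun p => rfl, rfl, ?_, rfl⟩
      · simp only [τ, Sum.elim_inr, fstL, smul_apply, smul_eq_mul]
        have := triangle_fst_nonneg hp
        simp only [ContinuousLinearMap.coe_fst']
        positivity
      · have e : P (Sum.inr (Sum.inr j)) p - (θ * τ (Sum.inr (Sum.inr j)) p)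
            • v (Sum.inr (Sum.inr j)) = (p.1 - θ * p.1, 0) := by
          simp [P, τ, v, fstL]
          field_simp
        rw [e]
        have h2 := mul_nonneg hθ.1 (triangle_fst_nonneg hp)
        have h5 := mul_le_of_le_one_left (triangle_fst_nonneg hp) hθ.2
        refine ⟨?_, ?_, ?_⟩ <;> simp only
        · exact le_rfl
        · linarith
        · linarith [hp.2.2]
      · simp [τ, v, fstL]
        field_simp
  have hππ : ∀ p, π p = (p.1 - p.2, 0) := fun p => rfl
  obtain ⟨u, hu⟩ := exists_transport_solution (β := β) (π := π) hM hchar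
    (fun p hp => by
      rw [hππ]
      exact ⟨le_rfl, sub_nonneg.2 hp.2.1, by linarith [hp.2.2, hp.1]⟩)
    (fun p hp => by rw [hππ]; simpa using hp.1)
    (by
      rintro (i | _ | j) (i' | _ | j') h (i'' | _ | j'') <;>
        simp only [β, Sum.elim_inl, Sum.elim_inr, ne_eq, not_true_eq_false] at h ⊢)
    (by
      rintro (i | _ | j) e h
      · simp [β] at h
      · rw [hππ]; simp [v]
      · simp [β] at h) m d
  refine ⟨⟨fun p i => u (Sum.inl i) p, u (Sum.inr (Sum.inl ())),
    fun x j => u (Sum.inr (Sum.inr j)) (x, 0)⟩, ?_⟩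
  have hbot : ∀ x ∈ Icc (0 : ℝ) 1, ((x, 0) : ℝ × ℝ) ∈ triangle := fun x hx =>
    ⟨le_rfl, hx.1, hx.2⟩
  refine ⟨fun i => (hu _).1, (hu _).1, fun j => ?_, fun p hp i => ?_, fun p hp => ?_,
    fun x hx i => ?_, fun x hx => ?_, fun x hx j => ?_, ?_⟩
  · exact (hu (Sum.inr (Sum.inr j))).1.comp (contDiff_id.prodMk contDiff_const).contDiffOn hbot
  · have := (hu (Sum.inl i)).2.1 p hp hp
    simp only [v, Sum.elim_inl, fderivWithin_triangle_apply] at this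
    simp only [m, P, Fintype.sum_sum_type, Sum.elim_inl, Sum.elim_inr,
      ContinuousLinearMap.coe_id', id_eq, Finset.univ_unique, Finset.sum_singleton, zero_mul,
      Finset.sum_const_zero, add_zero, sub_mul, Finset.sum_sub_distrib, mul_ite, mul_one, mul_zero,
      ite_mul, Finset.sum_ite_eq', Finset.mem_univ, if_true] at this
    have h2 : ∑ j, u (Sum.inl j) p * S.sigPP j i = ∑ j, S.sigPP j i * u (Sum.inl j) p :=
      Finset.sum_congr rfl fun j _ => mul_comm _ _
    simp only [h2]
    linarith
  · have := (hu (Sum.inr (Sum.inl ()))).2.1 p hp hp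
    simp only [v, Sum.elim_inl, Sum.elim_inr, fderivWithin_triangle_apply] at this
    simp only [m, P, Fintype.sum_sum_type, Sum.elim_inl, Sum.elim_inr,
      ContinuousLinearMap.coe_id', id_eq, zero_mul, Finset.sum_const_zero, add_zero] at this
    rw [this]
    exact Finset.sum_congr rfl fun j _ => mul_comm _ _
  · have := (hu (Sum.inl i)).2.2 (x, x) ⟨hx.1, le_rfl, hx.2⟩ (by simp [τ, fstL, sndL])
    have hs : 0 < S.lamM + S.lamP i := add_pos hM (hP i)
    simp only [β, d, Sum.elim_inl, zero_mul, Finset.sum_const_zero, add_zero] at this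
    dsimp only
    rw [this]
    field_simp
  · have := (hu (Sum.inr (Sum.inl ()))).2.2 (x, 0) (hbot x hx) (by simp [τ, sndL])
    simp only [β, d, hππ, Fintype.sum_sum_type, Sum.elim_inl, Sum.elim_inr, zero_mul,
      Finset.sum_const_zero, zero_add, sub_zero] at this
    dsimp only
    rw [this, mul_add, Finset.mul_sum, Finset.mul_sum, add_sub_assoc, add_comm, ← sub_eq_zero]
    have e1 : ∑ i, S.lamM * (S.lamM⁻¹ * (S.lamP i * S.Q i) * u (Sum.inl i) (x, 0))
        = ∑ i, u (Sum.inl i) (x, 0) * S.lamP i * S.Q i :=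
      Finset.sum_congr rfl fun i _ => by field_simp
    have e2 : ∑ j, S.lamM * (S.lamM⁻¹ * S.B j * u (Sum.inr (Sum.inr j)) (x, 0))
        = ∑ j, u (Sum.inr (Sum.inr j)) (x, 0) * S.B j :=
      Finset.sum_congr rfl fun i _ => by field_simp
    rw [e1, e2]
    ring
  · have := (hu (Sum.inr (Sum.inr j))).2.1 (x, 0) (hbot x hx) (hbot x hx)
    rw [derivWithin_comp_bottom (hu (Sum.inr (Sum.inr j))).1 hx]
    simp only [v, Sum.elim_inr, fderivWithin_triangle_apply, zero_mul, add_zero] at this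
    have hPx : P (Sum.inr (Sum.inr j)) (x, 0) = (x, 0) := rfl
    simp only [m, hPx, Fintype.sum_sum_type, Sum.elim_inl, Sum.elim_inr, Finset.univ_unique,
      Finset.sum_singleton, zero_mul, zero_add, sub_mul, Finset.sum_sub_distrib, mul_ite, mul_one,
      mul_zero, ite_mul, Finset.sum_ite_eq', Finset.mem_univ, if_true] at this
    rw [this]
    have h2 : ∑ l, u (Sum.inr (Sum.inr l)) (x, 0) * S.A l j
        = ∑ l, S.A l j * u (Sum.inr (Sum.inr l)) (x, 0) :=
      Finset.sum_congr rfl fun j _ => mul_comm _ _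
    have h3 : ∑ i, u (Sum.inl i) (x, 0) * S.lamP i * S.C i j
        = ∑ i, S.lamP i * S.C i j * u (Sum.inl i) (x, 0) :=
      Finset.sum_congr rfl fun j _ => by ring
    simp only [h2, h3]
    ring
  · funext j
    have := (hu (Sum.inr (Sum.inr j))).2.2 (0, 0) (hbot 0 ⟨le_rfl, zero_le_one⟩)
      (by simp [τ, fstL])
    simpa [β, d] using this

end KernelExistence

/-! ### Primitives of integrable functions on [0,1] and weak derivatives. -/

section IntervalCalculus

open Filter Topology

lemma integral_unitMeasure (f : ℝ → ℝ) : ∫ x, f x ∂unitMeasure = ∫ x in (0 : ℝ)..1, f x := by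
  rw [intervalIntegral.integral_of_le zero_le_one, integral_Icc_eq_integral_Ioc]

lemma integrable_unitMeasure_iff (f : ℝ → ℝ) :
    Integrable f unitMeasure ↔ IntervalIntegrable f volume 0 1 := by
  rw [intervalIntegrable_iff_integrableOn_Icc_of_le zero_le_one, IntegrableOn]

/-- `u` is a primitive of `g` on `[0, y]`. -/
def IsPrimitive (y : ℝ) (u g : ℝ → ℝ) : Prop :=
  IntervalIntegrable g volume 0 y ∧ ∀ x ∈ Icc 0 y, u x = u 0 + ∫ t in (0 : ℝ)..x, g t

namespace IsPrimitive

variable {y : ℝ} {u v g k : ℝ → ℝ}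

lemma mono (h : IsPrimitive y u g) {x : ℝ} (hx : x ∈ Icc 0 y) : IsPrimitive x u g := by
  refine ⟨h.1.mono_set ?_, fun t ht => h.2 t ⟨ht.1, ht.2.trans hx.2⟩⟩
  rw [uIcc_of_le hx.1, uIcc_of_le (hx.1.trans hx.2)]
  exact Icc_subset_Icc_right hx.2

lemma continuousOn (h : IsPrimitive y u g) (hy : 0 ≤ y) : ContinuousOn u (Icc 0 y) := by
  have h1 := intervalIntegral.continuousOn_primitive_interval' h.1 left_mem_uIcc
  rw [uIcc_of_le hy] at h1
  exact (h1.const_add (u 0)).congr fun x hx => h.2 x hx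

lemma of_hasDerivWithinAt (hy : 0 ≤ y) (hu : ∀ x ∈ Icc 0 y, HasDerivWithinAt u (g x) (Icc 0 y) x)
    (hg : ContinuousOn g (Icc 0 y)) : IsPrimitive y u g := by
  have hgi : ∀ x ∈ Icc 0 y, IntervalIntegrable g volume 0 x := fun x hx =>
    ContinuousOn.intervalIntegrable (by
      rw [uIcc_of_le hx.1]; exact hg.mono (Icc_subset_Icc_right hx.2))
  refine ⟨hgi y ⟨hy, le_rfl⟩, fun x hx => ?_⟩
  rw [intervalIntegral.integral_eq_sub_of_hasDerivAt_of_le hx.1 (f := u) ?_ ?_ (hgi x hx)]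
  · ring
  · exact fun t ht => (hu t ⟨ht.1, ht.2.trans hx.2⟩).continuousWithinAt.mono
      (Icc_subset_Icc_right hx.2)
  · exact fun t ht => (hu t ⟨ht.1.le, ht.2.le.trans hx.2⟩).hasDerivAt
      (Icc_mem_nhds ht.1 (ht.2.trans_le hx.2))

/-- Integration by parts for primitives of integrable functions. -/
lemma integral_by_parts (hy : 0 ≤ y) (hu : IsPrimitive y u g) (hv : IsPrimitive y v k) :
    ∫ x in (0 : ℝ)..y, (g x * v x + u x * k x) = u y * v y - u 0 * v 0 := by
  -- The function u is constrained only on [0, y]. The integral formula that it equals there is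
  -- defined on all of ℝ, is absolutely continuous and has derivative g almost everywhere, so
  -- integration by parts is applied to the formula.
  have ac : ∀ {u g : ℝ → ℝ}, IsPrimitive y u g →
      AbsolutelyContinuousOnInterval (fun x => u 0 + ∫ t in (0 : ℝ)..x, g t) 0 y ∧
      ∀ᵐ x, x ∈ uIcc 0 y → deriv (fun x => u 0 + ∫ t in (0 : ℝ)..x, g t) x = g x := by
    intro u g h
    refine ⟨?_, ?_⟩
    · have h1 := (h.1.absolutelyContinuousOnInterval_intervalIntegral (c := 0) left_mem_uIcc)
      have h2 : AbsolutelyContinuousOnInterval (fun _ : ℝ => u 0) 0 y :=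
        (contDiff_const (n := 1)).contDiffOn.absolutelyContinuousOnInterval
      exact h2.add h1
    · filter_upwards [h.1.ae_hasDerivAt_integral] with x hx hx'
      exact ((hx hx' 0 left_mem_uIcc).const_add (u 0)).deriv
  obtain ⟨h1, h2⟩ := ac hu
  obtain ⟨h3, h4⟩ := ac hv
  have h5 := h1.integral_deriv_mul_eq_sub h3
  rw [← hu.2 y ⟨hy, le_rfl⟩, ← hv.2 y ⟨hy, le_rfl⟩] at h5
  simp only [intervalIntegral.integral_same, add_zero] at h5
  rw [← h5]
  refine intervalIntegral.integral_congr_ae ?_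
  filter_upwards [h2, h4] with x hx2 hx4 hx
  have hx' : x ∈ Icc 0 y := by rw [uIoc_of_le hy] at hx; exact ⟨hx.1.le, hx.2⟩
  rw [hx2 (uIoc_subset_uIcc hx), hx4 (uIoc_subset_uIcc hx), ← hu.2 x hx', ← hv.2 x hx']

lemma add (hu : IsPrimitive y u g) (hv : IsPrimitive y v k) :
    IsPrimitive y (fun x => u x + v x) (fun x => g x + k x) := by
  refine ⟨hu.1.add hv.1, fun x hx => ?_⟩
  rw [intervalIntegral.integral_add (hu.mono hx).1 (hv.mono hx).1]
  dsimp only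
  linarith [hu.2 x hx, hv.2 x hx]

lemma const_mul (c : ℝ) (hu : IsPrimitive y u g) :
    IsPrimitive y (fun x => c * u x) (fun x => c * g x) := by
  refine ⟨hu.1.const_mul c, fun x hx => ?_⟩
  rw [intervalIntegral.integral_const_mul]
  dsimp only
  rw [hu.2 x hx, mul_add]

lemma sub (hu : IsPrimitive y u g) (hv : IsPrimitive y v k) :
    IsPrimitive y (fun x => u x - v x) (fun x => g x - k x) := by
  refine ⟨hu.1.sub hv.1, fun x hx => ?_⟩
  rw [intervalIntegral.integral_sub (hu.mono hx).1 (hv.mono hx).1]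
  dsimp only
  linarith [hu.2 x hx, hv.2 x hx]

lemma finset_sum {ι : Type*} (s : Finset ι) {u g : ι → ℝ → ℝ}
    (h : ∀ i ∈ s, IsPrimitive y (u i) (g i)) :
    IsPrimitive y (fun x => ∑ i ∈ s, u i x) (fun x => ∑ i ∈ s, g i x) := by
  classical
  induction s using Finset.induction_on with
  | empty => simp [IsPrimitive]
  | insert a s ha ih =>
    simp only [Finset.sum_insert ha]
    exact (h a (Finset.mem_insert_self a s)).add
      (ih fun i hi => h i (Finset.mem_insert_of_mem hi))

lemma mul (hy : 0 ≤ y) (hu : IsPrimitive y u g) (hv : IsPrimitive y v k) :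
    IsPrimitive y (fun x => u x * v x) (fun x => g x * v x + u x * k x) := by
  have hu' := hu.continuousOn hy
  have hv' := hv.continuousOn hy
  rw [← uIcc_of_le hy] at hu' hv'
  refine ⟨(hu.1.mul_continuousOn hv').add (hv.1.continuousOn_mul hu'), fun x hx => ?_⟩
  rw [(hu.mono hx).integral_by_parts hx.1 (hv.mono hx)]
  ring

lemma exp (s : ℝ) (hy : 0 ≤ y) :
    IsPrimitive y (fun x => Real.exp (s * x)) (fun x => s * Real.exp (s * x)) := by
  refine of_hasDerivWithinAt hy (fun x _ => ?_) (by fun_prop)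
  have := ((hasDerivAt_id x).const_mul s).exp
  refine (this.congr_deriv ?_).hasDerivWithinAt
  simp; ring

/-- The weighted energy identity. -/
lemma energy (hu : IsPrimitive 1 u g) (s : ℝ) :
    ∫ x in (0 : ℝ)..1, Real.exp (s * x) * (u x * g x)
      = (Real.exp s * u 1 ^ 2 - u 0 ^ 2) / 2
        - s / 2 * ∫ x in (0 : ℝ)..1, Real.exp (s * x) * u x ^ 2 := by
  have huc := hu.continuousOn zero_le_one
  rw [← uIcc_of_le zero_le_one] at huc
  have h1 := ((exp s zero_le_one).mul zero_le_one hu).integral_by_parts zero_le_one hu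
  have i1 : IntervalIntegrable (fun x => Real.exp (s * x) * (u x * g x)) volume 0 1 :=
    (hu.1.continuousOn_mul huc).continuousOn_mul (by fun_prop)
  have i2 : IntervalIntegrable (fun x => Real.exp (s * x) * u x ^ 2) volume 0 1 :=
    ContinuousOn.intervalIntegrable (by fun_prop)
  have h2 : ∫ x in (0 : ℝ)..1, ((s * Real.exp (s * x) * u x + Real.exp (s * x) * g x) * u x
      + Real.exp (s * x) * u x * g x)
      = ∫ x in (0 : ℝ)..1, (s * (Real.exp (s * x) * u x ^ 2)
        + 2 * (Real.exp (s * x) * (u x * g x))) :=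
    intervalIntegral.integral_congr fun x _ => by ring
  rw [h2, intervalIntegral.integral_add (i2.const_mul s) (i1.const_mul 2),
    intervalIntegral.integral_const_mul, intervalIntegral.integral_const_mul] at h1
  simp only [mul_one, mul_zero, Real.exp_zero, one_mul] at h1
  linarith

end IsPrimitive

lemma isPrimitive_integral {g : ℝ → ℝ} {y : ℝ} (hg : IntervalIntegrable g volume 0 y) (a : ℝ) :
    IsPrimitive y (fun x => a + ∫ t in (0 : ℝ)..x, g t) g :=
  ⟨hg, fun x _ => by simp⟩

/-- Weakly differentiable functions on `[0,1]` are primitives, and their boundary terms are their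
boundary values. -/
lemma exists_primitive_of_weak {u g : ℝ → ℝ} (hu : Integrable u unitMeasure)
    (hg : Integrable g unitMeasure) {a b l : ℝ} (hl : l ≠ 0)
    (h : ∀ φ : ℝ → ℝ, ContDiff ℝ 1 φ → ∫ x, g x * φ x ∂unitMeasure
      = l * (a * φ 0 - b * φ 1) + l * ∫ x, u x * deriv φ x ∂unitMeasure) :
    ∃ û : ℝ → ℝ, IsPrimitive 1 û (fun x => -(l⁻¹ * g x)) ∧ u =ᵐ[unitMeasure] û ∧
      û 0 = a ∧ û 1 = b := by
  rw [integrable_unitMeasure_iff] at hg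
  have hg' : IntervalIntegrable (fun x => -(l⁻¹ * g x)) volume 0 1 := (hg.const_mul _).neg
  have hG := isPrimitive_integral hg' a
  set û : ℝ → ℝ := fun x => a + ∫ t in (0 : ℝ)..x, -(l⁻¹ * g t) with hû
  have h0 : û 0 = a := by simp [hû]
  have hcont := hG.continuousOn zero_le_one
  refine ⟨û, hG, ?_, h0, ?_⟩
  · have hint : Integrable (fun x => u x - û x) unitMeasure :=
      hu.sub ((integrable_unitMeasure_iff _).2 (ContinuousOn.intervalIntegrable (by
        rwa [uIcc_of_le zero_le_one])))
    have h1 : ∀ ψ : ℝ → ℝ, ContDiff ℝ 1 ψ → ∫ x, (u x - û x) * ψ x ∂unitMeasure = 0 := by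
      intro ψ hψ
      have hψc := hψ.continuous
      -- A primitive of ψ that vanishes at 1 removes the unknown boundary term b; the term at 0
      -- agrees with that of û by construction. Hence u - û is orthogonal to every ψ.
      let φ : ℝ → ℝ := fun x => ∫ t in (1 : ℝ)..x, ψ t
      have hφd : ∀ x, HasDerivAt φ (ψ x) x := fun x =>
        intervalIntegral.integral_hasDerivAt_right (hψc.intervalIntegrable _ _)
          (hψc.stronglyMeasurableAtFilter _ _) hψc.continuousAt
      have hφ' : deriv φ = ψ := funext fun x => (hφd x).deriv
      have hφ : ContDiff ℝ 1 φ := by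
        rw [contDiff_one_iff_deriv]
        exact ⟨fun x => (hφd x).differentiableAt, hφ' ▸ hψc⟩
      have h2 := h φ hφ
      have h3 : IsPrimitive 1 φ ψ := IsPrimitive.of_hasDerivWithinAt zero_le_one
        (fun x _ => (hφd x).hasDerivWithinAt) hψc.continuousOn
      have h4 := hG.integral_by_parts zero_le_one h3
      have hφ1 : φ 1 = 0 := by simp [φ]
      rw [hφ', hφ1, integral_unitMeasure, integral_unitMeasure] at h2
      rw [hφ1, h0] at h4
      have hφc := hφ.continuous
      have hcu : ContinuousOn û (uIcc 0 1) := by rwa [uIcc_of_le zero_le_one]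
      have i1 : IntervalIntegrable (fun x => -(l⁻¹ * g x) * φ x) volume 0 1 :=
        hg'.mul_continuousOn hφc.continuousOn
      have i2 : IntervalIntegrable (fun x => û x * ψ x) volume 0 1 :=
        (hcu.mul hψc.continuousOn).intervalIntegrable
      have i3 : IntervalIntegrable (fun x => u x * ψ x) volume 0 1 :=
        ((integrable_unitMeasure_iff u).1 hu).mul_continuousOn hψc.continuousOn
      rw [intervalIntegral.integral_add i1 i2] at h4
      have h5 : ∫ x in (0 : ℝ)..1, -(l⁻¹ * g x) * φ x
          = -l⁻¹ * ∫ x in (0 : ℝ)..1, g x * φ x := by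
        rw [← intervalIntegral.integral_const_mul]
        exact intervalIntegral.integral_congr fun x _ => by ring
      rw [integral_unitMeasure]
      simp only [sub_mul]
      rw [intervalIntegral.integral_sub i3 i2]
      rw [h5, h2] at h4
      have h6 : l⁻¹ * l = 1 := inv_mul_cancel₀ hl
      linear_combination -h4 - (a * φ 0 + ∫ x in (0 : ℝ)..1, u x * ψ x) * h6
    have h2 : (Icc (0 : ℝ) 1).indicator (fun x => u x - û x) =ᵐ[volume] 0 := by
      refine ae_eq_zero_of_integral_contDiff_smul_eq_zero
        ((integrable_indicator_iff measurableSet_Icc).2 hint).locallyIntegrable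
        fun ψ hψ _ => ?_
      have := h1 ψ (hψ.of_le (by exact_mod_cast le_top))
      refine Eq.trans ?_ this
      rw [← integral_indicator measurableSet_Icc]
      refine integral_congr_ae (Eventually.of_forall fun x => ?_)
      by_cases hx : x ∈ Icc (0 : ℝ) 1
      · simp [hx, mul_comm]
      · simp [hx]
    rw [EventuallyEq, ae_restrict_iff' measurableSet_Icc]
    filter_upwards [h2] with x hx hx'
    rw [indicator_of_mem hx'] at hx
    simpa [sub_eq_zero] using hx
  -- The constant test function gives the total mass of g, which is exactly what fixes û at 1.
  · have h1 := h (fun _ => 1) contDiff_const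
    simp only [mul_one, deriv_const, mul_zero, integral_zero, add_zero] at h1
    rw [integral_unitMeasure] at h1
    simp only [hû]
    rw [intervalIntegral.integral_neg, intervalIntegral.integral_const_mul, h1]
    field_simp
    ring

end IntervalCalculus

/-! ### Volterra integrals with kernels on the triangle. -/

section TriangleCalculus

open Filter Topology

lemma isCompact_triangle : IsCompact triangle :=
  ((isCompact_Icc (a := (0 : ℝ)) (b := 1)).prod (isCompact_Icc (a := (0 : ℝ)) (b := 1))).of_isClosed_subset
    isClosed_triangle fun _ hp => ⟨⟨hp.1.trans hp.2.1, hp.2.2⟩, hp.1, hp.2.1.trans hp.2.2⟩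

variable {f k : ℝ × ℝ → ℝ} {g : ℝ → ℝ}

lemma measurable_indicator_triangle (hk : ContinuousOn k triangle) :
    Measurable (triangle.indicator k) := by
  classical
  rw [← piecewise_eq_indicator]
  exact hk.measurable_piecewise continuousOn_const isClosed_triangle.measurableSet

lemma exists_indicator_triangle_bound (hk : ContinuousOn k triangle) :
    ∃ C, 0 ≤ C ∧ ∀ p, ‖triangle.indicator k p‖ ≤ C := by
  obtain ⟨C, hC⟩ := isCompact_triangle.exists_bound_of_continuousOn hk
  refine ⟨max C 0, le_max_right _ _, fun p => ?_⟩
  by_cases hp : p ∈ triangle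
  · rw [indicator_of_mem hp]; exact (hC p hp).trans (le_max_left _ _)
  · rw [indicator_of_notMem hp]; simp

lemma continuousOn_fderivWithin_triangle (hf : ContDiffOn ℝ 1 f triangle) :
    ContinuousOn (fderivWithin ℝ f triangle) triangle :=
  hf.continuousOn_fderivWithin uniqueDiffOn_triangle le_rfl

lemma continuousOn_partialX (hf : ContDiffOn ℝ 1 f triangle) :
    ContinuousOn (partialX f) triangle :=
  (continuousOn_fderivWithin_triangle hf).clm_apply continuousOn_const

lemma continuousOn_partialXi (hf : ContDiffOn ℝ 1 f triangle) :
    ContinuousOn (partialXi f) triangle :=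
  (continuousOn_fderivWithin_triangle hf).clm_apply continuousOn_const

lemma integral_partialX (hf : ContDiffOn ℝ 1 f triangle) {ξ y : ℝ} (hξ : 0 ≤ ξ) (hξy : ξ ≤ y)
    (hy : y ≤ 1) : ∫ x in ξ..y, partialX f (x, ξ) = f (y, ξ) - f (ξ, ξ) := by
  have hm : MapsTo (fun x : ℝ => (x, ξ)) (Icc ξ y) triangle :=
    fun x hx => ⟨hξ, hx.1, hx.2.trans hy⟩
  have hd : ∀ x ∈ Icc ξ y, HasDerivWithinAt (fun x => f (x, ξ)) (partialX f (x, ξ)) (Icc ξ y) x := by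
    intro x hx
    have h2 : HasDerivWithinAt (fun y : ℝ => ((y, ξ) : ℝ × ℝ)) (1, 0) (Icc ξ y) x :=
      ((hasDerivAt_id x).prodMk (hasDerivAt_const x ξ)).hasDerivWithinAt
    exact ((hf.differentiableOn one_ne_zero) _ (hm hx)).hasFDerivWithinAt.comp_hasDerivWithinAt
      x h2 hm
  refine intervalIntegral.integral_eq_sub_of_hasDerivAt_of_le hξy
    (fun x hx => (hd x hx).continuousWithinAt)
    (fun x hx => (hd x ⟨hx.1.le, hx.2.le⟩).hasDerivAt (Icc_mem_nhds hx.1 hx.2)) ?_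
  refine ContinuousOn.intervalIntegrable ?_
  rw [uIcc_of_le hξy]
  exact (continuousOn_partialX hf).comp (by fun_prop) hm

lemma isPrimitive_slice (hf : ContDiffOn ℝ 1 f triangle) {x : ℝ} (hx : x ∈ Icc (0 : ℝ) 1) :
    IsPrimitive x (fun ξ => f (x, ξ)) (fun ξ => partialXi f (x, ξ)) := by
  have hm : MapsTo (fun ξ : ℝ => (x, ξ)) (Icc 0 x) triangle :=
    fun ξ hξ => ⟨hξ.1, hξ.2, hx.2⟩
  refine IsPrimitive.of_hasDerivWithinAt hx.1 (fun ξ hξ => ?_)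
    ((continuousOn_partialXi hf).comp (by fun_prop) hm)
  have h2 : HasDerivWithinAt (fun y : ℝ => ((x, y) : ℝ × ℝ)) (0, 1) (Icc 0 x) ξ :=
    ((hasDerivAt_const ξ x).prodMk (hasDerivAt_id ξ)).hasDerivWithinAt
  exact ((hf.differentiableOn one_ne_zero) _ (hm hξ)).hasFDerivWithinAt.comp_hasDerivWithinAt
      ξ h2 hm

lemma integrable_kernel_mul (hk : ContinuousOn k triangle) (hg : Integrable g unitMeasure) {y : ℝ}
    (hy : y ≤ 1) :
    Integrable (fun p : ℝ × ℝ => triangle.indicator k p * g p.2)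
      ((volume.restrict (Ioc 0 y)).prod (volume.restrict (Ioc 0 y))) := by
  obtain ⟨C, -, hC⟩ := exists_indicator_triangle_bound hk
  have h1 : Integrable g (volume.restrict (Ioc 0 y)) :=
    IntegrableOn.mono_set hg fun x hx => ⟨hx.1.le, hx.2.trans hy⟩
  exact (h1.comp_snd _).bdd_mul
    (measurable_indicator_triangle hk).aestronglyMeasurable (Eventually.of_forall hC)

lemma integral_indicator_triangle_left (g : ℝ → ℝ) {x y : ℝ} (hx : 0 ≤ x)
    (hxy : x ≤ y) (hy : y ≤ 1) :
    ∫ ξ in Ioc 0 y, triangle.indicator k (x, ξ) * g ξ = ∫ ξ in (0 : ℝ)..x, k (x, ξ) * g ξ := by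
  rw [intervalIntegral.integral_of_le hx, ← integral_indicator measurableSet_Ioc,
    ← integral_indicator measurableSet_Ioc]
  congr 1
  ext ξ
  by_cases h1 : ξ ∈ Ioc 0 x
  · have h2 : ξ ∈ Ioc 0 y := ⟨h1.1, h1.2.trans hxy⟩
    have h3 : ((x, ξ) : ℝ × ℝ) ∈ triangle := ⟨h1.1.le, h1.2, hxy.trans hy⟩
    rw [indicator_of_mem h1, indicator_of_mem h2, indicator_of_mem h3]
  · rw [indicator_of_notMem h1]
    by_cases h2 : ξ ∈ Ioc 0 y
    · have h3 : ((x, ξ) : ℝ × ℝ) ∉ triangle := fun h => h1 ⟨h2.1, h.2.1⟩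
      rw [indicator_of_mem h2, indicator_of_notMem h3, zero_mul]
    · rw [indicator_of_notMem h2]

/-- Exchanging the order of integration on a triangle. -/
lemma integral_triangle_swap (hk : ContinuousOn k triangle) (hg : Integrable g unitMeasure) {y : ℝ}
    (hy0 : 0 ≤ y) (hy : y ≤ 1) :
    ∫ x in (0 : ℝ)..y, ∫ ξ in (0 : ℝ)..x, k (x, ξ) * g ξ
      = ∫ ξ in (0 : ℝ)..y, (∫ x in ξ..y, k (x, ξ)) * g ξ := by
  have h1 : ∫ x in (0 : ℝ)..y, ∫ ξ in (0 : ℝ)..x, k (x, ξ) * g ξ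
      = ∫ x in Ioc 0 y, ∫ ξ in Ioc 0 y, triangle.indicator k (x, ξ) * g ξ := by
    rw [intervalIntegral.integral_of_le hy0]
    refine setIntegral_congr_fun measurableSet_Ioc fun x hx => ?_
    exact (integral_indicator_triangle_left g hx.1.le hx.2 hy).symm
  rw [h1, integral_integral_swap (integrable_kernel_mul hk hg hy),
    intervalIntegral.integral_of_le hy0]
  refine setIntegral_congr_fun measurableSet_Ioc fun ξ hξ => ?_
  rw [integral_mul_const]
  congr 1
  rw [intervalIntegral.integral_of_le hξ.2, ← integral_Icc_eq_integral_Ioc (x := ξ),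
    ← integral_indicator measurableSet_Ioc, ← integral_indicator measurableSet_Icc]
  congr 1
  ext x
  by_cases h1 : x ∈ Icc ξ y
  · have h2 : x ∈ Ioc 0 y := ⟨hξ.1.trans_le h1.1, h1.2⟩
    have h3 : ((x, ξ) : ℝ × ℝ) ∈ triangle := ⟨hξ.1.le, h1.1, h1.2.trans hy⟩
    rw [indicator_of_mem h1, indicator_of_mem h2, indicator_of_mem h3]
  · rw [indicator_of_notMem h1]
    by_cases h2 : x ∈ Ioc 0 y
    · have h3 : ((x, ξ) : ℝ × ℝ) ∉ triangle := fun h => h1 ⟨h.2.1, h2.2⟩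
      rw [indicator_of_mem h2, indicator_of_notMem h3]
    · rw [indicator_of_notMem h2]

lemma intervalIntegrable_volterra (hk : ContinuousOn k triangle) (hg : Integrable g unitMeasure) :
    IntervalIntegrable (fun x => ∫ ξ in (0 : ℝ)..x, k (x, ξ) * g ξ) volume 0 1 := by
  rw [intervalIntegrable_iff_integrableOn_Ioc_of_le zero_le_one]
  have := (integrable_kernel_mul hk hg le_rfl).integral_prod_left
  refine this.congr ?_
  rw [EventuallyEq, ae_restrict_iff' measurableSet_Ioc]
  refine Eventually.of_forall fun x hx => ?_
  exact integral_indicator_triangle_left g hx.1.le hx.2 le_rfl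

lemma continuousOn_diag (hf : ContinuousOn f triangle) :
    ContinuousOn (fun x => f (x, x)) (uIcc 0 1) := by
  rw [uIcc_of_le zero_le_one]
  exact hf.comp (by fun_prop) fun x hx => ⟨hx.1, le_rfl, hx.2⟩

lemma intervalIntegrable_slice_mul (hf : ContinuousOn f triangle) (hg : Integrable g unitMeasure)
    {x : ℝ} (hx : x ∈ Icc (0 : ℝ) 1) :
    IntervalIntegrable (fun ξ => f (x, ξ) * g ξ) volume 0 x := by
  refine IntervalIntegrable.continuousOn_mul (((integrable_unitMeasure_iff g).1 hg).mono_set ?_) ?_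
  · rw [uIcc_of_le hx.1, uIcc_of_le zero_le_one]; exact Icc_subset_Icc_right hx.2
  · rw [uIcc_of_le hx.1]
    exact hf.comp (by fun_prop) fun ξ hξ => ⟨hξ.1, hξ.2, hx.2⟩

/-- Leibniz' rule for Volterra integrals, in integrated form. -/
lemma isPrimitive_volterra (hf : ContDiffOn ℝ 1 f triangle) (hg : Integrable g unitMeasure) :
    IsPrimitive 1 (fun y => ∫ ξ in (0 : ℝ)..y, f (y, ξ) * g ξ)
      (fun x => f (x, x) * g x + ∫ ξ in (0 : ℝ)..x, partialX f (x, ξ) * g ξ) := by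
  have h1 : IntervalIntegrable (fun x => f (x, x) * g x) volume 0 1 :=
    ((integrable_unitMeasure_iff g).1 hg).continuousOn_mul (continuousOn_diag hf.continuousOn)
  have h2 := intervalIntegrable_volterra (continuousOn_partialX hf) hg
  refine ⟨h1.add h2, fun y hy => ?_⟩
  have hsub : uIcc 0 y ⊆ uIcc 0 1 := by
    rw [uIcc_of_le hy.1, uIcc_of_le zero_le_one]; exact Icc_subset_Icc_right hy.2
  rw [intervalIntegral.integral_add (h1.mono_set hsub) (h2.mono_set hsub),
    integral_triangle_swap (continuousOn_partialX hf) hg hy.1 hy.2]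
  -- After the exchange of integrals, the inner integral runs from the diagonal to x = y and is
  -- evaluated by the fundamental theorem of calculus. This avoids differentiating an integral of a
  -- merely integrable g.
  have h3 : ∫ ξ in (0 : ℝ)..y, (∫ x in ξ..y, partialX f (x, ξ)) * g ξ
      = (∫ ξ in (0 : ℝ)..y, f (y, ξ) * g ξ) - ∫ ξ in (0 : ℝ)..y, f (ξ, ξ) * g ξ := by
    rw [← intervalIntegral.integral_sub (intervalIntegrable_slice_mul hf.continuousOn hg hy)
      (h1.mono_set hsub)]
    refine intervalIntegral.integral_congr fun ξ hξ => ?_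
    rw [uIcc_of_le hy.1] at hξ
    rw [integral_partialX hf hξ.1 hξ.2 hy.2]
    ring
  rw [h3]
  simp

/-- Integration by parts in the second variable of a kernel. -/
lemma integral_kernel_mul_deriv (hf : ContDiffOn ℝ 1 f triangle) {u : ℝ → ℝ}
    (hu : IsPrimitive 1 u g) {x : ℝ} (hx : x ∈ Icc (0 : ℝ) 1) :
    ∫ ξ in (0 : ℝ)..x, f (x, ξ) * g ξ
      = f (x, x) * u x - f (x, 0) * u 0 - ∫ ξ in (0 : ℝ)..x, partialXi f (x, ξ) * u ξ := by
  have h1 := (isPrimitive_slice hf hx).integral_by_parts hx.1 (hu.mono hx)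
  have hu' : Integrable u unitMeasure := (integrable_unitMeasure_iff u).2
    (ContinuousOn.intervalIntegrable (by
      rw [uIcc_of_le zero_le_one]; exact hu.continuousOn zero_le_one))
  rw [intervalIntegral.integral_add
    (intervalIntegrable_slice_mul (continuousOn_partialXi hf) hu' hx)
    (intervalIntegrable_slice_mul hf.continuousOn ((integrable_unitMeasure_iff g).2 hu.1) hx)] at h1
  linarith

end TriangleCalculus

/-! ### Functionals, Volterra operators and weighted inner products on L². -/

section SquareIntegrable

open Filter Topology

instance : IsProbabilityMeasure unitMeasure := ⟨by simp⟩

lemma memLp_of_continuousOn {φ : ℝ → ℝ} (hφ : ContinuousOn φ (Icc 0 1)) (p : ℝ≥0∞) :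
    MemLp φ p unitMeasure := by
  obtain ⟨C, hC⟩ := isCompact_Icc.exists_bound_of_continuousOn hφ
  refine MemLp.of_bound (hφ.aestronglyMeasurable measurableSet_Icc) C ?_
  rw [ae_restrict_iff' measurableSet_Icc]
  exact Eventually.of_forall hC

lemma memLp_leftState (f : LeftState) : MemLp f 2 unitMeasure := Lp.memLp f

lemma integrable_leftState (f : LeftState) : Integrable f unitMeasure :=
  (memLp_leftState f).integrable (by norm_num)

lemma integrable_leftState_mul (f : LeftState) {φ : ℝ → ℝ} (hφ : MemLp φ 2 unitMeasure) :
    Integrable (fun x => f x * φ x) unitMeasure :=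
  (memLp_leftState f).integrable_mul hφ

open Classical in
/-- The functional `f ↦ ∫ f φ` on `L²`, for square integrable `φ`. -/
noncomputable def pairing (φ : ℝ → ℝ) : LeftState →L[ℝ] ℝ :=
  if h : MemLp φ 2 unitMeasure then innerSL ℝ h.toLp else 0

lemma pairing_apply {φ : ℝ → ℝ} (hφ : MemLp φ 2 unitMeasure) (f : LeftState) :
    pairing φ f = ∫ x, f x * φ x ∂unitMeasure := by
  rw [pairing, dif_pos hφ, innerSL_apply_apply, L2.inner_def]
  refine integral_congr_ae ?_
  filter_upwards [hφ.coeFn_toLp] with x hx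
  rw [hx]; rfl

lemma norm_sq_leftState (f : LeftState) : ‖f‖ ^ 2 = ∫ x, f x ^ 2 ∂unitMeasure := by
  rw [← real_inner_self_eq_norm_sq, L2.inner_def]
  refine integral_congr_ae (Eventually.of_forall fun x => ?_)
  simp

/-- The components of an `ℝ³`-valued square integrable function. -/
noncomputable def component (i : Fin 3) : RightState →L[ℝ] LeftState :=
  (EuclideanSpace.proj i : EuclideanSpace ℝ (Fin 3) →L[ℝ] ℝ).compLpL 2 unitMeasure

lemma coeFn_component (i : Fin 3) (w : RightState) :
    component i w =ᵐ[unitMeasure] fun x => w x i :=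
  ContinuousLinearMap.coeFn_compLpL _ w

lemma norm_sq_rightState (w : RightState) : ‖w‖ ^ 2 = ∑ i, ‖component i w‖ ^ 2 := by
  simp only [norm_sq_leftState]
  rw [← integral_finsetSum _ fun i _ => (memLp_leftState _).integrable_sq,
    ← real_inner_self_eq_norm_sq, L2.inner_def]
  refine integral_congr_ae ?_
  filter_upwards [coeFn_component 0 w, coeFn_component 1 w, coeFn_component 2 w] with x h0 h1 h2
  simp only [Fin.sum_univ_three, h0, h1, h2, real_inner_self_eq_norm_sq, EuclideanSpace.norm_sq_eq,
    Real.norm_eq_abs, sq_abs]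

/-- A square integrable function with given components. -/
lemma exists_rightState (f : Fin 3 → LeftState) : ∃ w : RightState, ∀ i, component i w = f i := by
  have hm : MemLp (fun x => (WithLp.toLp 2 fun i => f i x : EuclideanSpace ℝ (Fin 3))) 2
      unitMeasure := memLp_piLp_iff.2 fun i => memLp_leftState (f i)
  refine ⟨hm.toLp, fun i => ?_⟩
  refine Lp.ext ?_
  filter_upwards [coeFn_component i hm.toLp, hm.coeFn_toLp] with x h1 h2
  rw [h1, h2]

/-- Nonnegativity of ∫(h - c)² with c the integral of h. Mass at most 1, rather than exactly 1, is
what the application on subintervals [0, x] needs. -/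
lemma sq_integral_le {α : Type*} [MeasurableSpace α] {ν : Measure α} [IsFiniteMeasure ν]
    (hν : ν.real univ ≤ 1) {h : α → ℝ} (hh : MemLp h 2 ν) : (∫ x, h x ∂ν) ^ 2 ≤ ∫ x, h x ^ 2 ∂ν := by
  set c := ∫ x, h x ∂ν with hc
  have h1 : Integrable h ν := hh.integrable (by norm_num)
  have h2 : 0 ≤ ∫ x, (h x - c) ^ 2 ∂ν := integral_nonneg fun x => sq_nonneg _
  have h3 : ∫ x, (h x - c) ^ 2 ∂ν = (∫ x, h x ^ 2 ∂ν) - 2 * c * c + ν.real univ * c ^ 2 := by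
    have : ∀ x, (h x - c) ^ 2 = h x ^ 2 - 2 * c * h x + c ^ 2 := fun x => by ring
    simp only [this]
    rw [integral_add (f := fun x => h x ^ 2 - 2 * c * h x)
      (hh.integrable_sq.sub (h1.const_mul _)) (integrable_const _), integral_sub hh.integrable_sq (h1.const_mul _), integral_const_mul, integral_const,
      smul_eq_mul, ← hc]
  have h4 : ν.real univ * c ^ 2 ≤ 1 * c ^ 2 := by gcongr
  nlinarith

lemma integral_norm_leftState_le (f : LeftState) : ∫ x, ‖f x‖ ∂unitMeasure ≤ ‖f‖ := by
  have h1 := sq_integral_le (ν := unitMeasure) (by simp) (memLp_leftState f).norm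
  refine le_of_sq_le_sq (h1.trans (le_of_eq ?_)) (norm_nonneg _)
  rw [norm_sq_leftState]
  simp

lemma norm_integral_mul_le (f : LeftState) {φ : ℝ → ℝ} {C : ℝ} (hC : 0 ≤ C)
    (hφ : ∀ x, ‖φ x‖ ≤ C) : ‖∫ x, φ x * f x ∂unitMeasure‖ ≤ C * ‖f‖ := by
  refine (norm_integral_le_of_norm_le ((integrable_leftState f).norm.const_mul C)
    (Eventually.of_forall fun x => ?_)).trans ?_
  · rw [norm_mul]
    gcongr
    exact hφ x
  · rw [integral_const_mul]
    gcongr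
    exact integral_norm_leftState_le f

lemma memLp_kernel_integral {k : ℝ × ℝ → ℝ} (hk : ContinuousOn k triangle) (f : LeftState) :
    MemLp (fun x => ∫ ξ, triangle.indicator k (x, ξ) * f ξ ∂unitMeasure) 2 unitMeasure := by
  obtain ⟨C, hC0, hC⟩ := exists_indicator_triangle_bound hk
  refine MemLp.of_bound ?_ (C * ‖f‖)
    (Eventually.of_forall fun x => norm_integral_mul_le f hC0 fun ξ => hC _)
  have h1 : StronglyMeasurable (Function.uncurry fun x ξ => triangle.indicator k (x, ξ) * f ξ) :=
    (measurable_indicator_triangle hk).stronglyMeasurable.mul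
      ((Lp.stronglyMeasurable f).comp_measurable measurable_snd)
  exact h1.integral_prod_right.aestronglyMeasurable

lemma integrable_kernel_slice {k : ℝ × ℝ → ℝ} (hk : ContinuousOn k triangle) (f : LeftState)
    (x : ℝ) : Integrable (fun ξ => triangle.indicator k (x, ξ) * f ξ) unitMeasure := by
  obtain ⟨C, hC0, hC⟩ := exists_indicator_triangle_bound hk
  exact (integrable_leftState f).bdd_mul ((measurable_indicator_triangle hk).comp
    measurable_prodMk_left).aestronglyMeasurable (Eventually.of_forall fun ξ => hC _)

open Classical in
/-- The Volterra operator with a continuous kernel on the triangle. -/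
noncomputable def volterra (k : ℝ × ℝ → ℝ) : LeftState →L[ℝ] LeftState :=
  if hk : ContinuousOn k triangle then
    LinearMap.mkContinuousOfExistsBound
    { toFun := fun f => (memLp_kernel_integral hk f).toLp
      map_add' := fun f g => by
        rw [← MemLp.toLp_add]
        refine MemLp.toLp_congr _ _ (Eventually.of_forall fun x => ?_)
        rw [Pi.add_apply, ← integral_add (integrable_kernel_slice hk f x)
          (integrable_kernel_slice hk g x)]
        refine integral_congr_ae ?_
        filter_upwards [Lp.coeFn_add f g] with ξ hξ
        rw [hξ, Pi.add_apply, mul_add]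
      map_smul' := fun c f => by
        rw [RingHom.id_apply, ← MemLp.toLp_const_smul]
        refine MemLp.toLp_congr _ _ (Eventually.of_forall fun x => ?_)
        rw [Pi.smul_apply, smul_eq_mul, ← integral_const_mul]
        refine integral_congr_ae ?_
        filter_upwards [Lp.coeFn_smul c f] with ξ hξ
        rw [hξ, Pi.smul_apply, smul_eq_mul]
        ring } (by
      obtain ⟨C, hC0, hC⟩ := exists_indicator_triangle_bound hk
      refine ⟨C, fun f => ?_⟩
      have h1 := Lp.norm_le_of_ae_bound (f := (memLp_kernel_integral hk f).toLp)
        (C := C * ‖f‖) (by positivity) (by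
          filter_upwards [(memLp_kernel_integral hk f).coeFn_toLp] with x hx
          rw [hx]
          exact norm_integral_mul_le f hC0 fun ξ => hC _)
      simpa [measureUnivNNReal] using h1)
  else 0

lemma coeFn_volterra {k : ℝ × ℝ → ℝ} (hk : ContinuousOn k triangle) (f : LeftState) :
    volterra k f =ᵐ[unitMeasure] fun x => ∫ ξ in (0 : ℝ)..x, k (x, ξ) * f ξ := by
  have h1 : volterra k f = (memLp_kernel_integral hk f).toLp := by
    rw [volterra, dif_pos hk]; rfl
  rw [h1]
  filter_upwards [(memLp_kernel_integral hk f).coeFn_toLp,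
    ae_restrict_mem measurableSet_Icc] with x hx hx'
  rw [hx, integral_Icc_eq_integral_Ioc]
  exact integral_indicator_triangle_left f hx'.1 hx'.2 le_rfl

lemma memLp_exp_mul (s : ℝ) (f : LeftState) :
    MemLp (fun x => Real.exp (s * x) * f x) 2 unitMeasure :=
  (memLp_leftState f).mul (memLp_of_continuousOn (by fun_prop) ∞)

lemma integrable_exp_mul_mul (s : ℝ) (f g : LeftState) :
    Integrable (fun x => Real.exp (s * x) * (f x * g x)) unitMeasure := by
  refine (integrable_leftState_mul f (memLp_exp_mul s g)).congr (Eventually.of_forall fun x => ?_)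
  ring

/-- The exponentially weighted inner product of `L²`. -/
noncomputable def expInner (s : ℝ) : LeftState →L[ℝ] LeftState →L[ℝ] ℝ :=
  LinearMap.mkContinuous₂
    (LinearMap.mk₂ ℝ (fun f g => ∫ x, Real.exp (s * x) * (f x * g x) ∂unitMeasure)
      (fun f f' g => by
        rw [← integral_add (integrable_exp_mul_mul s f g) (integrable_exp_mul_mul s f' g)]
        refine integral_congr_ae ?_
        filter_upwards [Lp.coeFn_add f f'] with x hx
        rw [hx, Pi.add_apply]; ring)
      (fun c f g => by
        rw [smul_eq_mul, ← integral_const_mul]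
        refine integral_congr_ae ?_
        filter_upwards [Lp.coeFn_smul c f] with x hx
        rw [hx, Pi.smul_apply, smul_eq_mul]; ring)
      (fun f g g' => by
        rw [← integral_add (integrable_exp_mul_mul s f g) (integrable_exp_mul_mul s f g')]
        refine integral_congr_ae ?_
        filter_upwards [Lp.coeFn_add g g'] with x hx
        rw [hx, Pi.add_apply]; ring)
      (fun c f g => by
        rw [smul_eq_mul, ← integral_const_mul]
        refine integral_congr_ae ?_
        filter_upwards [Lp.coeFn_smul c g] with x hx
        rw [hx, Pi.smul_apply, smul_eq_mul]; ring))
    (Real.exp |s|) (fun f g => by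
      have hg := memLp_exp_mul s g
      have h1 : ‖hg.toLp‖ ≤ Real.exp |s| * ‖g‖ := by
        refine Lp.norm_le_mul_norm_of_ae_le_mul ?_
        filter_upwards [hg.coeFn_toLp, ae_restrict_mem measurableSet_Icc] with x hx hx'
        rw [hx, norm_mul, Real.norm_of_nonneg (Real.exp_pos _).le]
        gcongr
        have := abs_mul s x ▸ le_abs_self (s * x)
        rw [abs_of_nonneg hx'.1] at this
        exact this.trans (mul_le_of_le_one_right (abs_nonneg s) hx'.2)
      have h2 : ∫ x, Real.exp (s * x) * (f x * g x) ∂unitMeasure = inner ℝ f hg.toLp := by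
        rw [L2.inner_def]
        refine integral_congr_ae ?_
        filter_upwards [hg.coeFn_toLp] with x hx
        rw [hx]
        simp only [RCLike.inner_apply, conj_trivial]
        ring
      rw [LinearMap.mk₂_apply, h2]
      refine (norm_inner_le_norm _ _).trans ?_
      nlinarith [norm_nonneg f])

lemma expInner_apply (s : ℝ) (f g : LeftState) :
    expInner s f g = ∫ x, Real.exp (s * x) * (f x * g x) ∂unitMeasure := rfl

end SquareIntegrable

/-! ### The state space and the closed-loop generator as a relation. -/

section Generator

open Filter Topology

/-- The state space `ℝ² × L²([0,1], ℝ³) × L²([0,1], ℝ)`, as a Hilbert space. -/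
noncomputable abbrev StateSpace : Type :=
  WithLp 2 (OdeState × WithLp 2 (RightState × LeftState))

/-- The coordinates of the ODE state. -/
noncomputable def odeCoord (j : Fin 2) : StateSpace →L[ℝ] ℝ :=
  (EuclideanSpace.proj j : OdeState →L[ℝ] ℝ).comp
    (WithLp.fstL 2 ℝ OdeState (WithLp 2 (RightState × LeftState)))

/-- The components of the rightward transported state. -/
noncomputable def rightCoord (i : Fin 3) : StateSpace →L[ℝ] LeftState :=
  (component i).comp ((WithLp.fstL 2 ℝ RightState LeftState).comp
    (WithLp.sndL 2 ℝ OdeState (WithLp 2 (RightState × LeftState))))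

/-- The leftward transported state. -/
noncomputable def leftCoord : StateSpace →L[ℝ] LeftState :=
  (WithLp.sndL 2 ℝ RightState LeftState).comp
    (WithLp.sndL 2 ℝ OdeState (WithLp 2 (RightState × LeftState)))

/-- The state with given parts. -/
noncomputable def mkState (X : OdeState) (w : RightState) (z : LeftState) : StateSpace :=
  WithLp.toLp 2 (X, WithLp.toLp 2 (w, z))

@[simp] lemma odeCoord_mkState (j : Fin 2) (X : OdeState) (w : RightState) (z : LeftState) :
    odeCoord j (mkState X w z) = X j := rfl

@[simp] lemma rightCoord_mkState (i : Fin 3) (X : OdeState) (w : RightState) (z : LeftState) :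
    rightCoord i (mkState X w z) = component i w := rfl

@[simp] lemma leftCoord_mkState (X : OdeState) (w : RightState) (z : LeftState) :
    leftCoord (mkState X w z) = z := rfl

lemma norm_sq_mkState (X : OdeState) (w : RightState) (z : LeftState) :
    ‖mkState X w z‖ ^ 2 = ‖X‖ ^ 2 + (‖w‖ ^ 2 + ‖z‖ ^ 2) := by
  rw [WithLp.prod_norm_sq_eq_of_L2]
  congr 1
  exact WithLp.prod_norm_sq_eq_of_L2 _

lemma exists_eq_mkState (Y : StateSpace) : ∃ X w z, Y = mkState X w z :=
  ⟨_, _, _, rfl⟩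

lemma norm_sq_stateSpace (Y : StateSpace) :
    ‖Y‖ ^ 2 = ∑ j, odeCoord j Y ^ 2 + (∑ i, ‖rightCoord i Y‖ ^ 2 + ‖leftCoord Y‖ ^ 2) := by
  obtain ⟨X, w, z, rfl⟩ := exists_eq_mkState Y
  rw [norm_sq_mkState, norm_sq_rightState, EuclideanSpace.norm_sq_eq]
  simp

lemma stateSpace_ext {Y Y' : StateSpace} (hX : ∀ j, odeCoord j Y = odeCoord j Y')
    (hw : ∀ i, rightCoord i Y = rightCoord i Y') (hz : leftCoord Y = leftCoord Y') : Y = Y' := by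
  rw [← sub_eq_zero, ← norm_eq_zero, ← sq_eq_zero_iff, norm_sq_stateSpace]
  simp [map_sub, hX, hw, hz]

variable (S : NominalSystem) (k : BacksteppingKernels)

/-- The in-domain coupling terms of the rightward equations. -/
noncomputable def rightSource (i : Fin 3) : StateSpace →L[ℝ] LeftState :=
  ∑ j, S.sigPP i j • rightCoord j + S.sigPM i • leftCoord

/-- The in-domain coupling terms of the leftward equation. -/
noncomputable def leftSource : StateSpace →L[ℝ] LeftState :=
  ∑ j, S.sigMP j • rightCoord j + S.sigMM • leftCoord

/-- The boundary value `z(1)` that the backstepping feedback produces. -/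
noncomputable def closedLoopTrace : StateSpace →L[ℝ] ℝ :=
  ∑ i, (pairing fun ξ => k.K (1, ξ) i).comp (rightCoord i)
    + (pairing fun ξ => k.N (1, ξ)).comp leftCoord + ∑ j, k.γ 1 j • odeCoord j

/-- `G` is the time derivative of the closed loop at the state `Y`, weakly in space, with boundary
values `z(0) = z0` and `w(1) = w1`. -/
structure IsGenerator (Y G : StateSpace) (z0 : ℝ) (w1 : Fin 3 → ℝ) : Prop where
  ode : ∀ j, odeCoord j G = ∑ l, S.A j l * odeCoord l Y + S.B j * z0
  right : ∀ φ : ℝ → ℝ, ContDiff ℝ 1 φ → ∀ i, pairing φ (rightCoord i G)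
    = S.lamP i * ((S.Q i * z0 + ∑ j, S.C i j * odeCoord j Y) * φ 0 - w1 i * φ 1)
      + S.lamP i * pairing (deriv φ) (rightCoord i Y) + pairing φ (rightSource S i Y)
  left : ∀ φ : ℝ → ℝ, ContDiff ℝ 1 φ → pairing φ (leftCoord G)
    = S.lamM * (closedLoopTrace k Y * φ 1 - z0 * φ 0)
      - S.lamM * pairing (deriv φ) (leftCoord Y) + pairing φ (leftSource S Y)

variable {S k}

lemma IsGenerator.add {Y G Y' G' : StateSpace} {z0 z0' : ℝ} {w1 w1' : Fin 3 → ℝ}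
    (h : IsGenerator S k Y G z0 w1) (h' : IsGenerator S k Y' G' z0' w1') :
    IsGenerator S k (Y + Y') (G + G') (z0 + z0') (w1 + w1') := by
  refine ⟨fun j => ?_, fun φ hφ i => ?_, fun φ hφ => ?_⟩
  · simp only [map_add, h.ode, h'.ode, mul_add, Finset.sum_add_distrib]; ring
  · simp only [map_add, h.right φ hφ, h'.right φ hφ, mul_add, Finset.sum_add_distrib, Pi.add_apply]
    ring
  · simp only [map_add, h.left φ hφ, h'.left φ hφ]; ring

lemma IsGenerator.smul {Y G : StateSpace} {z0 : ℝ} {w1 : Fin 3 → ℝ}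
    (h : IsGenerator S k Y G z0 w1) (c : ℝ) :
    IsGenerator S k (c • Y) (c • G) (c * z0) (c • w1) := by
  refine ⟨fun j => ?_, fun φ hφ i => ?_, fun φ hφ => ?_⟩
  · simp only [map_smul, h.ode, smul_eq_mul, mul_add, Finset.mul_sum]
    congr 1
    · exact Finset.sum_congr rfl fun l _ => by ring
    · ring
  · have : ∑ j, S.C i j * (c * odeCoord j Y) = c * ∑ j, S.C i j * odeCoord j Y := by
      rw [Finset.mul_sum]; exact Finset.sum_congr rfl fun l _ => by ring
    simp only [map_smul, h.right φ hφ, smul_eq_mul, Pi.smul_apply, this]; ring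
  · simp only [map_smul, h.left φ hφ, smul_eq_mul]; ring

lemma IsGenerator.zero : IsGenerator S k 0 0 0 0 := by
  constructor <;> simp

variable (S k) in
/-- The graph of the closed-loop generator. -/
noncomputable def generatorGraph : Submodule ℝ (StateSpace × StateSpace) where
  carrier := {p | ∃ z0 w1, IsGenerator S k p.1 p.2 z0 w1}
  add_mem' := by
    rintro p q ⟨z0, w1, h⟩ ⟨z0', w1', h'⟩
    exact ⟨_, _, h.add h'⟩
  zero_mem' := ⟨0, 0, IsGenerator.zero⟩
  smul_mem' := by
    rintro c p ⟨z0, w1, h⟩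
    exact ⟨_, _, h.smul c⟩

lemma memLp_contDiff {φ : ℝ → ℝ} (hφ : ContDiff ℝ 1 φ) : MemLp φ 2 unitMeasure :=
  memLp_of_continuousOn hφ.continuous.continuousOn 2

lemma memLp_deriv {φ : ℝ → ℝ} (hφ : ContDiff ℝ 1 φ) : MemLp (deriv φ) 2 unitMeasure :=
  memLp_of_continuousOn (hφ.continuous_deriv le_rfl).continuousOn 2

/-- Membership in the domain is regularity in x: after moving the coupling terms to the left, the
weak identity identifies the component with an absolutely continuous function whose end values are
the prescribed traces. -/
lemma IsGenerator.exists_right_primitive {Y G : StateSpace} {z0 : ℝ} {w1 : Fin 3 → ℝ}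
    (hP : ∀ i, 0 < S.lamP i) (h : IsGenerator S k Y G z0 w1) (i : Fin 3) :
    ∃ wh : ℝ → ℝ, IsPrimitive 1 wh
        (fun x => -((S.lamP i)⁻¹ * (rightCoord i G - rightSource S i Y : LeftState) x)) ∧
      rightCoord i Y =ᵐ[unitMeasure] wh ∧ wh 0 = S.Q i * z0 + ∑ j, S.C i j * odeCoord j Y ∧
      wh 1 = w1 i := by
  refine exists_primitive_of_weak (integrable_leftState _) (integrable_leftState _) (hP i).ne'
    fun φ hφ => ?_
  rw [← pairing_apply (memLp_contDiff hφ), ← pairing_apply (memLp_deriv hφ), map_sub,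
    h.right φ hφ i]
  ring

/-- As for the rightward components, but with speed -Λ⁻, because the transport goes the other way.
-/
lemma IsGenerator.exists_left_primitive {Y G : StateSpace} {z0 : ℝ} {w1 : Fin 3 → ℝ}
    (hM : 0 < S.lamM) (h : IsGenerator S k Y G z0 w1) :
    ∃ zh : ℝ → ℝ, IsPrimitive 1 zh
        (fun x => S.lamM⁻¹ * (leftCoord G - leftSource S Y : LeftState) x) ∧
      leftCoord Y =ᵐ[unitMeasure] zh ∧ zh 0 = z0 ∧ zh 1 = closedLoopTrace k Y := by
  have := exists_primitive_of_weak (integrable_leftState (leftCoord Y))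
    (integrable_leftState (leftCoord G - leftSource S Y)) (neg_ne_zero.2 hM.ne')
    (a := z0) (b := closedLoopTrace k Y) fun φ hφ => by
      rw [← pairing_apply (memLp_contDiff hφ), ← pairing_apply (memLp_deriv hφ), map_sub,
        h.left φ hφ]
      ring
  simpa only [inv_neg, neg_mul, neg_neg] using this

lemma coeFn_rightSource (i : Fin 3) (Y : StateSpace) :
    rightSource S i Y =ᵐ[unitMeasure]
      fun x => ∑ j, S.sigPP i j * rightCoord j Y x + S.sigPM i * leftCoord Y x := by
  have e : rightSource S i Y = S.sigPP i 0 • rightCoord 0 Y + S.sigPP i 1 • rightCoord 1 Y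
      + S.sigPP i 2 • rightCoord 2 Y + S.sigPM i • leftCoord Y := by
    simp [rightSource, Fin.sum_univ_three]
  rw [e]
  filter_upwards [Lp.coeFn_add (S.sigPP i 0 • rightCoord 0 Y + S.sigPP i 1 • rightCoord 1 Y
      + S.sigPP i 2 • rightCoord 2 Y) (S.sigPM i • leftCoord Y),
    Lp.coeFn_add (S.sigPP i 0 • rightCoord 0 Y + S.sigPP i 1 • rightCoord 1 Y)
      (S.sigPP i 2 • rightCoord 2 Y),
    Lp.coeFn_add (S.sigPP i 0 • rightCoord 0 Y) (S.sigPP i 1 • rightCoord 1 Y),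
    Lp.coeFn_smul (S.sigPP i 0) (rightCoord 0 Y), Lp.coeFn_smul (S.sigPP i 1) (rightCoord 1 Y),
    Lp.coeFn_smul (S.sigPP i 2) (rightCoord 2 Y), Lp.coeFn_smul (S.sigPM i) (leftCoord Y)]
    with x h1 h2 h3 h4 h5 h6 h7
  simp only [h1, h2, h3, h4, h5, h6, h7, Pi.add_apply, Pi.smul_apply, smul_eq_mul,
    Fin.sum_univ_three]

lemma coeFn_leftSource (Y : StateSpace) :
    leftSource S Y =ᵐ[unitMeasure]
      fun x => ∑ j, S.sigMP j * rightCoord j Y x + S.sigMM * leftCoord Y x := by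
  have e : leftSource S Y = S.sigMP 0 • rightCoord 0 Y + S.sigMP 1 • rightCoord 1 Y
      + S.sigMP 2 • rightCoord 2 Y + S.sigMM • leftCoord Y := by
    simp [leftSource, Fin.sum_univ_three]
  rw [e]
  filter_upwards [Lp.coeFn_add (S.sigMP 0 • rightCoord 0 Y + S.sigMP 1 • rightCoord 1 Y
      + S.sigMP 2 • rightCoord 2 Y) (S.sigMM • leftCoord Y),
    Lp.coeFn_add (S.sigMP 0 • rightCoord 0 Y + S.sigMP 1 • rightCoord 1 Y)
      (S.sigMP 2 • rightCoord 2 Y),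
    Lp.coeFn_add (S.sigMP 0 • rightCoord 0 Y) (S.sigMP 1 • rightCoord 1 Y),
    Lp.coeFn_smul (S.sigMP 0) (rightCoord 0 Y), Lp.coeFn_smul (S.sigMP 1) (rightCoord 1 Y),
    Lp.coeFn_smul (S.sigMP 2) (rightCoord 2 Y), Lp.coeFn_smul S.sigMM (leftCoord Y)]
    with x h1 h2 h3 h4 h5 h6 h7
  simp only [h1, h2, h3, h4, h5, h6, h7, Pi.add_apply, Pi.smul_apply, smul_eq_mul,
    Fin.sum_univ_three]

end Generator

/-! ### The backstepping transformation on the domain of the generator. -/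

section Backstepping

open Filter Topology

lemma ContinuousOn.integrable_unitMeasure {u : ℝ → ℝ} (hu : ContinuousOn u (Icc 0 1)) :
    Integrable u unitMeasure := (memLp_of_continuousOn hu 1).integrable le_rfl

/-- Lets the pointwise identities (evolution equations, kernel equations) be integrated over [0, x]
into linear relations between finitely many numbers, so that the final cancellation is pure linear
algebra. -/
lemma integral_linear_combination {n : ℕ} {h : ℝ → ℝ} {c : Fin n → ℝ} {F : Fin n → ℝ → ℝ} {x : ℝ}
    (hx : x ∈ Icc (0 : ℝ) 1) (hF : ∀ e, IntervalIntegrable (F e) volume 0 x)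
    (hh : ∀ᵐ ξ ∂unitMeasure, ξ ≤ x → h ξ = ∑ e, c e * F e ξ) :
    ∫ ξ in (0 : ℝ)..x, h ξ = ∑ e, c e * ∫ ξ in (0 : ℝ)..x, F e ξ := by
  have h1 : ∫ ξ in (0 : ℝ)..x, h ξ = ∫ ξ in (0 : ℝ)..x, ∑ e, c e * F e ξ := by
    refine intervalIntegral.integral_congr_ae ?_
    rw [ae_restrict_iff' measurableSet_Icc] at hh
    filter_upwards [hh] with ξ hξ hξ'
    rw [uIoc_of_le hx.1] at hξ'
    exact hξ ⟨hξ'.1.le, hξ'.2.trans hx.2⟩ hξ'.2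
  rw [h1, intervalIntegral.integral_finsetSum fun e _ => (hF e).const_mul (c e)]
  simp only [intervalIntegral.integral_const_mul]

open Classical in
/-- A square integrable function on `[0,1]` as an element of `L²`. -/
noncomputable def toLeftState (φ : ℝ → ℝ) : LeftState :=
  if h : MemLp φ 2 unitMeasure then h.toLp else 0

lemma coeFn_toLeftState {φ : ℝ → ℝ} (hφ : ContinuousOn φ (Icc 0 1)) :
    toLeftState φ =ᵐ[unitMeasure] φ := by
  rw [toLeftState, dif_pos (memLp_of_continuousOn hφ 2)]
  exact MemLp.coeFn_toLp _

/-- The backstepping transformation. -/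
noncomputable def backstep (k : BacksteppingKernels) : StateSpace →L[ℝ] LeftState :=
  leftCoord - ∑ i, (volterra fun p => k.K p i).comp (rightCoord i)
    - (volterra k.N).comp leftCoord - ∑ j, (odeCoord j).smulRight (toLeftState fun x => k.γ x j)

variable {S : NominalSystem} {κ : Fin 2 → ℝ} {k : BacksteppingKernels}

lemma coeFn_backstep (hk : IsKernelSolution S κ k) (Y : StateSpace) :
    backstep k Y =ᵐ[unitMeasure] fun x => leftCoord Y x
      - ∑ i, (∫ ξ in (0 : ℝ)..x, k.K (x, ξ) i * rightCoord i Y ξ)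
      - (∫ ξ in (0 : ℝ)..x, k.N (x, ξ) * leftCoord Y ξ) - ∑ j, odeCoord j Y * k.γ x j := by
  have e : backstep k Y = leftCoord Y
      - (volterra (fun p => k.K p 0) (rightCoord 0 Y) + volterra (fun p => k.K p 1) (rightCoord 1 Y)
        + volterra (fun p => k.K p 2) (rightCoord 2 Y)) - volterra k.N (leftCoord Y)
      - (odeCoord 0 Y • toLeftState (fun x => k.γ x 0)
        + odeCoord 1 Y • toLeftState (fun x => k.γ x 1)) := by
    simp [backstep, Fin.sum_univ_three, Fin.sum_univ_two]
  rw [e]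
  have hK := fun i => coeFn_volterra (hk.contDiff_K i).continuousOn (rightCoord i Y)
  have hγ := fun j => coeFn_toLeftState (hk.contDiff_γ j).continuousOn
  have hK0 := hK 0
  have hK1 := hK 1
  have hK2 := hK 2
  have hN := coeFn_volterra hk.contDiff_N.continuousOn (leftCoord Y)
  have hγ0 := hγ 0
  have hγ1 := hγ 1
  generalize volterra (fun p => k.K p 0) (rightCoord 0 Y) = V0 at *
  generalize volterra (fun p => k.K p 1) (rightCoord 1 Y) = V1 at *
  generalize volterra (fun p => k.K p 2) (rightCoord 2 Y) = V2 at *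
  generalize volterra k.N (leftCoord Y) = V3 at *
  generalize toLeftState (fun x => k.γ x 0) = g0 at *
  generalize toLeftState (fun x => k.γ x 1) = g1 at *
  filter_upwards [Lp.coeFn_sub (leftCoord Y - (V0 + V1 + V2) - V3)
      (odeCoord 0 Y • g0 + odeCoord 1 Y • g1),
    Lp.coeFn_sub (leftCoord Y - (V0 + V1 + V2)) V3, Lp.coeFn_sub (leftCoord Y) (V0 + V1 + V2),
    Lp.coeFn_add (V0 + V1) V2, Lp.coeFn_add V0 V1,
    Lp.coeFn_add (odeCoord 0 Y • g0) (odeCoord 1 Y • g1), Lp.coeFn_smul (odeCoord 0 Y) g0,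
    Lp.coeFn_smul (odeCoord 1 Y) g1, hK0, hK1, hK2, hN, hγ0, hγ1]
    with x h1 h2 h3 h4 h5 h6 h7 h8 h9 h10 h11 h12 h13 h14
  simp only [h1, h2, h3, h4, h5, h6, h7, h8, h9, h10, h11, h12, h13, h14, Pi.add_apply,
    Pi.sub_apply, Pi.smul_apply, smul_eq_mul, Fin.sum_univ_three, Fin.sum_univ_two]

lemma IsPrimitive.congr_ae {u g g' : ℝ → ℝ} (h : IsPrimitive 1 u g)
    (hg : g =ᵐ[unitMeasure] g') : IsPrimitive 1 u g' := by
  refine ⟨(integrable_unitMeasure_iff g').1 (((integrable_unitMeasure_iff g).2 h.1).congr hg),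
    fun x hx => ?_⟩
  rw [h.2 x hx]
  congr 1
  refine intervalIntegral.integral_congr_ae ?_
  rw [EventuallyEq, ae_restrict_iff' measurableSet_Icc] at hg
  filter_upwards [hg] with ξ hξ hξ'
  rw [uIoc_of_le hx.1] at hξ'
  exact hξ ⟨hξ'.1.le, hξ'.2.trans hx.2⟩

lemma continuousOn_top_slice {f : ℝ × ℝ → ℝ} (hf : ContinuousOn f triangle) :
    ContinuousOn (fun ξ => f (1, ξ)) (Icc 0 1) :=
  hf.comp (by fun_prop) fun ξ hξ => ⟨hξ.1, hξ.2, le_rfl⟩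

lemma integral_volterra_congr {f : ℝ × ℝ → ℝ} {g g' : ℝ → ℝ} (hg : g =ᵐ[unitMeasure] g') {x : ℝ}
    (hx : x ∈ Icc (0 : ℝ) 1) :
    ∫ ξ in (0 : ℝ)..x, f (x, ξ) * g ξ = ∫ ξ in (0 : ℝ)..x, f (x, ξ) * g' ξ := by
  refine intervalIntegral.integral_congr_ae ?_
  rw [EventuallyEq, ae_restrict_iff' measurableSet_Icc] at hg
  filter_upwards [hg] with ξ hξ hξ'
  rw [uIoc_of_le hx.1] at hξ'
  rw [hξ ⟨hξ'.1.le, hξ'.2.trans hx.2⟩]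

set_option maxHeartbeats 1600000 in
/-- The backstepping transformation of a state in the domain solves
`Λ⁻ ρ' + Σ⁻⁻ ρ = transform of the derivative`, with `ρ(0) = z(0) - κ X` and `ρ(1) = 0`. -/
theorem IsGenerator.exists_backstep_primitive (hP : ∀ i, 0 < S.lamP i) (hM : 0 < S.lamM)
    (hk : IsKernelSolution S κ k) {Y G : StateSpace} {z0 : ℝ} {w1 : Fin 3 → ℝ}
    (h : IsGenerator S k Y G z0 w1) :
    ∃ ρ : ℝ → ℝ, IsPrimitive 1 ρ
        (fun x => S.lamM⁻¹ * (backstep k G x - S.sigMM * backstep k Y x)) ∧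
      backstep k Y =ᵐ[unitMeasure] ρ ∧ ρ 0 = z0 - ∑ j, κ j * odeCoord j Y ∧ ρ 1 = 0 := by
  choose wh hw hwY hw0 hw1 using h.exists_right_primitive hP
  obtain ⟨zh, hz, hzY, hz0, hz1⟩ := h.exists_left_primitive hM
  have hwc := fun i => (hw i).continuousOn zero_le_one
  have hzc := hz.continuousOn zero_le_one
  have hwi := fun i => (hwc i).integrable_unitMeasure
  have hzi := hzc.integrable_unitMeasure
  have hγ : ∀ j, IsPrimitive 1 (fun x => k.γ x j)
      (fun x => derivWithin (fun y => k.γ y j) (Icc 0 1) x) := fun j =>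
    IsPrimitive.of_hasDerivWithinAt zero_le_one
      (fun x hx => ((hk.contDiff_γ j).differentiableOn one_ne_zero x hx).hasDerivWithinAt)
      ((hk.contDiff_γ j).continuousOn_derivWithin (uniqueDiffOn_Icc zero_lt_one) le_rfl)
  -- The representative ρ is built from the absolutely continuous representatives of w and z; its
  -- derivative comes from the Leibniz rule and still has to be identified.
  have hρ := ((hz.sub (IsPrimitive.finset_sum Finset.univ fun i _ =>
    isPrimitive_volterra (hk.contDiff_K i) (hwi i))).sub
      (isPrimitive_volterra hk.contDiff_N hzi)).sub
    (IsPrimitive.finset_sum Finset.univ fun j _ => (hγ j).const_mul (odeCoord j Y))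
  refine ⟨_, hρ.congr_ae ?_, ?_, ?_, ?_⟩
  -- The equations in strong form: the time derivative as transport term plus coupling, expressed
  -- through the spatial derivatives of the representatives.
  · have hGw : ∀ i, rightCoord i G =ᵐ[unitMeasure] fun ξ =>
        -S.lamP i * -((S.lamP i)⁻¹ * (rightCoord i G - rightSource S i Y : LeftState) ξ)
          + (∑ j, S.sigPP i j * wh j ξ + S.sigPM i * zh ξ) := by
      intro i
      filter_upwards [coeFn_rightSource (S := S) i Y, hwY 0, hwY 1, hwY 2, hzY,
        Lp.coeFn_sub (rightCoord i G) (rightSource S i Y)] with ξ h1 h2 h3 h4 h5 h6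
      have := (hP i).ne'
      rw [h6, Pi.sub_apply, h1]
      simp only [Fin.sum_univ_three, h2, h3, h4, h5]
      field_simp
      ring
    have hGz : leftCoord G =ᵐ[unitMeasure] fun ξ =>
        S.lamM * (S.lamM⁻¹ * (leftCoord G - leftSource S Y : LeftState) ξ)
          + (∑ j, S.sigMP j * wh j ξ + S.sigMM * zh ξ) := by
      filter_upwards [coeFn_leftSource (S := S) Y, hwY 0, hwY 1, hwY 2, hzY,
        Lp.coeFn_sub (leftCoord G) (leftSource S Y)] with ξ h1 h2 h3 h4 h5 h6
      rw [h6, Pi.sub_apply, h1]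
      simp only [Fin.sum_univ_three, h2, h3, h4, h5]
      field_simp
      ring
    filter_upwards [coeFn_backstep hk G, coeFn_backstep hk Y, hzY, hGz,
      ae_restrict_mem measurableSet_Icc] with x hx1 hx2 hx4 hx5 hx
    set wd : Fin 3 → ℝ → ℝ := fun i ξ =>
      -((S.lamP i)⁻¹ * (rightCoord i G - rightSource S i Y : LeftState) ξ) with hwd
    set zd : ℝ → ℝ := fun ξ => S.lamM⁻¹ * (leftCoord G - leftSource S Y : LeftState) ξ with hzd
    have hwdi : ∀ i, Integrable (wd i) unitMeasure := fun i =>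
      (integrable_unitMeasure_iff _).2 (hw i).1
    have hzdi : Integrable zd unitMeasure := (integrable_unitMeasure_iff _).2 hz.1
    have hKc := fun i => (hk.contDiff_K i).continuousOn
    have hNc := hk.contDiff_N.continuousOn
    have a1 : ∀ i, ∫ ξ in (0 : ℝ)..x, k.K (x, ξ) i * rightCoord i G ξ
        = -S.lamP i * (∫ ξ in (0 : ℝ)..x, k.K (x, ξ) i * wd i ξ)
          + S.sigPP i 0 * (∫ ξ in (0 : ℝ)..x, k.K (x, ξ) i * wh 0 ξ)
          + S.sigPP i 1 * (∫ ξ in (0 : ℝ)..x, k.K (x, ξ) i * wh 1 ξ)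
          + S.sigPP i 2 * (∫ ξ in (0 : ℝ)..x, k.K (x, ξ) i * wh 2 ξ)
          + S.sigPM i * (∫ ξ in (0 : ℝ)..x, k.K (x, ξ) i * zh ξ) := by
      intro i
      have := integral_linear_combination (h := fun ξ => k.K (x, ξ) i * rightCoord i G ξ)
        (c := ![-S.lamP i, S.sigPP i 0, S.sigPP i 1, S.sigPP i 2, S.sigPM i])
        (F := ![fun ξ => k.K (x, ξ) i * wd i ξ, fun ξ => k.K (x, ξ) i * wh 0 ξ,
          fun ξ => k.K (x, ξ) i * wh 1 ξ, fun ξ => k.K (x, ξ) i * wh 2 ξ,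
          fun ξ => k.K (x, ξ) i * zh ξ]) hx ?_ ?_
      · rw [this]; simp [Fin.sum_univ_succ]; ring
      · simp only [Fin.forall_fin_succ]
        exact ⟨intervalIntegrable_slice_mul (hKc i) (hwdi i) hx,
          intervalIntegrable_slice_mul (hKc i) (hwi 0) hx,
          intervalIntegrable_slice_mul (hKc i) (hwi 1) hx,
          intervalIntegrable_slice_mul (hKc i) (hwi 2) hx,
          intervalIntegrable_slice_mul (hKc i) hzi hx, fun e => e.elim0⟩
      · filter_upwards [hGw i] with ξ hξ _
        rw [hξ]; simp [Fin.sum_univ_succ, hwd]; ring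
    have a2 : ∫ ξ in (0 : ℝ)..x, k.N (x, ξ) * leftCoord G ξ
        = S.lamM * (∫ ξ in (0 : ℝ)..x, k.N (x, ξ) * zd ξ)
          + S.sigMP 0 * (∫ ξ in (0 : ℝ)..x, k.N (x, ξ) * wh 0 ξ)
          + S.sigMP 1 * (∫ ξ in (0 : ℝ)..x, k.N (x, ξ) * wh 1 ξ)
          + S.sigMP 2 * (∫ ξ in (0 : ℝ)..x, k.N (x, ξ) * wh 2 ξ)
          + S.sigMM * (∫ ξ in (0 : ℝ)..x, k.N (x, ξ) * zh ξ) := by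
      have := integral_linear_combination (h := fun ξ => k.N (x, ξ) * leftCoord G ξ)
        (c := ![S.lamM, S.sigMP 0, S.sigMP 1, S.sigMP 2, S.sigMM])
        (F := ![fun ξ => k.N (x, ξ) * zd ξ, fun ξ => k.N (x, ξ) * wh 0 ξ,
          fun ξ => k.N (x, ξ) * wh 1 ξ, fun ξ => k.N (x, ξ) * wh 2 ξ,
          fun ξ => k.N (x, ξ) * zh ξ]) hx ?_ ?_
      · rw [this]; simp [Fin.sum_univ_succ]; ring
      · simp only [Fin.forall_fin_succ]
        exact ⟨intervalIntegrable_slice_mul hNc hzdi hx,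
          intervalIntegrable_slice_mul hNc (hwi 0) hx,
          intervalIntegrable_slice_mul hNc (hwi 1) hx,
          intervalIntegrable_slice_mul hNc (hwi 2) hx,
          intervalIntegrable_slice_mul hNc hzi hx, fun e => e.elim0⟩
      · filter_upwards [hGz] with ξ hξ _
        rw [hξ]; simp [Fin.sum_univ_succ, hzd]; ring
    -- The kernel equation of K, tested with w on the slice [0, x]; `a4` is the same for N and z.
    -- These exchange x-derivatives of the kernels for ξ-derivatives.
    have a3 : ∀ i, S.lamM * ∫ ξ in (0 : ℝ)..x, partialX (fun q => k.K q i) (x, ξ) * wh i ξ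
        = S.lamP i * (∫ ξ in (0 : ℝ)..x, partialXi (fun q => k.K q i) (x, ξ) * wh i ξ)
          + S.sigMP i * (∫ ξ in (0 : ℝ)..x, k.N (x, ξ) * wh i ξ)
          + S.sigPP 0 i * (∫ ξ in (0 : ℝ)..x, k.K (x, ξ) 0 * wh i ξ)
          + S.sigPP 1 i * (∫ ξ in (0 : ℝ)..x, k.K (x, ξ) 1 * wh i ξ)
          + S.sigPP 2 i * (∫ ξ in (0 : ℝ)..x, k.K (x, ξ) 2 * wh i ξ)
          - S.sigMM * (∫ ξ in (0 : ℝ)..x, k.K (x, ξ) i * wh i ξ) := by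
      intro i
      rw [← intervalIntegral.integral_const_mul]
      have := integral_linear_combination
        (h := fun ξ => S.lamM * (partialX (fun q => k.K q i) (x, ξ) * wh i ξ))
        (c := ![S.lamP i, S.sigMP i, S.sigPP 0 i, S.sigPP 1 i, S.sigPP 2 i, -S.sigMM])
        (F := ![fun ξ => partialXi (fun q => k.K q i) (x, ξ) * wh i ξ, fun ξ => k.N (x, ξ) * wh i ξ,
          fun ξ => k.K (x, ξ) 0 * wh i ξ, fun ξ => k.K (x, ξ) 1 * wh i ξ,
          fun ξ => k.K (x, ξ) 2 * wh i ξ, fun ξ => k.K (x, ξ) i * wh i ξ]) hx ?_ ?_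
      · rw [this]; simp [Fin.sum_univ_succ]; ring
      · simp only [Fin.forall_fin_succ]
        exact ⟨intervalIntegrable_slice_mul (continuousOn_partialXi (hk.contDiff_K i)) (hwi i) hx,
          intervalIntegrable_slice_mul hNc (hwi i) hx,
          intervalIntegrable_slice_mul (hKc 0) (hwi i) hx,
          intervalIntegrable_slice_mul (hKc 1) (hwi i) hx,
          intervalIntegrable_slice_mul (hKc 2) (hwi i) hx,
          intervalIntegrable_slice_mul (hKc i) (hwi i) hx, fun e => e.elim0⟩
      · filter_upwards [ae_restrict_mem measurableSet_Icc] with ξ hξ hξx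
        rw [← mul_assoc, hk.eq_K (x, ξ) ⟨hξ.1, hξx, hx.2⟩ i]
        simp [Fin.sum_univ_succ]; ring
    have a4 : S.lamM * (∫ ξ in (0 : ℝ)..x, partialX k.N (x, ξ) * zh ξ)
        = -S.lamM * (∫ ξ in (0 : ℝ)..x, partialXi k.N (x, ξ) * zh ξ)
          + S.sigPM 0 * (∫ ξ in (0 : ℝ)..x, k.K (x, ξ) 0 * zh ξ)
          + S.sigPM 1 * (∫ ξ in (0 : ℝ)..x, k.K (x, ξ) 1 * zh ξ)
          + S.sigPM 2 * (∫ ξ in (0 : ℝ)..x, k.K (x, ξ) 2 * zh ξ) := by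
      rw [← intervalIntegral.integral_const_mul]
      have := integral_linear_combination
        (h := fun ξ => S.lamM * (partialX k.N (x, ξ) * zh ξ))
        (c := ![-S.lamM, S.sigPM 0, S.sigPM 1, S.sigPM 2])
        (F := ![fun ξ => partialXi k.N (x, ξ) * zh ξ,
          fun ξ => k.K (x, ξ) 0 * zh ξ, fun ξ => k.K (x, ξ) 1 * zh ξ,
          fun ξ => k.K (x, ξ) 2 * zh ξ]) hx ?_ ?_
      · rw [this]; simp [Fin.sum_univ_succ]; ring
      · simp only [Fin.forall_fin_succ]
        exact ⟨intervalIntegrable_slice_mul (continuousOn_partialXi hk.contDiff_N) hzi hx,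
          intervalIntegrable_slice_mul (hKc 0) hzi hx,
          intervalIntegrable_slice_mul (hKc 1) hzi hx,
          intervalIntegrable_slice_mul (hKc 2) hzi hx, fun e => e.elim0⟩
      · filter_upwards [ae_restrict_mem measurableSet_Icc] with ξ hξ hξx
        have := hk.eq_N (x, ξ) ⟨hξ.1, hξx, hx.2⟩
        rw [Fin.sum_univ_three] at this
        rw [Fin.sum_univ_four]
        simp only [Matrix.cons_val]
        linear_combination zh ξ * this
    -- Integration by parts moves the spatial derivative from w to the kernel and leaves terms at ξ
    -- = x and ξ = 0.
    have a5 : ∀ i, ∫ ξ in (0 : ℝ)..x, k.K (x, ξ) i * wd i ξ = k.K (x, x) i * wh i x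
        - k.K (x, 0) i * wh i 0
        - ∫ ξ in (0 : ℝ)..x, partialXi (fun p => k.K p i) (x, ξ) * wh i ξ :=
      fun i => integral_kernel_mul_deriv (hk.contDiff_K i) (hw i) hx
    have a6 := integral_kernel_mul_deriv hk.contDiff_N hz hx
    have a7 : ∀ i, ∫ ξ in (0 : ℝ)..x, k.K (x, ξ) i * rightCoord i Y ξ
        = ∫ ξ in (0 : ℝ)..x, k.K (x, ξ) i * wh i ξ := fun i =>
      integral_volterra_congr (f := fun p => k.K p i) (hwY i) hx
    have a8 := integral_volterra_congr (f := k.N) hzY hx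
    have a9 := hk.diag_K x hx
    have a10 := hk.bdry_N x hx
    have a11 := hk.eq_γ x hx
    have a12 := h.ode
    have a9' : ∀ i, k.K (x, x) i * (S.lamM + S.lamP i) * wh i x = -S.sigMP i * wh i x :=
      fun i => by rw [a9 i]
    have a11' : ∀ j, odeCoord j Y * (S.lamM * derivWithin (fun y => k.γ y j) (Icc 0 1) x)
      = odeCoord j Y * (∑ l, k.γ x l * S.A l j - S.sigMM * k.γ x j
        + ∑ i, k.K (x, 0) i * S.lamP i * S.C i j) := fun j => by rw [a11 j]
    rw [hx1, hx2, hx5, eq_inv_mul_iff_mul_eq₀ hM.ne']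
    simp only [a1, a2, a5, a6, a7, a8, a12, hx4, hw0, hz0]
    have a30 := a3 0
    have a31 := a3 1
    have a32 := a3 2
    have a90 := a9' 0
    have a91 := a9' 1
    have a92 := a9' 2
    have a110 := a11' 0
    have a111 := a11' 1
    simp only [Fin.sum_univ_three, Fin.sum_univ_two] at a10 a110 a111 ⊢
    -- The interior integrals cancel by the kernel equations of K and N, the terms w(x) by the
    -- diagonal condition, the terms z(0) by the condition for N(x,0), and the terms X by the
    -- equation of γ.
    linear_combination -a30 - a31 - a32 - a4 - a90 - a91 - a92 - a110 - a111 - z0 * a10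
  · filter_upwards [coeFn_backstep hk Y, hzY, ae_restrict_mem measurableSet_Icc] with x h1 h2 hx
    rw [h1, h2, integral_volterra_congr (f := k.N) hzY hx]
    simp only [fun i => integral_volterra_congr (f := fun p => k.K p i) (hwY i) hx]
  · rw [hz0]
    have : ∀ j, k.γ 0 j = κ j := fun j => congrFun hk.init_γ j
    simp [this, mul_comm]
  -- At x = 1 the integrals and γ(1)X are precisely the value of z(1) enforced by the feedback, so
  -- ρ(1) = 0.
  · have h1 : (1 : ℝ) ∈ Icc (0 : ℝ) 1 := ⟨zero_le_one, le_rfl⟩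
    have e1 : ∀ i, pairing (fun ξ => k.K (1, ξ) i) (rightCoord i Y)
        = ∫ ξ in (0 : ℝ)..1, k.K (1, ξ) i * wh i ξ := fun i => by
      rw [pairing_apply (memLp_of_continuousOn (continuousOn_top_slice
          (hk.contDiff_K i).continuousOn) 2), integral_unitMeasure,
        ← integral_volterra_congr (f := fun p => k.K p i) (hwY i) h1]
      simp only [mul_comm]
    have e2 : pairing (fun ξ => k.N (1, ξ)) (leftCoord Y)
        = ∫ ξ in (0 : ℝ)..1, k.N (1, ξ) * zh ξ := by
      rw [pairing_apply (memLp_of_continuousOn (continuousOn_top_slice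
          hk.contDiff_N.continuousOn) 2), integral_unitMeasure,
        ← integral_volterra_congr (f := k.N) hzY h1]
      simp only [mul_comm]
    rw [hz1]
    simp only [closedLoopTrace, add_apply, ContinuousLinearMap.comp_apply, smul_apply,
      smul_eq_mul, e1, e2, Fin.sum_univ_three, Fin.sum_univ_two]
    ring

end Backstepping

/-! ### Planar Lyapunov forms and weighted energy estimates. -/

section Lyapunov

/-- The Hurwitz condition is applied to the explicit roots of the characteristic polynomial. For
real roots the sum and the product give the signs; for a conjugate pair the real part t/2 is
negative and the determinant exceeds t²/4. -/
lemma IsHurwitz.trace_neg_det_pos {M : Matrix (Fin 2) (Fin 2) ℝ} (hM : IsHurwitz M) :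
    M 0 0 + M 1 1 < 0 ∧ 0 < M 0 0 * M 1 1 - M 0 1 * M 1 0 := by
  have key : ∀ μ : ℂ, μ ^ 2 - (M 0 0 + M 1 1 : ℝ) * μ + (M 0 0 * M 1 1 - M 0 1 * M 1 0 : ℝ) = 0 →
      μ.re < 0 := by
    intro μ hμ
    refine hM μ ?_
    rw [spectrum.mem_iff, Matrix.isUnit_iff_isUnit_det, isUnit_iff_ne_zero, not_not,
      Matrix.det_fin_two]
    simp only [Matrix.algebraMap_matrix_apply, Matrix.sub_apply, Matrix.map_apply]
    push_cast at hμ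
    simp
    linear_combination hμ
  set t := M 0 0 + M 1 1
  set d := M 0 0 * M 1 1 - M 0 1 * M 1 0
  rcases le_or_gt 0 (t ^ 2 - 4 * d) with hD | hD
  · set r := √(t ^ 2 - 4 * d)
    have hr : r ^ 2 = t ^ 2 - 4 * d := Real.sq_sqrt hD
    have h1 := key ((t + r) / 2 : ℝ) (by
      norm_cast
      linear_combination hr / 4)
    have h2 := key ((t - r) / 2 : ℝ) (by
      norm_cast
      linear_combination hr / 4)
    rw [Complex.ofReal_re] at h1 h2
    refine ⟨by linarith, by nlinarith⟩
  · set r := √(4 * d - t ^ 2)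
    have hr : r ^ 2 = 4 * d - t ^ 2 := Real.sq_sqrt (by linarith)
    have h1 := key ⟨t / 2, r / 2⟩ (by
      apply Complex.ext
      · simp [sq]; linear_combination -hr / 4
      · simp [sq]; ring)
    refine ⟨by dsimp only at h1; linarith, by nlinarith [sq_nonneg t]⟩

/-- A quadratic Lyapunov function of a planar Hurwitz matrix. -/
lemma IsHurwitz.exists_lyapunov {M : Matrix (Fin 2) (Fin 2) ℝ} (hM : IsHurwitz M) :
    ∃ a b c p : ℝ, 0 < p ∧ ∀ x y : ℝ,
      p * (x ^ 2 + y ^ 2) ≤ a * x ^ 2 + 2 * b * (x * y) + c * y ^ 2 ∧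
      a * x * (M 0 0 * x + M 0 1 * y) + b * (x * (M 1 0 * x + M 1 1 * y)
        + y * (M 0 0 * x + M 0 1 * y)) + c * y * (M 1 0 * x + M 1 1 * y)
        ≤ -p * (x ^ 2 + y ^ 2) := by
  obtain ⟨ht, hd⟩ := hM.trace_neg_det_pos
  set d := M 0 0 * M 1 1 - M 0 1 * M 1 0 with hd'
  set t := M 0 0 + M 1 1 with ht'
  -- The form is H = d I + adj(M)ᵀ adj(M). From adj(M) M = d I and M + adj(M) = t I one gets H M +
  -- Mᵀ H = 2 t d I, which is negative.
  refine ⟨d + M 1 1 ^ 2 + M 1 0 ^ 2, -(M 1 1 * M 0 1) - M 1 0 * M 0 0, d + M 0 1 ^ 2 + M 0 0 ^ 2,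
    min d (-t * d), lt_min hd (by nlinarith), fun x y => ⟨?_, ?_⟩⟩
  · have h1 : min d (-t * d) * (x ^ 2 + y ^ 2) ≤ d * (x ^ 2 + y ^ 2) := by
      gcongr; exact min_le_left _ _
    nlinarith [sq_nonneg (M 1 1 * x - M 0 1 * y), sq_nonneg (M 1 0 * x - M 0 0 * y)]
  · have h1 : min d (-t * d) * (x ^ 2 + y ^ 2) ≤ (-t * d) * (x ^ 2 + y ^ 2) := by
      gcongr; exact min_le_right _ _
    have h2 : (d + M 1 1 ^ 2 + M 1 0 ^ 2) * x * (M 0 0 * x + M 0 1 * y)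
        + (-(M 1 1 * M 0 1) - M 1 0 * M 0 0) * (x * (M 1 0 * x + M 1 1 * y)
        + y * (M 0 0 * x + M 0 1 * y)) + (d + M 0 1 ^ 2 + M 0 0 ^ 2) * y * (M 1 0 * x + M 1 1 * y)
        = t * d * (x ^ 2 + y ^ 2) := by
      rw [hd', ht']; ring
    rw [h2]
    linarith

lemma expInner_symm (s : ℝ) (f g : LeftState) : expInner s f g = expInner s g f := by
  simp only [expInner_apply, mul_comm (f _)]

lemma expInner_mono {s s' c c' : ℝ} (h : ∀ x ∈ Icc (0 : ℝ) 1,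
    c * Real.exp (s * x) ≤ c' * Real.exp (s' * x)) (f : LeftState) :
    c * expInner s f f ≤ c' * expInner s' f f := by
  simp only [expInner_apply, ← integral_const_mul]
  refine integral_mono_ae ((integrable_exp_mul_mul s f f).const_mul c)
    ((integrable_exp_mul_mul s' f f).const_mul c') ?_
  filter_upwards [ae_restrict_mem measurableSet_Icc] with x hx
  have := mul_le_mul_of_nonneg_right (h x hx) (mul_self_nonneg (f x))
  simpa only [mul_assoc] using this

lemma norm_sq_eq_expInner (f : LeftState) : ‖f‖ ^ 2 = expInner 0 f f := by
  rw [norm_sq_leftState]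
  simp only [expInner_apply, sq, zero_mul, Real.exp_zero, one_mul]

lemma expInner_self_nonneg (s : ℝ) (f : LeftState) : 0 ≤ expInner s f f :=
  integral_nonneg fun _ => mul_nonneg (Real.exp_pos _).le (mul_self_nonneg _)

lemma two_mul_expInner_le (s : ℝ) (f g : LeftState) :
    2 * expInner s f g ≤ expInner s f f + expInner s g g := by
  have h := expInner_self_nonneg s (f - g)
  simp only [map_sub, sub_apply] at h
  linarith [expInner_symm s f g]

lemma two_mul_expInner_smul_le (s a : ℝ) (f g : LeftState) :
    2 * expInner s f (a • g) ≤ expInner s f f + a ^ 2 * expInner s g g := by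
  have h := two_mul_expInner_le s f (a • g)
  simp only [map_smul, smul_apply, smul_eq_mul] at h ⊢
  linarith

lemma expInner_add_le (s : ℝ) (f g : LeftState) :
    expInner s (f + g) (f + g) ≤ 2 * expInner s f f + 2 * expInner s g g := by
  have h := two_mul_expInner_le s f g
  simp only [map_add, add_apply]
  linarith [expInner_symm s f g]

/-- In the weighted norm with weight `exp (-ν x)` Volterra operators are small. -/
lemma exists_expInner_volterra_le {k : ℝ × ℝ → ℝ} (hk : ContinuousOn k triangle) :
    ∃ C, 0 ≤ C ∧ ∀ ν : ℝ, 0 < ν → ∀ f : LeftState,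
      expInner (-ν) (volterra k f) (volterra k f) ≤ C / ν * expInner (-ν) f f := by
  obtain ⟨C, hC⟩ := isCompact_triangle.exists_bound_of_continuousOn hk
  refine ⟨C ^ 2, sq_nonneg _, fun ν hν f => ?_⟩
  have hf2 : Integrable (fun x => f x ^ 2) unitMeasure := (memLp_leftState f).integrable_sq
  have hcont : ContinuousOn (fun p : ℝ × ℝ => Real.exp (-ν * p.1)) triangle := by fun_prop
  have hle : ∀ x ∈ Icc (0 : ℝ) 1, (∫ ξ in (0 : ℝ)..x, k (x, ξ) * f ξ) ^ 2
      ≤ C ^ 2 * ∫ ξ in (0 : ℝ)..x, f ξ ^ 2 := by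
    intro x hx
    rw [← intervalIntegral.integral_const_mul, intervalIntegral.integral_of_le hx.1,
      intervalIntegral.integral_of_le hx.1]
    have hm : MemLp f 2 (volume.restrict (Ioc 0 x)) := (memLp_leftState f).mono_measure
      (Measure.restrict_mono (Ioc_subset_Icc_self.trans (Icc_subset_Icc_right hx.2)) le_rfl)
    have hm2 : MemLp (fun ξ => k (x, ξ) * f ξ) 2 (volume.restrict (Ioc 0 x)) := by
      refine MemLp.mul (p := ∞) (q := 2) hm ?_
      refine memLp_top_of_bound (ContinuousOn.aestronglyMeasurable ?_ measurableSet_Ioc) C ?_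
      · exact hk.comp (by fun_prop) fun ξ hξ => ⟨hξ.1.le, hξ.2, hx.2⟩
      · rw [ae_restrict_iff' measurableSet_Ioc]
        exact Filter.Eventually.of_forall fun ξ hξ => hC _ ⟨hξ.1.le, hξ.2, hx.2⟩
    refine (sq_integral_le ?_ hm2).trans ?_
    · simp [Measure.real, hx.1, hx.2]
    · refine setIntegral_mono_on hm2.integrable_sq (hm.integrable_sq.const_mul _) measurableSet_Ioc
        fun ξ hξ => ?_
      rw [mul_pow]
      refine mul_le_mul_of_nonneg_right ?_ (sq_nonneg _)
      have := hC (x, ξ) ⟨hξ.1.le, hξ.2, hx.2⟩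
      rw [Real.norm_eq_abs] at this
      exact sq_le_sq' (by linarith [neg_abs_le (k (x, ξ))]) ((le_abs_self _).trans this)
  have hi := intervalIntegrable_volterra hcont hf2
  calc expInner (-ν) (volterra k f) (volterra k f)
      ≤ ∫ x in (0 : ℝ)..1, C ^ 2 * ∫ ξ in (0 : ℝ)..x, Real.exp (-ν * x) * f ξ ^ 2 := by
        rw [expInner_apply, ← integral_unitMeasure]
        refine integral_mono_ae (integrable_exp_mul_mul _ _ _)
          (((integrable_unitMeasure_iff _).2 hi).const_mul _) ?_
        filter_upwards [coeFn_volterra hk f, ae_restrict_mem measurableSet_Icc] with x hx hx'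
        rw [hx, intervalIntegral.integral_const_mul, ← sq]
        calc _ ≤ Real.exp (-ν * x) * (C ^ 2 * ∫ ξ in (0 : ℝ)..x, f ξ ^ 2) := by
              gcongr; exact hle x hx'
          _ = _ := by ring
    _ = C ^ 2 * ∫ ξ in (0 : ℝ)..1, (∫ x in ξ..1, Real.exp (-ν * x)) * f ξ ^ 2 := by
        rw [intervalIntegral.integral_const_mul]
        congr 1
        exact integral_triangle_swap (k := fun p => Real.exp (-ν * p.1)) hcont hf2 zero_le_one le_rfl
    _ ≤ C ^ 2 * ∫ ξ in (0 : ℝ)..1, ν⁻¹ * (Real.exp (-ν * ξ) * (f ξ * f ξ)) := by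
        -- Source of the smallness: after Cauchy–Schwarz on each slice and exchange of integrals,
        -- the weight integrated from ξ to 1 is at most exp(-νξ)/ν.
        have hder : ∀ ξ : ℝ, ∫ x in ξ..1, Real.exp (-ν * x)
            = ν⁻¹ * (Real.exp (-ν * ξ) - Real.exp (-ν)) := by
          intro ξ
          rw [intervalIntegral.integral_comp_mul_left (fun x => Real.exp x) (neg_ne_zero.2 hν.ne'),
            integral_exp]
          simp only [smul_eq_mul, mul_one]
          field_simp
          ring
        gcongr
        rw [← integral_unitMeasure, ← integral_unitMeasure]
        refine integral_mono_ae ?_ ((integrable_exp_mul_mul (-ν) f f).const_mul _)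
          (Filter.Eventually.of_forall fun ξ => ?_)
        · simp only [hder]
          refine hf2.bdd_mul (c := ν⁻¹ * (1 + Real.exp (-ν)))
            (ContinuousOn.aestronglyMeasurable (by fun_prop) measurableSet_Icc) ?_
          filter_upwards [ae_restrict_mem measurableSet_Icc] with x hx
          rw [norm_mul, Real.norm_of_nonneg (inv_nonneg.2 hν.le)]
          gcongr
          rw [Real.norm_eq_abs, abs_le]
          have h1 : Real.exp (-ν * x) ≤ 1 := Real.exp_le_one_iff.2 (by nlinarith [hx.1])
          constructor <;> linarith [Real.exp_pos (-ν), Real.exp_pos (-ν * x)]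
        · dsimp only
          rw [hder, ← sq, ← mul_assoc]
          gcongr
          linarith [Real.exp_pos (-ν)]
    _ = C ^ 2 / ν * expInner (-ν) f f := by
        rw [intervalIntegral.integral_const_mul, expInner_apply, integral_unitMeasure]
        ring

variable {S : NominalSystem} {κ : Fin 2 → ℝ} {k : BacksteppingKernels}

/-- The state `z` is controlled by its backstepping transform, `w` and `X`, uniformly for large
weights. -/
lemma exists_expInner_left_le (hk : IsKernelSolution S κ k) :
    ∃ C ν₀ : ℝ, 0 < C ∧ 0 < ν₀ ∧ ∀ ν : ℝ, ν₀ ≤ ν → ∀ Y : StateSpace,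
      expInner (-ν) (leftCoord Y) (leftCoord Y)
        ≤ C * (expInner (-ν) (backstep k Y) (backstep k Y)
          + ∑ i, expInner (-ν) (rightCoord i Y) (rightCoord i Y) + ∑ j, odeCoord j Y ^ 2) := by
  choose c hc0 hc using fun i => exists_expInner_volterra_le (hk.contDiff_K i).continuousOn
  obtain ⟨cN, hcN0, hcN⟩ := exists_expInner_volterra_le hk.contDiff_N.continuousOn
  set g : Fin 2 → ℝ := fun j => ‖toLeftState fun x => k.γ x j‖ ^ 2
  have hg0 : ∀ j, 0 ≤ g j := fun j => sq_nonneg _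
  set C0 := 1 + ∑ i, c i + cN + ∑ j, g j with hC0
  have hcle : ∀ i, c i ≤ ∑ i, c i := fun i => Finset.single_le_sum (fun i _ => hc0 i) (Finset.mem_univ i)
  have hgle : ∀ j, g j ≤ ∑ j, g j := fun i => Finset.single_le_sum (fun i _ => hg0 i) (Finset.mem_univ i)
  have hcs : 0 ≤ ∑ i, c i := Finset.sum_nonneg fun i _ => hc0 i
  have hgs : 0 ≤ ∑ j, g j := Finset.sum_nonneg fun i _ => hg0 i
  -- For ν ≥ 64 C0 the term with N costs at most 1/64 of the norm of z. Splitting the sum into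
  -- pieces multiplies this by 4, so it is absorbed on the left; the other terms get the factor 8.
  refine ⟨128 * C0, 64 * C0, by positivity, by positivity, fun ν hν Y => ?_⟩
  have hν0 : 0 < ν := by linarith
  have hC1 : C0 / ν ≤ 1 / 64 := by rw [div_le_div_iff₀ hν0 (by norm_num)]; linarith
  have e : leftCoord Y = (((backstep k Y + volterra (fun p => k.K p 0) (rightCoord 0 Y))
      + (volterra (fun p => k.K p 1) (rightCoord 1 Y)
        + volterra (fun p => k.K p 2) (rightCoord 2 Y)))
      + ((odeCoord 0 Y • toLeftState (fun x => k.γ x 0)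
        + odeCoord 1 Y • toLeftState (fun x => k.γ x 1)) + volterra k.N (leftCoord Y))) := by
    simp [backstep, Fin.sum_univ_three, Fin.sum_univ_two]
    abel
  have q1 : ∀ i, expInner (-ν) (volterra (fun p => k.K p i) (rightCoord i Y))
      (volterra (fun p => k.K p i) (rightCoord i Y))
      ≤ C0 * expInner (-ν) (rightCoord i Y) (rightCoord i Y) := fun i => by
    refine (hc i ν hν0 _).trans (mul_le_mul_of_nonneg_right ?_ (expInner_self_nonneg _ _))
    have : c i / ν ≤ C0 / ν := by gcongr; linarith [hcle i]
    linarith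
  have q2 : ∀ j, expInner (-ν) (odeCoord j Y • toLeftState (fun x => k.γ x j))
      (odeCoord j Y • toLeftState (fun x => k.γ x j)) ≤ C0 * odeCoord j Y ^ 2 := fun j => by
    have := expInner_mono (s := -ν) (s' := 0) (c := 1) (c' := 1) (fun x hx => by
      rw [one_mul, one_mul, Real.exp_le_exp]; nlinarith [hx.1]) (toLeftState fun x => k.γ x j)
    rw [one_mul, one_mul, ← norm_sq_eq_expInner] at this
    simp only [map_smul, smul_apply, smul_eq_mul]
    calc _ = odeCoord j Y ^ 2 * expInner (-ν) (toLeftState fun x => k.γ x j)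
            (toLeftState fun x => k.γ x j) := by ring
      _ ≤ odeCoord j Y ^ 2 * C0 := by
          gcongr
          linarith [hgle j]
      _ = _ := mul_comm _ _
  have q3 : expInner (-ν) (volterra k.N (leftCoord Y)) (volterra k.N (leftCoord Y))
      ≤ 1 / 64 * expInner (-ν) (leftCoord Y) (leftCoord Y) := by
    refine (hcN ν hν0 _).trans (mul_le_mul_of_nonneg_right ?_ (expInner_self_nonneg _ _))
    have : cN / ν ≤ C0 / ν := by gcongr; linarith
    linarith
  have q4 : expInner (-ν) (backstep k Y) (backstep k Y)
      ≤ C0 * expInner (-ν) (backstep k Y) (backstep k Y) :=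
    le_mul_of_one_le_left (expInner_self_nonneg _ _) (by linarith)
  have t0 := expInner_add_le (-ν) ((backstep k Y + volterra (fun p => k.K p 0) (rightCoord 0 Y))
      + (volterra (fun p => k.K p 1) (rightCoord 1 Y)
        + volterra (fun p => k.K p 2) (rightCoord 2 Y)))
      ((odeCoord 0 Y • toLeftState (fun x => k.γ x 0)
        + odeCoord 1 Y • toLeftState (fun x => k.γ x 1)) + volterra k.N (leftCoord Y))
  rw [← e] at t0
  have t1 := expInner_add_le (-ν) (backstep k Y + volterra (fun p => k.K p 0) (rightCoord 0 Y))
      (volterra (fun p => k.K p 1) (rightCoord 1 Y) + volterra (fun p => k.K p 2) (rightCoord 2 Y))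
  have t2 := expInner_add_le (-ν) (backstep k Y) (volterra (fun p => k.K p 0) (rightCoord 0 Y))
  have t3 := expInner_add_le (-ν) (volterra (fun p => k.K p 1) (rightCoord 1 Y))
    (volterra (fun p => k.K p 2) (rightCoord 2 Y))
  have t4 := expInner_add_le (-ν) (odeCoord 0 Y • toLeftState (fun x => k.γ x 0)
        + odeCoord 1 Y • toLeftState (fun x => k.γ x 1)) (volterra k.N (leftCoord Y))
  have t5 := expInner_add_le (-ν) (odeCoord 0 Y • toLeftState (fun x => k.γ x 0))
    (odeCoord 1 Y • toLeftState (fun x => k.γ x 1))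
  have q10 := q1 0
  have q11 := q1 1
  have q12 := q1 2
  have q20 := q2 0
  have q21 := q2 1
  rw [Fin.sum_univ_three, Fin.sum_univ_two]
  have n1 := expInner_self_nonneg (-ν) (leftCoord Y)
  have n2 := fun i => mul_nonneg (show 0 ≤ C0 by positivity) (expInner_self_nonneg (-ν) (rightCoord i Y))
  have n3 := fun j => mul_nonneg (show 0 ≤ C0 by positivity) (sq_nonneg (odeCoord j Y))
  have n4 := mul_nonneg (show 0 ≤ C0 by positivity) (expInner_self_nonneg (-ν) (backstep k Y))
  linarith [n2 0, n2 1, n2 2, n3 0, n3 1]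

lemma expInner_energy {u : ℝ → ℝ} {f g : LeftState} {c : ℝ}
    (hu : IsPrimitive 1 u fun x => c * g x) (hf : f =ᵐ[unitMeasure] u) (s : ℝ) :
    c * expInner s f g
      = (Real.exp s * u 1 ^ 2 - u 0 ^ 2) / 2 - s / 2 * expInner s f f := by
  have h := hu.energy s
  rw [← integral_unitMeasure, ← integral_unitMeasure] at h
  have e1 : ∫ x, Real.exp (s * x) * (u x * (c * g x)) ∂unitMeasure = c * expInner s f g := by
    rw [expInner_apply, ← integral_const_mul]
    refine integral_congr_ae ?_
    filter_upwards [hf] with x hx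
    rw [hx]; ring
  have e2 : ∫ x, Real.exp (s * x) * u x ^ 2 ∂unitMeasure = expInner s f f := by
    rw [expInner_apply]
    refine integral_congr_ae ?_
    filter_upwards [hf] with x hx
    rw [hx, sq]
  rw [e1, e2] at h
  exact h

/-- The inflow value ρ(1) = 0 contributes nothing, and the outflow value ρ(0) = z(0) - κX
contributes with a good sign. A large positive exponent s beats the reaction term Σ⁻⁻, and the
outflow term will pay for ρ(0) elsewhere. -/
lemma IsGenerator.energy_backstep (hP : ∀ i, 0 < S.lamP i) (hM : 0 < S.lamM)
    (hk : IsKernelSolution S κ k) {Y G : StateSpace} {z0 : ℝ} {w1 : Fin 3 → ℝ}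
    (h : IsGenerator S k Y G z0 w1) (s : ℝ) :
    expInner s (backstep k Y) (backstep k G)
      = (S.sigMM - S.lamM * s / 2) * expInner s (backstep k Y) (backstep k Y)
        - S.lamM / 2 * (z0 - ∑ j, κ j * odeCoord j Y) ^ 2 := by
  obtain ⟨ρ, hρ, hρY, h0, h1⟩ := h.exists_backstep_primitive hP hM hk
  have hρ' : IsPrimitive 1 ρ fun x =>
      S.lamM⁻¹ * (backstep k G - S.sigMM • backstep k Y : LeftState) x := by
    refine hρ.congr_ae ?_
    filter_upwards [Lp.coeFn_sub (backstep k G) (S.sigMM • backstep k Y),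
      Lp.coeFn_smul S.sigMM (backstep k Y)] with x h1 h2
    rw [h1, Pi.sub_apply, h2, Pi.smul_apply, smul_eq_mul]
  have e := expInner_energy hρ' hρY s
  rw [h0, h1, inv_mul_eq_iff_eq_mul₀ hM.ne'] at e
  simp only [map_sub, map_smul, smul_eq_mul] at e
  linear_combination e

/-- For negative s the transport gives dissipation proportional to |s|; the outflow w(1) helps, and
the inflow w(0) is a cost to be covered by ρ(0) and X. -/
lemma IsGenerator.energy_right (hP : ∀ i, 0 < S.lamP i) {Y G : StateSpace} {z0 : ℝ}
    {w1 : Fin 3 → ℝ} (h : IsGenerator S k Y G z0 w1) (s : ℝ) (i : Fin 3) :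
    expInner s (rightCoord i Y) (rightCoord i G)
      = expInner s (rightCoord i Y) (rightSource S i Y)
        - S.lamP i * ((Real.exp s * w1 i ^ 2
            - (S.Q i * z0 + ∑ j, S.C i j * odeCoord j Y) ^ 2) / 2
          - s / 2 * expInner s (rightCoord i Y) (rightCoord i Y)) := by
  obtain ⟨u, hu, huY, h0, h1⟩ := h.exists_right_primitive hP i
  simp only [← neg_mul] at hu
  have e := expInner_energy hu huY s
  rw [h0, h1, neg_mul, neg_eq_iff_eq_neg, inv_mul_eq_iff_eq_mul₀ (hP i).ne'] at e
  simp only [map_sub] at e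
  linear_combination e

lemma two_mul_expInner_rightSource_le {T : ℝ} (hT1 : ∀ i j, S.sigPP i j ^ 2 ≤ T)
    (hT2 : ∀ i, S.sigPM i ^ 2 ≤ T) (s : ℝ) (Y : StateSpace) (i : Fin 3) :
    2 * expInner s (rightCoord i Y) (rightSource S i Y)
      ≤ 4 * expInner s (rightCoord i Y) (rightCoord i Y)
        + T * (∑ i, expInner s (rightCoord i Y) (rightCoord i Y)
          + expInner s (leftCoord Y) (leftCoord Y)) := by
  have e : rightSource S i Y = S.sigPP i 0 • rightCoord 0 Y + S.sigPP i 1 • rightCoord 1 Y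
      + S.sigPP i 2 • rightCoord 2 Y + S.sigPM i • leftCoord Y := by
    simp [rightSource, Fin.sum_univ_three]
  have hj : ∀ (f g : LeftState) (a : ℝ), a ^ 2 ≤ T →
      2 * expInner s f (a • g) ≤ expInner s f f + T * expInner s g g := fun f g a ha =>
    (two_mul_expInner_smul_le s a f g).trans
      (by gcongr; exact expInner_self_nonneg s g)
  have h0 := hj (rightCoord i Y) (rightCoord 0 Y) _ (hT1 i 0)
  have h1 := hj (rightCoord i Y) (rightCoord 1 Y) _ (hT1 i 1)
  have h2 := hj (rightCoord i Y) (rightCoord 2 Y) _ (hT1 i 2)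
  have hz := hj (rightCoord i Y) (leftCoord Y) _ (hT2 i)
  rw [e, map_add, map_add, map_add, Fin.sum_univ_three]
  generalize expInner s (rightCoord i Y) = F at *
  linarith

/-- The constant is independent of the exponent s, so the exponent can afterwards be chosen large
compared with it. -/
lemma sum_expInner_rightSource_le (S : NominalSystem) :
    ∃ T, 0 ≤ T ∧ ∀ (s : ℝ) (Y : StateSpace),
      ∑ i, expInner s (rightCoord i Y) (rightSource S i Y)
        ≤ T * (∑ i, expInner s (rightCoord i Y) (rightCoord i Y)
          + expInner s (leftCoord Y) (leftCoord Y)) := by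
  obtain ⟨T1, hT1⟩ : ∃ T, ∀ i j, S.sigPP i j ^ 2 ≤ T := by
    obtain ⟨T, hT⟩ := (Set.finite_range fun p : Fin 3 × Fin 3 => S.sigPP p.1 p.2 ^ 2).bddAbove
    exact ⟨T, fun i j => hT ⟨(i, j), rfl⟩⟩
  obtain ⟨T2, hT2⟩ : ∃ T, ∀ i, S.sigPM i ^ 2 ≤ T := by
    obtain ⟨T, hT⟩ := (Set.finite_range fun i : Fin 3 => S.sigPM i ^ 2).bddAbove
    exact ⟨T, fun i => hT ⟨i, rfl⟩⟩
  set T := max T1 T2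
  have hT0 : 0 ≤ T := (sq_nonneg _).trans ((hT1 0 0).trans (le_max_left _ _))
  refine ⟨2 + 2 * T, by positivity, fun s Y => ?_⟩
  have key := two_mul_expInner_rightSource_le (S := S) (T := T)
    (fun i j => (hT1 i j).trans (le_max_left _ _)) (fun i => (hT2 i).trans (le_max_right _ _)) s Y
  have hZ := expInner_self_nonneg s (leftCoord Y)
  have hE : 0 ≤ ∑ i, expInner s (rightCoord i Y) (rightCoord i Y) :=
    Finset.sum_nonneg fun i _ => expInner_self_nonneg _ _
  have h1 := Finset.sum_le_sum fun i (_ : i ∈ Finset.univ) => key i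
  rw [← Finset.mul_sum, Finset.sum_add_distrib, ← Finset.mul_sum] at h1
  simp only [Finset.sum_const, Finset.card_univ, Fintype.card_fin, nsmul_eq_mul] at h1
  generalize ∑ i, expInner s (rightCoord i Y) (rightCoord i Y) = E at *
  generalize expInner s (leftCoord Y) (leftCoord Y) = Z at *
  push_cast at h1
  have h2 : 0 ≤ T * (E + Z) := by positivity
  linarith

end Lyapunov

/-! ### Choice of the Lyapunov functional. -/

section LyapunovFunctional

variable {S : NominalSystem} {κ : Fin 2 → ℝ} {k : BacksteppingKernels}

/-- The quadratic Lyapunov functional: weighted norms of the backstepping transform of `z` and of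
`w`, and a quadratic form in `X`. -/
noncomputable def lyapunov (k : BacksteppingKernels) (α β a b c μ ν : ℝ) :
    StateSpace →L[ℝ] StateSpace →L[ℝ] ℝ :=
  α • (expInner μ).bilinearComp (backstep k) (backstep k)
    + β • (a • (odeCoord 0).smulRight (odeCoord 0)
      + b • ((odeCoord 0).smulRight (odeCoord 1) + (odeCoord 1).smulRight (odeCoord 0))
      + c • (odeCoord 1).smulRight (odeCoord 1))
    + ∑ i, (expInner (-ν)).bilinearComp (rightCoord i) (rightCoord i)

lemma lyapunov_apply (k : BacksteppingKernels) (α β a b c μ ν : ℝ) (Y Y' : StateSpace) :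
    lyapunov k α β a b c μ ν Y Y' = α * expInner μ (backstep k Y) (backstep k Y')
      + β * (a * (odeCoord 0 Y * odeCoord 0 Y') + b * (odeCoord 0 Y * odeCoord 1 Y'
        + odeCoord 1 Y * odeCoord 0 Y') + c * (odeCoord 1 Y * odeCoord 1 Y'))
      + ∑ i, expInner (-ν) (rightCoord i Y) (rightCoord i Y') := by
  simp only [lyapunov, add_apply, smul_apply, sum_apply, smul_eq_mul,
    ContinuousLinearMap.bilinearComp_apply, ContinuousLinearMap.smulRight_apply]

lemma lyapunov_symm (k : BacksteppingKernels) (α β a b c μ ν : ℝ) (Y Y' : StateSpace) :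
    lyapunov k α β a b c μ ν Y Y' = lyapunov k α β a b c μ ν Y' Y := by
  rw [lyapunov_apply, lyapunov_apply, expInner_symm μ]
  simp only [fun i => expInner_symm (-ν) (rightCoord i Y) (rightCoord i Y')]
  ring

lemma two_mul_le_of_pos {p : ℝ} (hp : 0 < p) (x y : ℝ) : x * y ≤ p / 2 * x ^ 2 + y ^ 2 / (2 * p) := by
  have h : p / 2 * x ^ 2 + y ^ 2 / (2 * p) - x * y = (p * x - y) ^ 2 / (2 * p) := by
    field_simp; ring
  have : 0 ≤ (p * x - y) ^ 2 / (2 * p) := by positivity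
  linarith

/-- Decay of the quadratic form in `X`. -/
lemma IsHurwitz.exists_ode_decay (hκ : IsHurwitz (feedbackMatrix S.A S.B κ)) :
    ∃ a b c p C : ℝ, 0 < p ∧ 0 ≤ C ∧ (∀ x y : ℝ,
      p * (x ^ 2 + y ^ 2) ≤ a * (x * x) + b * (x * y + y * x) + c * (y * y) ∧
      a * (x * x) + b * (x * y + y * x) + c * (y * y) ≤ C * (x ^ 2 + y ^ 2)) ∧
      ∀ {Y G : StateSpace} {z0 : ℝ} {w1 : Fin 3 → ℝ}, IsGenerator S k Y G z0 w1 →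
        a * (odeCoord 0 Y * odeCoord 0 G) + b * (odeCoord 0 Y * odeCoord 1 G
          + odeCoord 1 Y * odeCoord 0 G) + c * (odeCoord 1 Y * odeCoord 1 G)
        ≤ -p * (odeCoord 0 Y ^ 2 + odeCoord 1 Y ^ 2)
          + C * (z0 - ∑ j, κ j * odeCoord j Y) ^ 2 := by
  obtain ⟨a, b, c, p, hp, h⟩ := hκ.exists_lyapunov
  set u := a * S.B 0 + b * S.B 1
  set v := b * S.B 0 + c * S.B 1
  -- Young's inequality spends half of the decay rate p on the forcing B(z(0) - κX); the two entries
  -- of the maximum bound the form itself and the forcing.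
  refine ⟨a, b, c, p / 2, max (|a| + |b| + |c|) (u ^ 2 / (2 * p) + v ^ 2 / (2 * p)), by positivity,
    le_max_of_le_left (by positivity), fun x y => ⟨?_, ?_⟩, fun {Y G z0 w1} hG => ?_⟩
  · have := (h x y).1
    nlinarith [sq_nonneg x, sq_nonneg y]
  · have h1 : (|a| + |b| + |c|) * (x ^ 2 + y ^ 2)
        ≤ max (|a| + |b| + |c|) (u ^ 2 / (2 * p) + v ^ 2 / (2 * p)) * (x ^ 2 + y ^ 2) := by
      gcongr; exact le_max_left _ _
    refine le_trans ?_ h1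
    have i1 : a * x ^ 2 ≤ |a| * x ^ 2 := by gcongr; exact le_abs_self a
    have i2 : c * y ^ 2 ≤ |c| * y ^ 2 := by gcongr; exact le_abs_self c
    have i3 : b * (2 * (x * y)) ≤ |b| * (x ^ 2 + y ^ 2) := by
      refine (le_abs_self _).trans ?_
      rw [abs_mul]
      gcongr
      rw [abs_le]
      constructor <;> nlinarith [sq_nonneg (x + y), sq_nonneg (x - y)]
    have : 0 ≤ |a| * y ^ 2 := by positivity
    have : 0 ≤ |c| * x ^ 2 := by positivity
    nlinarith
  · have h0 := hG.ode 0
    have h1 := hG.ode 1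
    simp only [Fin.sum_univ_two] at h0 h1 ⊢
    have h2 := (h (odeCoord 0 Y) (odeCoord 1 Y)).2
    simp only [feedbackMatrix, Matrix.add_apply, Matrix.vecMulVec_apply] at h2
    rw [h0, h1]
    generalize odeCoord 0 Y = x at *
    generalize odeCoord 1 Y = y at *
    set r := z0 - (κ 0 * x + κ 1 * y) with hr
    have i1 := two_mul_le_of_pos hp x (u * r)
    have i2 := two_mul_le_of_pos hp y (v * r)
    have i3 : (u ^ 2 / (2 * p) + v ^ 2 / (2 * p)) * r ^ 2
        ≤ max (|a| + |b| + |c|) (u ^ 2 / (2 * p) + v ^ 2 / (2 * p)) * r ^ 2 := by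
      gcongr; exact le_max_right _ _
    refine le_trans ?_ (add_le_add_right i3 _)
    have i4 : (u * r) ^ 2 / (2 * p) + (v * r) ^ 2 / (2 * p)
        = (u ^ 2 / (2 * p) + v ^ 2 / (2 * p)) * r ^ 2 := by ring
    have hz : z0 = r + (κ 0 * x + κ 1 * y) := by rw [hr]; ring
    rw [hz]
    have e : a * (x * (S.A 0 0 * x + S.A 0 1 * y + S.B 0 * (r + (κ 0 * x + κ 1 * y))))
        + b * (x * (S.A 1 0 * x + S.A 1 1 * y + S.B 1 * (r + (κ 0 * x + κ 1 * y)))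
          + y * (S.A 0 0 * x + S.A 0 1 * y + S.B 0 * (r + (κ 0 * x + κ 1 * y))))
        + c * (y * (S.A 1 0 * x + S.A 1 1 * y + S.B 1 * (r + (κ 0 * x + κ 1 * y))))
        = (a * x * ((S.A 0 0 + S.B 0 * κ 0) * x + (S.A 0 1 + S.B 0 * κ 1) * y)
          + b * (x * ((S.A 1 0 + S.B 1 * κ 0) * x + (S.A 1 1 + S.B 1 * κ 1) * y)
          + y * ((S.A 0 0 + S.B 0 * κ 0) * x + (S.A 0 1 + S.B 0 * κ 1) * y))
          + c * y * ((S.A 1 0 + S.B 1 * κ 0) * x + (S.A 1 1 + S.B 1 * κ 1) * y))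
          + x * (u * r) + y * (v * r) := by ring
    rw [e]
    linarith

/-- The boundary value `w(0)` is controlled by the transformed boundary value and by `X`. -/
lemma exists_inflow_le (S : NominalSystem) (κ : Fin 2 → ℝ) :
    ∃ C, 0 ≤ C ∧ ∀ (Y : StateSpace) (z0 : ℝ), z0 ^ 2 ≤ C * ((z0 - ∑ j, κ j * odeCoord j Y) ^ 2
        + (odeCoord 0 Y ^ 2 + odeCoord 1 Y ^ 2)) ∧
      ∑ i, S.lamP i / 2 * (S.Q i * z0 + ∑ j, S.C i j * odeCoord j Y) ^ 2
        ≤ C * ((z0 - ∑ j, κ j * odeCoord j Y) ^ 2 + (odeCoord 0 Y ^ 2 + odeCoord 1 Y ^ 2)) := by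
  have key : ∀ c d e r x y : ℝ, (c * r + d * x + e * y) ^ 2
      ≤ 3 * (c ^ 2 + d ^ 2 + e ^ 2) * (r ^ 2 + (x ^ 2 + y ^ 2)) := by
    intro c d e r x y
    nlinarith [sq_nonneg (c * x - d * r), sq_nonneg (c * y - e * r), sq_nonneg (d * y - e * x),
      sq_nonneg (c * r), sq_nonneg (d * x), sq_nonneg (e * y), sq_nonneg (c * x),
      sq_nonneg (c * y), sq_nonneg (d * r), sq_nonneg (d * y), sq_nonneg (e * r),
      sq_nonneg (e * x)]
  set D : Fin 3 → ℝ := fun i => 3 * (S.Q i ^ 2 + (S.Q i * κ 0 + S.C i 0) ^ 2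
    + (S.Q i * κ 1 + S.C i 1) ^ 2)
  refine ⟨3 * (1 ^ 2 + κ 0 ^ 2 + κ 1 ^ 2) + ∑ i, |S.lamP i| / 2 * D i, ?_, fun Y z0 => ?_⟩
  · have : ∀ i, 0 ≤ D i := fun i => by positivity
    have : 0 ≤ ∑ i, |S.lamP i| / 2 * D i :=
      Finset.sum_nonneg fun i _ => mul_nonneg (by positivity) (this i)
    positivity
  · simp only [Fin.sum_univ_two]
    generalize odeCoord 0 Y = x
    generalize odeCoord 1 Y = y
    set r := z0 - (κ 0 * x + κ 1 * y) with hr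
    have hz : z0 = r + (κ 0 * x + κ 1 * y) := by rw [hr]; ring
    set T := r ^ 2 + (x ^ 2 + y ^ 2)
    have hT : 0 ≤ T := by positivity
    have hD : ∀ i, 0 ≤ D i := fun i => by positivity
    have hs : 0 ≤ ∑ i, |S.lamP i| / 2 * D i :=
      Finset.sum_nonneg fun i _ => mul_nonneg (by positivity) (hD i)
    constructor
    · have h1 := key 1 (κ 0) (κ 1) r x y
      have h2 : z0 ^ 2 = (1 * r + κ 0 * x + κ 1 * y) ^ 2 := by rw [hz]; ring
      rw [h2, add_mul]
      have := mul_nonneg hs hT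
      linarith
    · have h1 : ∑ i, S.lamP i / 2 * (S.Q i * z0 + (S.C i 0 * x + S.C i 1 * y)) ^ 2
          ≤ ∑ i, |S.lamP i| / 2 * D i * T := by
        refine Finset.sum_le_sum fun i _ => ?_
        have h2 := key (S.Q i) (S.Q i * κ 0 + S.C i 0) (S.Q i * κ 1 + S.C i 1) r x y
        have h3 : S.Q i * z0 + (S.C i 0 * x + S.C i 1 * y)
          = S.Q i * r + (S.Q i * κ 0 + S.C i 0) * x + (S.Q i * κ 1 + S.C i 1) * y := by
            rw [hz]; ring
        rw [h3, mul_assoc]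
        gcongr
        exact le_abs_self _
      rw [← Finset.sum_mul] at h1
      have : 0 ≤ 3 * (1 ^ 2 + κ 0 ^ 2 + κ 1 ^ 2) * T := by positivity
      linarith

set_option maxHeartbeats 1600000 in
/-- A coercive Lyapunov functional, strictly decreasing along the closed loop. -/
theorem exists_lyapunov_functional (hP : ∀ i, 0 < S.lamP i) (hM : 0 < S.lamM)
    (hk : IsKernelSolution S κ k) (hκ : IsHurwitz (feedbackMatrix S.A S.B κ)) :
    ∃ V : StateSpace →L[ℝ] StateSpace →L[ℝ] ℝ, (∀ Y Y', V Y Y' = V Y' Y) ∧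
      ∃ c > 0, (∀ Y, c * ‖Y‖ ^ 2 ≤ V Y Y) ∧
      ∀ Y G z0 w1, IsGenerator S k Y G z0 w1 →
        V Y G ≤ -c * (V Y Y + (z0 ^ 2 + ∑ i, w1 i ^ 2)) := by
  obtain ⟨C, ν₀, hC, hν₀, hleft⟩ := exists_expInner_left_le hk
  obtain ⟨T, hT, hsrc⟩ := sum_expInner_rightSource_le S
  obtain ⟨a, b, c, p, D, hp, hD, hform, hode⟩ := hκ.exists_ode_decay (k := k)
  obtain ⟨Cb, hCb, hbd⟩ := exists_inflow_le S κ
  obtain ⟨l, hl, hlP⟩ : ∃ l, 0 < l ∧ ∀ i, l ≤ S.lamP i := by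
    obtain ⟨i, hi⟩ := Finite.exists_min S.lamP
    exact ⟨S.lamP i, hP i, hi⟩
  -- The constants are fixed in an order without circularity. First ν: the transport of w must
  -- absorb the couplings, including the part of z that depends on w, with one unit to spare.
  set ν := max ν₀ (2 * (T * (1 + C) + 1) / l) with hν
  have hνν₀ : ν₀ ≤ ν := le_max_left _ _
  have hνl : T * (1 + C) + 1 ≤ ν * l / 2 := by
    have : 2 * (T * (1 + C) + 1) / l ≤ ν := le_max_right _ _
    rw [div_le_iff₀ hl] at this
    linarith
  have hν0 : 0 < ν := by linarith
  -- C5 is the price of the w-estimate in ρ, X and ρ(0). Next β makes the decay of X cover it, then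
  -- α makes the outflow of ρ cover it together with the forcing βD of the ODE, and finally μ makes
  -- the interior decay of ρ cover it.
  set C5 := T * C + Cb with hC5
  have hC50 : 0 ≤ C5 := by positivity
  set β := (C5 + 1) / p with hβ
  have hβ0 : 0 < β := by positivity
  have hβp : β * p = C5 + 1 := by rw [hβ]; field_simp
  set α := 2 * (C5 + β * D + 1) / S.lamM with hα
  have hα0 : 0 < α := by positivity
  have hαM : α * (S.lamM / 2) = C5 + β * D + 1 := by rw [hα]; field_simp
  set μ := 2 * (|S.sigMM| + (C5 + 1) / α) / S.lamM with hμ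
  have hμ0 : 0 ≤ μ := by positivity
  have hμM : α * (S.sigMM - S.lamM * μ / 2) ≤ -(C5 + 1) := by
    have e : S.lamM * μ / 2 = |S.sigMM| + (C5 + 1) / α := by rw [hμ]; field_simp
    have e2 : α * ((C5 + 1) / α) = C5 + 1 := by field_simp
    rw [e, mul_sub, mul_add, e2]
    have := mul_le_mul_of_nonneg_left (le_abs_self S.sigMM) hα0.le
    linarith
  set c1 := l / 2 * Real.exp (-ν) with hc1
  have hc10 : 0 < c1 := by positivity
  have hRR : ∀ f : LeftState, expInner (-ν) f f ≤ expInner μ f f := fun f => by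
    have := expInner_mono (s := -ν) (s' := μ) (c := 1) (c' := 1) (fun x hx => by
      rw [one_mul, one_mul, Real.exp_le_exp]; nlinarith [hx.1]) f
    linarith
  have hnorm : ∀ f : LeftState, ‖f‖ ^ 2 ≤ Real.exp ν * expInner (-ν) f f := fun f => by
    have := expInner_mono (s := 0) (s' := -ν) (c := 1) (c' := Real.exp ν) (fun x hx => by
      rw [one_mul, ← Real.exp_add, Real.exp_le_exp]; nlinarith [hx.1, hx.2]) f
    rw [one_mul] at this
    rwa [norm_sq_eq_expInner]
  -- m bounds V and the traces by the dissipation; n and q below compare V and the norm with the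
  -- common quantity R + X + W.
  set m := α + β * D + 1 + Cb + c1⁻¹ with hm
  have hm0 : 0 < m := by positivity
  set q := 1 + Real.exp ν * (1 + C) with hq
  have hq0 : 0 < q := by positivity
  set n := min (min α (β * p)) 1 with hn
  have hn0 : 0 < n := by positivity
  refine ⟨lyapunov k α β a b c μ ν, lyapunov_symm k α β a b c μ ν, min (n / q) m⁻¹, by positivity,
    fun Y => ?_, fun Y G z0 w1 h => ?_⟩
  · have h1 : ‖Y‖ ^ 2 ≤ q * (expInner μ (backstep k Y) (backstep k Y)
        + (odeCoord 0 Y ^ 2 + odeCoord 1 Y ^ 2)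
        + ∑ i, expInner (-ν) (rightCoord i Y) (rightCoord i Y)) := by
      rw [norm_sq_stateSpace, Fin.sum_univ_two]
      have e1 : ∑ i, ‖rightCoord i Y‖ ^ 2
          ≤ Real.exp ν * ∑ i, expInner (-ν) (rightCoord i Y) (rightCoord i Y) := by
        rw [Finset.mul_sum]
        exact Finset.sum_le_sum fun i _ => hnorm _
      have e2 := hnorm (leftCoord Y)
      have e3 := hleft ν hνν₀ Y
      rw [Fin.sum_univ_two] at e3
      have e4 := hRR (backstep k Y)
      have e5 : 0 ≤ ∑ i, expInner (-ν) (rightCoord i Y) (rightCoord i Y) :=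
        Finset.sum_nonneg fun i _ => expInner_self_nonneg _ _
      have e6 := expInner_self_nonneg μ (backstep k Y)
      have hX : 0 ≤ odeCoord 0 Y ^ 2 + odeCoord 1 Y ^ 2 := by positivity
      generalize ∑ i, expInner (-ν) (rightCoord i Y) (rightCoord i Y) = W at *
      generalize expInner μ (backstep k Y) (backstep k Y) = R at *
      generalize expInner (-ν) (backstep k Y) (backstep k Y) = R' at *
      generalize expInner (-ν) (leftCoord Y) (leftCoord Y) = Z at *
      generalize odeCoord 0 Y ^ 2 + odeCoord 1 Y ^ 2 = X at *
      have e7 : Real.exp ν * Z ≤ Real.exp ν * (C * (R + X + W)) := by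
        refine mul_le_mul_of_nonneg_left (e3.trans ?_) (Real.exp_pos ν).le
        exact mul_le_mul_of_nonneg_left (by linarith) hC.le
      have e8 : 0 ≤ Real.exp ν * R := by positivity
      have e9 : 0 ≤ Real.exp ν * X := by positivity
      rw [hq]
      linarith
    have h2 : n * (expInner μ (backstep k Y) (backstep k Y)
        + (odeCoord 0 Y ^ 2 + odeCoord 1 Y ^ 2)
        + ∑ i, expInner (-ν) (rightCoord i Y) (rightCoord i Y)) ≤ lyapunov k α β a b c μ ν Y Y := by
      rw [lyapunov_apply, mul_add, mul_add]
      have n1 : n ≤ α := (min_le_left _ _).trans (min_le_left _ _)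
      have n2 : n ≤ β * p := (min_le_left _ _).trans (min_le_right _ _)
      have n3 : n ≤ 1 := min_le_right _ _
      refine add_le_add (add_le_add ?_ ?_) ?_
      · exact mul_le_mul_of_nonneg_right n1 (expInner_self_nonneg _ _)
      · refine (mul_le_mul_of_nonneg_right n2 (by positivity)).trans ?_
        rw [mul_assoc]
        exact mul_le_mul_of_nonneg_left (hform _ _).1 hβ0.le
      · exact mul_le_of_le_one_left (Finset.sum_nonneg fun i _ => expInner_self_nonneg _ _) n3
    calc min (n / q) m⁻¹ * ‖Y‖ ^ 2 ≤ n / q * ‖Y‖ ^ 2 := by gcongr; exact min_le_left _ _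
      _ ≤ n / q * (q * (expInner μ (backstep k Y) (backstep k Y)
        + (odeCoord 0 Y ^ 2 + odeCoord 1 Y ^ 2)
        + ∑ i, expInner (-ν) (rightCoord i Y) (rightCoord i Y))) := by gcongr
      _ = n * (expInner μ (backstep k Y) (backstep k Y)
        + (odeCoord 0 Y ^ 2 + odeCoord 1 Y ^ 2)
        + ∑ i, expInner (-ν) (rightCoord i Y) (rightCoord i Y)) := by field_simp
      _ ≤ _ := h2
  · have hVY := lyapunov_apply k α β a b c μ ν Y Y
    have hVG := lyapunov_apply k α β a b c μ ν Y G
    have b1 := h.energy_backstep hP hM hk μ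
    have b2 := hode h
    obtain ⟨b3, b4⟩ := hbd Y z0
    have b5 := hsrc (-ν) Y
    have b6 := hleft ν hνν₀ Y
    rw [Fin.sum_univ_two] at b6
    have b7 := hRR (backstep k Y)
    have b8 : ∑ i, expInner (-ν) (rightCoord i Y) (rightCoord i G)
        ≤ ∑ i, expInner (-ν) (rightCoord i Y) (rightSource S i Y)
          + ∑ i, S.lamP i / 2 * (S.Q i * z0 + ∑ j, S.C i j * odeCoord j Y) ^ 2
          - c1 * ∑ i, w1 i ^ 2
          - ν * l / 2 * ∑ i, expInner (-ν) (rightCoord i Y) (rightCoord i Y) := by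
      rw [Finset.mul_sum, Finset.mul_sum, ← Finset.sum_add_distrib, ← Finset.sum_sub_distrib,
        ← Finset.sum_sub_distrib]
      refine Finset.sum_le_sum fun i _ => ?_
      rw [h.energy_right hP (-ν) i]
      have g1 : l * (Real.exp (-ν) * w1 i ^ 2) ≤ S.lamP i * (Real.exp (-ν) * w1 i ^ 2) := by
        gcongr; exact hlP i
      have g2 : l * (ν * expInner (-ν) (rightCoord i Y) (rightCoord i Y))
          ≤ S.lamP i * (ν * expInner (-ν) (rightCoord i Y) (rightCoord i Y)) :=
        mul_le_mul_of_nonneg_right (hlP i) (mul_nonneg hν0.le (expInner_self_nonneg _ _))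
      rw [hc1]
      linarith
    have b9 := (hform (odeCoord 0 Y) (odeCoord 1 Y)).2
    have b15 := (mul_nonneg hp.le (by positivity)).trans (hform (odeCoord 0 Y) (odeCoord 1 Y)).1
    have b10 := expInner_self_nonneg μ (backstep k Y)
    have b11 : 0 ≤ ∑ i, expInner (-ν) (rightCoord i Y) (rightCoord i Y) :=
      Finset.sum_nonneg fun i _ => expInner_self_nonneg _ _
    have b12 : 0 ≤ odeCoord 0 Y ^ 2 + odeCoord 1 Y ^ 2 := by positivity
    have b13 : 0 ≤ ∑ i, w1 i ^ 2 := by positivity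
    have b14 : 0 ≤ (z0 - ∑ j, κ j * odeCoord j Y) ^ 2 := sq_nonneg _
    rw [b1] at hVG
    generalize ∑ i, expInner (-ν) (rightCoord i Y) (rightCoord i G) = WG at *
    generalize ∑ i, expInner (-ν) (rightCoord i Y) (rightSource S i Y) = WS at *
    generalize ∑ i, S.lamP i / 2 * (S.Q i * z0 + ∑ j, S.C i j * odeCoord j Y) ^ 2 = W0 at *
    generalize ∑ i, expInner (-ν) (rightCoord i Y) (rightCoord i Y) = W at *
    generalize expInner μ (backstep k Y) (backstep k Y) = R at *
    generalize expInner (-ν) (backstep k Y) (backstep k Y) = R' at *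
    generalize expInner (-ν) (leftCoord Y) (leftCoord Y) = Z at *
    generalize a * (odeCoord 0 Y * odeCoord 0 G) + b * (odeCoord 0 Y * odeCoord 1 G
          + odeCoord 1 Y * odeCoord 0 G) + c * (odeCoord 1 Y * odeCoord 1 G) = XG at *
    generalize a * (odeCoord 0 Y * odeCoord 0 Y) + b * (odeCoord 0 Y * odeCoord 1 Y
          + odeCoord 1 Y * odeCoord 0 Y) + c * (odeCoord 1 Y * odeCoord 1 Y) = XX at *
    generalize odeCoord 0 Y ^ 2 + odeCoord 1 Y ^ 2 = X at *
    generalize (z0 - ∑ j, κ j * odeCoord j Y) ^ 2 = r at *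
    generalize ∑ i, w1 i ^ 2 = w at *
    generalize lyapunov k α β a b c μ ν Y Y = VY at *
    generalize lyapunov k α β a b c μ ν Y G = VG at *
    -- The dissipation left after all absorptions: one unit of each square, and the outflow of w.
    set N := W + X + R + r + c1 * w with hN
    have hN0 : 0 ≤ N := by positivity
    have d1 : VG ≤ -N := by
      have f1 : T * Z ≤ T * (C * (R + W + X)) := by
        refine mul_le_mul_of_nonneg_left (b6.trans ?_) hT
        exact mul_le_mul_of_nonneg_left (by linarith) hC.le
      have f2 : β * XG ≤ β * (-p * X + D * r) := by gcongr
      have f3 : α * (S.sigMM - S.lamM * μ / 2) * R ≤ -(C5 + 1) * R := by gcongr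
      have f4 : (T * (1 + C) + 1) * W ≤ ν * l / 2 * W := by gcongr
      have f5 : β * (-p * X + D * r) = -((C5 + 1) * X) + β * D * r := by rw [← hβp]; ring
      have f6 : α * (S.lamM / 2) * r = (C5 + β * D + 1) * r := by rw [hαM]
      have f7 : 0 ≤ T * C * r := by positivity
      have f8 : 0 ≤ Cb * R := by positivity
      rw [hVG, hN]
      rw [hC5] at f3 f5 f6
      linarith
    have d2 : VY + (z0 ^ 2 + w) ≤ m * N := by
      have f1 : β * XX ≤ β * (D * X) := by gcongr
      have f2 : c1⁻¹ * (c1 * w) = w := by field_simp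
      have s1 : α * R ≤ α * N := by
        gcongr; rw [hN]; have : 0 ≤ c1 * w := by positivity
        linarith
      have s2 : β * D * X ≤ β * D * N := by
        gcongr; rw [hN]; have : 0 ≤ c1 * w := by positivity
        linarith
      have s3 : W ≤ N := by
        rw [hN]; have : 0 ≤ c1 * w := by positivity
        linarith
      have s4 : Cb * (r + X) ≤ Cb * N := by
        gcongr; rw [hN]; have : 0 ≤ c1 * w := by positivity
        linarith
      have s5 : c1⁻¹ * (c1 * w) ≤ c1⁻¹ * N := by
        gcongr; rw [hN]
        linarith
      rw [hVY, hm]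
      linarith
    have d3 : 0 ≤ VY + (z0 ^ 2 + w) := by
      have f1 : 0 ≤ β * XX := mul_nonneg hβ0.le b15
      have f2 : 0 ≤ α * R := mul_nonneg hα0.le b10
      rw [hVY]
      linarith [sq_nonneg z0]
    have d4 : min (n / q) m⁻¹ * (VY + (z0 ^ 2 + w)) ≤ N := by
      calc min (n / q) m⁻¹ * (VY + (z0 ^ 2 + w)) ≤ m⁻¹ * (VY + (z0 ^ 2 + w)) := by
            gcongr; exact min_le_right _ _
        _ ≤ m⁻¹ * (m * N) := by gcongr
        _ = N := by field_simp
    linarith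

end LyapunovFunctional

/-! ### The resolvent equation and maximality of the generator. -/

section Resolvent

open Filter Topology

lemma exists_linear_ode_continuous {E : Type*} [NormedAddCommGroup E] [NormedSpace ℝ E]
    [CompleteSpace E] (M : E →L[ℝ] E) {f : ℝ → E} (hf : Continuous f) (v₀ : E) :
    ∃ v : ℝ → E, v 0 = v₀ ∧ ∀ x, HasDerivAt v (M (v x) + f x) x := by
  have hexp : ∀ x : ℝ, HasDerivAt (fun t : ℝ => NormedSpace.exp (t • M))
      (M * NormedSpace.exp (x • M)) x := fun x => hasDerivAt_exp_smul_const' M x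
  have hc : Continuous fun t : ℝ => NormedSpace.exp (t • M) :=
    continuous_iff_continuousAt.2 fun x => (hexp x).continuousAt
  have hg : Continuous fun s : ℝ => NormedSpace.exp ((-s) • M) (f s) :=
    (hc.comp continuous_neg).clm_apply hf
  refine ⟨fun x => NormedSpace.exp (x • M)
    (v₀ + ∫ s in (0 : ℝ)..x, NormedSpace.exp ((-s) • M) (f s)), by simp, fun x => ?_⟩
  have h1 := (hexp x).clm_apply ((hg.integral_hasStrictDerivAt 0 x).hasDerivAt.const_add v₀)
  refine h1.congr_deriv ?_
  have h2 : NormedSpace.exp (x • M) (NormedSpace.exp ((-x) • M) (f x)) = f x := by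
    let _ : NormedAlgebra ℚ (E →L[ℝ] E) := NormedAlgebra.restrictScalars ℚ ℝ _
    rw [← mul_apply_eq_comp, ← NormedSpace.exp_add_of_commute]
    · simp
    · exact ((Commute.refl M).smul_left x).smul_right (-x)
  rw [h2]
  rfl

/-- Linear differential equations with integrable forcing. -/
lemma exists_linear_ode {ι : Type*} [Fintype ι] [DecidableEq ι] (M : Matrix ι ι ℝ) {f : ι → ℝ → ℝ}
    (hf : ∀ c, Integrable (f c) unitMeasure) (u₀ : ι → ℝ) :
    ∃ u : ι → ℝ → ℝ, ∀ c, u c 0 = u₀ c ∧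
      IsPrimitive 1 (u c) fun x => ∑ d, M c d * u d x + f c x := by
  set F : ℝ → ι → ℝ := fun x c => ∫ t in (0 : ℝ)..x, (Icc (0 : ℝ) 1).indicator (f c) t with hF
  have hFc : Continuous F := continuous_pi fun c => intervalIntegral.continuous_primitive
    (fun a b => ((integrable_indicator_iff measurableSet_Icc).2 (hf c)).intervalIntegrable) 0
  -- Subtracting the primitive F of the forcing leaves an equation for v = u - F with the continuous
  -- forcing M F, to which variation of constants applies classically.
  obtain ⟨v, hv0, hv⟩ := exists_linear_ode_continuous (Matrix.toLin' M).toContinuousLinearMap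
    ((Matrix.toLin' M).toContinuousLinearMap.continuous.comp hFc) u₀
  have hvc : Continuous v := continuous_iff_continuousAt.2 fun x => (hv x).continuousAt
  refine ⟨fun c x => v x c + F x c, fun c => ⟨by simp [hv0, hF], ?_⟩⟩
  have h1 : IsPrimitive 1 (fun x => v x c)
      (fun x => ∑ d, M c d * (v x d + F x d)) := by
    refine IsPrimitive.of_hasDerivWithinAt zero_le_one (fun x _ => ?_) (by fun_prop)
    have := (hasDerivAt_pi.1 (hv x) c).hasDerivWithinAt (s := Icc 0 1)
    refine this.congr_deriv ?_
    simp [Matrix.mulVec, dotProduct, mul_add, Finset.sum_add_distrib]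
  have h2 : IsPrimitive 1 (fun x => F x c) (f c) := by
    refine ⟨(integrable_unitMeasure_iff _).1 (hf c), fun x hx => ?_⟩
    simp only [hF, intervalIntegral.integral_same, zero_add]
    refine intervalIntegral.integral_congr fun t ht => ?_
    rw [uIcc_of_le hx.1] at ht
    exact indicator_of_mem (s := Icc (0 : ℝ) 1) ⟨ht.1, ht.2.trans hx.2⟩ _
  exact h1.add h2

/-- The converse passage to `exists_primitive_of_weak`: from a solution of the ODE in x back to the
weak identity. -/
lemma IsPrimitive.pairing_eq {u d : ℝ → ℝ} (hu : IsPrimitive 1 u d) {f h : LeftState} {c : ℝ}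
    (hf : f =ᵐ[unitMeasure] u) (hh : h =ᵐ[unitMeasure] fun x => c * d x) {φ : ℝ → ℝ}
    (hφ : ContDiff ℝ 1 φ) :
    pairing φ h = c * (u 1 * φ 1 - u 0 * φ 0) - c * pairing (deriv φ) f := by
  have hφ' : IsPrimitive 1 φ (deriv φ) := IsPrimitive.of_hasDerivWithinAt zero_le_one
    (fun x _ => ((hφ.differentiable one_ne_zero) x).hasDerivAt.hasDerivWithinAt)
    (hφ.continuous_deriv le_rfl).continuousOn
  have h1 := hu.integral_by_parts zero_le_one hφ'
  have i1 : IntervalIntegrable (fun x => d x * φ x) volume 0 1 :=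
    hu.1.mul_continuousOn hφ.continuous.continuousOn
  have i2 : IntervalIntegrable (fun x => u x * deriv φ x) volume 0 1 :=
    ((hu.continuousOn zero_le_one).mul
      (hφ.continuous_deriv le_rfl).continuousOn).intervalIntegrable_of_Icc zero_le_one
  rw [intervalIntegral.integral_add i1 i2] at h1
  rw [pairing_apply (memLp_contDiff hφ), pairing_apply (memLp_deriv hφ)]
  have e1 : ∫ x, h x * φ x ∂unitMeasure = c * ∫ x in (0 : ℝ)..1, d x * φ x := by
    rw [← intervalIntegral.integral_const_mul, ← integral_unitMeasure]
    refine integral_congr_ae ?_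
    filter_upwards [hh] with x hx
    rw [hx, mul_assoc]
  have e2 : ∫ x, f x * deriv φ x ∂unitMeasure = ∫ x in (0 : ℝ)..1, u x * deriv φ x := by
    rw [← integral_unitMeasure]
    refine integral_congr_ae ?_
    filter_upwards [hf] with x hx
    rw [hx]
  rw [e1, e2, ← h1]
  ring

variable {S : NominalSystem} {κ : Fin 2 → ℝ} {k : BacksteppingKernels}

/-- `G` is the time derivative of the transport equations at the state `Y`, weakly in space, with
boundary values `z(0) = z0`, `w(1) = w1` and `z(1) = z1`. -/
structure IsTransport (S : NominalSystem) (Y G : StateSpace) (z0 : ℝ) (w1 : Fin 3 → ℝ) (z1 : ℝ) :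
    Prop where
  right : ∀ φ : ℝ → ℝ, ContDiff ℝ 1 φ → ∀ i, pairing φ (rightCoord i G)
    = S.lamP i * ((S.Q i * z0 + ∑ j, S.C i j * odeCoord j Y) * φ 0 - w1 i * φ 1)
      + S.lamP i * pairing (deriv φ) (rightCoord i Y) + pairing φ (rightSource S i Y)
  left : ∀ φ : ℝ → ℝ, ContDiff ℝ 1 φ → pairing φ (leftCoord G)
    = S.lamM * (z1 * φ 1 - z0 * φ 0)
      - S.lamM * pairing (deriv φ) (leftCoord Y) + pairing φ (leftSource S Y)

lemma IsTransport.add {Y G Y' G' : StateSpace} {z0 z0' z1 z1' : ℝ} {w1 w1' : Fin 3 → ℝ}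
    (h : IsTransport S Y G z0 w1 z1) (h' : IsTransport S Y' G' z0' w1' z1') :
    IsTransport S (Y + Y') (G + G') (z0 + z0') (w1 + w1') (z1 + z1') := by
  refine ⟨fun φ hφ i => ?_, fun φ hφ => ?_⟩
  · simp only [map_add, h.right φ hφ, h'.right φ hφ, mul_add, Finset.sum_add_distrib, Pi.add_apply]
    ring
  · simp only [map_add, h.left φ hφ, h'.left φ hφ]; ring

lemma IsTransport.smul {Y G : StateSpace} {z0 z1 : ℝ} {w1 : Fin 3 → ℝ}
    (h : IsTransport S Y G z0 w1 z1) (c : ℝ) :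
    IsTransport S (c • Y) (c • G) (c * z0) (c • w1) (c * z1) := by
  refine ⟨fun φ hφ i => ?_, fun φ hφ => ?_⟩
  · have : ∑ j, S.C i j * (c * odeCoord j Y) = c * ∑ j, S.C i j * odeCoord j Y := by
      rw [Finset.mul_sum]; exact Finset.sum_congr rfl fun l _ => by ring
    simp only [map_smul, h.right φ hφ, smul_eq_mul, Pi.smul_apply, this]; ring
  · simp only [map_smul, h.left φ hφ, smul_eq_mul]; ring

lemma IsTransport.isGenerator {Y G : StateSpace} {z0 z1 : ℝ} {w1 : Fin 3 → ℝ}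
    (h : IsTransport S Y G z0 w1 z1) (hz : z1 = closedLoopTrace k Y)
    (hX : ∀ j, odeCoord j G = ∑ l, S.A j l * odeCoord l Y + S.B j * z0) :
    IsGenerator S k Y G z0 w1 :=
  ⟨hX, h.right, fun φ hφ => hz ▸ h.left φ hφ⟩

/-- The resolvent equation of the transport equations with prescribed values at `x = 0`. -/
lemma exists_isTransport (hP : ∀ i, 0 < S.lamP i) (hM : 0 < S.lamM) (l : ℝ) (g : StateSpace)
    (X : Fin 2 → ℝ) (z0 : ℝ) :
    ∃ Y w1 z1, (∀ j, odeCoord j Y = X j) ∧ IsTransport S Y (l • Y - g) z0 w1 z1 := by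
  set M : Matrix (Fin 3 ⊕ Unit) (Fin 3 ⊕ Unit) ℝ := Matrix.of fun c d =>
    Sum.elim (fun i => Sum.elim (fun j => (S.lamP i)⁻¹ * (S.sigPP i j - if i = j then l else 0))
        (fun _ => (S.lamP i)⁻¹ * S.sigPM i) d)
      (fun _ => Sum.elim (fun j => -(S.lamM⁻¹ * S.sigMP j)) (fun _ => S.lamM⁻¹ * (l - S.sigMM)) d) c
    with hMdef
  obtain ⟨u, hu⟩ := exists_linear_ode M
    (f := Sum.elim (fun i x => (S.lamP i)⁻¹ * rightCoord i g x)
      (fun _ x => -(S.lamM⁻¹ * leftCoord g x)))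
    (by
      rintro (i | _)
      · exact (integrable_leftState _).const_mul _
      · exact ((integrable_leftState _).const_mul _).neg)
    (Sum.elim (fun i => S.Q i * z0 + ∑ j, S.C i j * X j) fun _ => z0)
  have huc : ∀ c, ContinuousOn (u c) (Icc 0 1) := fun c => (hu c).2.continuousOn zero_le_one
  obtain ⟨w, hw⟩ := exists_rightState fun i => toLeftState (u (Sum.inl i))
  set Y := mkState (WithLp.toLp 2 X) w (toLeftState (u (Sum.inr ()))) with hY
  have hYX : ∀ j, odeCoord j Y = X j := fun j => rfl
  have hYw : ∀ i, rightCoord i Y =ᵐ[unitMeasure] u (Sum.inl i) := fun i => by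
    rw [hY, rightCoord_mkState, hw]
    exact coeFn_toLeftState (huc _)
  have hYz : leftCoord Y =ᵐ[unitMeasure] u (Sum.inr ()) := coeFn_toLeftState (huc _)
  refine ⟨Y, fun i => u (Sum.inl i) 1, u (Sum.inr ()) 1, hYX, fun φ hφ i => ?_, fun φ hφ => ?_⟩
  · have h1 : (l • rightCoord i Y - rightCoord i g - rightSource S i Y : LeftState)
        =ᵐ[unitMeasure] fun x => -S.lamP i * (∑ d, M (Sum.inl i) d * u d x
          + (S.lamP i)⁻¹ * rightCoord i g x) := by
      filter_upwards [Lp.coeFn_sub (l • rightCoord i Y - rightCoord i g) (rightSource S i Y),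
        Lp.coeFn_sub (l • rightCoord i Y) (rightCoord i g), Lp.coeFn_smul l (rightCoord i Y),
        coeFn_rightSource (S := S) i Y, hYw 0, hYw 1, hYw 2, hYw i, hYz]
        with x h1 h2 h3 h4 h5 h6 h7 h8 h9
      rw [h1, Pi.sub_apply, h2, Pi.sub_apply, h3, Pi.smul_apply, h4, h8, h9, Fin.sum_univ_three, h5,
        h6, h7, Fintype.sum_sum_type]
      simp only [hMdef, Matrix.of_apply, Sum.elim_inl, Sum.elim_inr, Finset.univ_unique,
        Finset.sum_singleton, smul_eq_mul, mul_sub, sub_mul, Finset.sum_sub_distrib, mul_ite,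
        mul_zero, ite_mul, zero_mul, Finset.sum_ite_eq, Finset.mem_univ, if_true,
        Fin.sum_univ_three]
      have := (hP i).ne'
      field_simp
      ring
    have h2 := (hu (Sum.inl i)).2.pairing_eq (hYw i) h1 hφ
    rw [(hu (Sum.inl i)).1] at h2
    simp only [map_sub, map_smul, Sum.elim_inl, hYX] at h2 ⊢
    linear_combination h2
  · have h1 : (l • leftCoord Y - leftCoord g - leftSource S Y : LeftState)
        =ᵐ[unitMeasure] fun x => S.lamM * (∑ d, M (Sum.inr ()) d * u d x
          + -(S.lamM⁻¹ * leftCoord g x)) := by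
      filter_upwards [Lp.coeFn_sub (l • leftCoord Y - leftCoord g) (leftSource S Y),
        Lp.coeFn_sub (l • leftCoord Y) (leftCoord g), Lp.coeFn_smul l (leftCoord Y),
        coeFn_leftSource (S := S) Y, hYw 0, hYw 1, hYw 2, hYz]
        with x h1 h2 h3 h4 h5 h6 h7 h9
      rw [h1, Pi.sub_apply, h2, Pi.sub_apply, h3, Pi.smul_apply, h4, h9, Fin.sum_univ_three, h5,
        h6, h7, Fintype.sum_sum_type]
      simp only [hMdef, Matrix.of_apply, Sum.elim_inl, Sum.elim_inr, Finset.univ_unique,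
        Finset.sum_singleton, smul_eq_mul, Fin.sum_univ_three]
      field_simp
      ring
    have h2 := (hu (Sum.inr ())).2.pairing_eq hYz h1 hφ
    rw [(hu (Sum.inr ())).1] at h2
    simp only [map_sub, map_smul, Sum.elim_inr] at h2 ⊢
    linear_combination h2

/-- Shooting from x = 0: with X and z(0) as three free parameters the transport equations can always
be solved. The two ODE equations and the feedback condition at x = 1 are three linear equations for
these parameters, so injectivity already gives solvability. -/
lemma exists_resolvent (hP : ∀ i, 0 < S.lamP i) (hM : 0 < S.lamM) {l : ℝ}
    (hinj : ∀ Y z0 w1, IsGenerator S k Y (l • Y) z0 w1 → Y = 0 ∧ z0 = 0) (g : StateSpace) :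
    ∃ Y G, (Y, G) ∈ generatorGraph S k ∧ l • Y - G = g := by
  obtain ⟨Yp, wp, zp, hpX, hp⟩ := exists_isTransport hP hM l g 0 0
  obtain ⟨Y0, w0, z0, h0X, h0⟩ := exists_isTransport hP hM l 0 ![1, 0] 0
  obtain ⟨Y1, w1, z1, h1X, h1⟩ := exists_isTransport hP hM l 0 ![0, 1] 0
  obtain ⟨Y2, w2, z2, h2X, h2⟩ := exists_isTransport hP hM l 0 0 1
  set tr := closedLoopTrace k
  -- Rows: the two components of the ODE, and the mismatch between z(1) reached by shooting and the
  -- value that the feedback demands.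
  set T : Matrix (Fin 3) (Fin 3) ℝ := !![l - S.A 0 0, -S.A 0 1, -S.B 0;
    -S.A 1 0, l - S.A 1 1, -S.B 1; z0 - tr Y0, z1 - tr Y1, z2 - tr Y2] with hT
  have hcomb : ∀ θ : Fin 3 → ℝ, IsTransport S (θ 0 • Y0 + θ 1 • Y1 + θ 2 • Y2)
      (l • (θ 0 • Y0 + θ 1 • Y1 + θ 2 • Y2)) (θ 2) (θ 0 • w0 + θ 1 • w1 + θ 2 • w2)
      (θ 0 * z0 + θ 1 * z1 + θ 2 * z2) := fun θ => by
    have := ((h0.smul (θ 0)).add (h1.smul (θ 1))).add (h2.smul (θ 2))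
    simp only [sub_zero, mul_zero, mul_one, zero_add] at this
    convert this using 1
    simp only [smul_add, smul_comm l]
  have hX : ∀ θ : Fin 3 → ℝ, odeCoord 0 (θ 0 • Y0 + θ 1 • Y1 + θ 2 • Y2) = θ 0 ∧
      odeCoord 1 (θ 0 • Y0 + θ 1 • Y1 + θ 2 • Y2) = θ 1 := fun θ => by
    simp [h0X, h1X, h2X]
  have hTinj : Function.Injective T.mulVecLin := by
    rw [injective_iff_map_eq_zero]
    intro θ hθ
    have e0 := congrFun hθ 0
    have e1 := congrFun hθ 1
    have e2 := congrFun hθ 2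
    simp [hT, Matrix.mulVec, dotProduct, Fin.sum_univ_three] at e0 e1 e2
    have hgen := (hcomb θ).isGenerator (k := k) (by
      simp only [map_add, map_smul, smul_eq_mul]; linarith) (by
      intro j
      rw [map_smul, smul_eq_mul, Fin.sum_univ_two, (hX θ).1, (hX θ).2]
      fin_cases j
      · simp only [Fin.zero_eta, (hX θ).1]; linarith
      · simp only [Fin.mk_one, (hX θ).2]; linarith)
    obtain ⟨hY, h2⟩ := hinj _ _ _ hgen
    have hX' := hX θ
    rw [hY, map_zero, map_zero] at hX'
    ext j
    fin_cases j
    · exact hX'.1.symm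
    · exact hX'.2.symm
    · exact h2
  obtain ⟨θ, hθ⟩ := LinearMap.injective_iff_surjective.1 hTinj
    ![odeCoord 0 g, odeCoord 1 g, tr Yp - zp]
  have e0 := congrFun hθ 0
  have e1 := congrFun hθ 1
  have e2 := congrFun hθ 2
  simp [hT, Matrix.mulVec, dotProduct, Fin.sum_univ_three] at e0 e1 e2
  have hsum := hp.add (hcomb θ)
  have hX0 : ∀ j, odeCoord j Yp = 0 := fun j => by rw [hpX]; rfl
  have hgen := hsum.isGenerator (k := k) (by
      simp only [map_add, map_smul, smul_eq_mul]; linarith) (by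
      intro j
      have hX' := hX θ
      rw [map_add, Fin.sum_univ_two, map_add (odeCoord 0) Yp _, map_add (odeCoord 1) Yp _, hX'.1, hX'.2, map_smul, map_sub, map_smul,
        hX0, hX0, hX0]
      fin_cases j
      · simp only [Fin.zero_eta, hX'.1, smul_eq_mul]; linarith
      · simp only [Fin.mk_one, hX'.2, smul_eq_mul]; linarith)
  refine ⟨_, _, ⟨_, _, hgen⟩, ?_⟩
  rw [smul_add]
  abel

lemma eq_zero_of_pairing {f : LeftState} (hf : ∀ φ : ℝ → ℝ, ContDiff ℝ 1 φ → pairing φ f = 0) :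
    f = 0 := by
  rw [Lp.eq_zero_iff_ae_eq_zero]
  refine ae_eq_zero_of_integral_contDiff_smul_eq_zero (integrable_leftState f).locallyIntegrable
    fun φ hφ _ => ?_
  have hφ1 : ContDiff ℝ 1 φ := hφ.of_le (by exact_mod_cast le_top)
  rw [← hf φ hφ1, pairing_apply (memLp_contDiff hφ1)]
  simp only [smul_eq_mul, mul_comm]

/-- The closed-loop generator is maximal dissipative. -/
theorem isMaxDissipative_generatorGraph (hP : ∀ i, 0 < S.lamP i) (hM : 0 < S.lamM)
    {V : StateSpace →L[ℝ] StateSpace →L[ℝ] ℝ} (hsymm : ∀ Y Y', V Y Y' = V Y' Y) {c : ℝ} (hc : 0 < c)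
    (hcoer : ∀ Y, c * ‖Y‖ ^ 2 ≤ V Y Y)
    (hdiss : ∀ Y G z0 w1, IsGenerator S k Y G z0 w1 →
        V Y G ≤ -c * (V Y Y + (z0 ^ 2 + ∑ i, w1 i ^ 2))) :
    IsMaxDissipative V (generatorGraph S k) := by
  have hV : ∀ Y, 0 ≤ V Y Y := fun Y => le_trans (by positivity) (hcoer Y)
  refine ⟨hsymm, ⟨c, hc, hcoer⟩, fun Y G ⟨z0, w1, h⟩ => (hdiss Y G z0 w1 h).trans ?_, fun l hl g => ?_,
    fun G ⟨z0, w1, h⟩ => ?_⟩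
  · have : 0 ≤ c * (V Y Y + (z0 ^ 2 + ∑ i, w1 i ^ 2)) :=
      mul_nonneg hc.le (add_nonneg (hV Y) (by positivity))
    linarith
  -- An element with G = l Y has V(Y,G) ≥ 0, while strict dissipation makes this negative unless Y
  -- and z(0) vanish. The trace term in the dissipation is what yields z(0) = 0.
  · refine exists_resolvent hP hM (fun Y z0 w1 h => ?_) g
    have h1 := hdiss _ _ _ _ h
    rw [map_smul, smul_eq_mul] at h1
    have h2 : 0 ≤ ∑ i, w1 i ^ 2 := by positivity
    have h3 := mul_nonneg hl.le (hV Y)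
    have h4 : V Y Y + (z0 ^ 2 + ∑ i, w1 i ^ 2) ≤ 0 := by
      by_contra! hcon
      have := mul_pos hc hcon
      linarith
    have h5 : z0 ^ 2 = 0 := by linarith [sq_nonneg z0, hV Y]
    have h6 : c * ‖Y‖ ^ 2 ≤ 0 := by linarith [hcoer Y, sq_nonneg z0]
    refine ⟨?_, by simpa using h5⟩
    have : ‖Y‖ ^ 2 ≤ 0 := by
      by_contra! hcon
      have := mul_pos hc hcon
      linarith
    simpa using le_antisymm this (sq_nonneg _)
  -- At Y = 0 the left side vanishes, so both traces vanish, and then every weak identity says that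
  -- G is orthogonal to all test functions.
  · have h1 := hdiss _ _ _ _ h
    simp only [map_zero, zero_apply, zero_add] at h1
    have h2 : z0 ^ 2 + ∑ i, w1 i ^ 2 ≤ 0 := by
      by_contra! hcon
      have := mul_pos hc hcon
      linarith
    have h3 : ∀ i, w1 i ^ 2 ≤ ∑ i, w1 i ^ 2 := fun i =>
      Finset.single_le_sum (f := fun i => w1 i ^ 2) (fun i _ => sq_nonneg _) (Finset.mem_univ i)
    have hz : z0 = 0 := by
      have : z0 ^ 2 = 0 := by linarith [sq_nonneg z0, h3 0, sq_nonneg (w1 0)]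
      simpa using this
    have hw : ∀ i, w1 i = 0 := fun i => by
      have : w1 i ^ 2 = 0 := by linarith [sq_nonneg z0, h3 i, sq_nonneg (w1 i)]
      simpa using this
    refine stateSpace_ext (fun j => ?_) (fun i => ?_) ?_
    · rw [h.ode]; simp [hz]
    · rw [map_zero]
      refine eq_zero_of_pairing fun φ hφ => ?_
      rw [h.right φ hφ]; simp [hz, hw]
    · rw [map_zero]
      refine eq_zero_of_pairing fun φ hφ => ?_
      rw [h.left φ hφ]; simp [hz]

end Resolvent

/-! ### Weak solutions as curves whose time integral lies in the generator. -/

section IntegratedSolutions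

open Filter Topology

variable {S : NominalSystem} {κ : Fin 2 → ℝ} {k : BacksteppingKernels}

variable (S) in
/-- The part of the ODE that depends on the state only. -/
noncomputable def odeForm (j : Fin 2) : StateSpace →L[ℝ] ℝ := ∑ l, S.A j l • odeCoord l

variable (S) in
/-- The part of the weak form of the rightward equations that depends on the state only. -/
noncomputable def rightForm (φ : ℝ → ℝ) (i : Fin 3) : StateSpace →L[ℝ] ℝ :=
  (S.lamP i * φ 0) • ∑ j, S.C i j • odeCoord j
    + S.lamP i • (pairing (deriv φ)).comp (rightCoord i) + (pairing φ).comp (rightSource S i)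

variable (S k) in
/-- The part of the weak form of the leftward equation that depends on the state only. -/
noncomputable def leftForm (φ : ℝ → ℝ) : StateSpace →L[ℝ] ℝ :=
  (S.lamM * φ 1) • closedLoopTrace k
    - S.lamM • (pairing (deriv φ)).comp leftCoord + (pairing φ).comp (leftSource S)

lemma odeForm_apply (j : Fin 2) (Y : StateSpace) :
    odeForm S j Y = ∑ l, S.A j l * odeCoord l Y := by
  simp [odeForm]

lemma rightForm_apply (φ : ℝ → ℝ) (i : Fin 3) (Y : StateSpace) :
    rightForm S φ i Y = S.lamP i * φ 0 * ∑ j, S.C i j * odeCoord j Y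
      + S.lamP i * pairing (deriv φ) (rightCoord i Y) + pairing φ (rightSource S i Y) := by
  simp [rightForm]
  ring

lemma leftForm_apply (φ : ℝ → ℝ) (Y : StateSpace) :
    leftForm S k φ Y = S.lamM * φ 1 * closedLoopTrace k Y
      - S.lamM * pairing (deriv φ) (leftCoord Y) + pairing φ (leftSource S Y) := by
  simp [leftForm]

/-- Each defining identity is a bounded functional of Y plus scalar multiples of the two unbounded
traces. In this form the relation visibly commutes with limits and with integration in time. -/
lemma isGenerator_iff {Y G : StateSpace} {z0 : ℝ} {w1 : Fin 3 → ℝ} :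
    IsGenerator S k Y G z0 w1 ↔
      (∀ j, odeCoord j G = odeForm S j Y + S.B j * z0) ∧
      (∀ φ : ℝ → ℝ, ContDiff ℝ 1 φ → ∀ i, pairing φ (rightCoord i G)
        = rightForm S φ i Y + S.lamP i * S.Q i * φ 0 * z0 + -(S.lamP i * φ 1) * w1 i) ∧
      ∀ φ : ℝ → ℝ, ContDiff ℝ 1 φ → pairing φ (leftCoord G)
        = leftForm S k φ Y + -(S.lamM * φ 0) * z0 := by
  constructor
  · intro h
    refine ⟨fun j => ?_, fun φ hφ i => ?_, fun φ hφ => ?_⟩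
    · rw [h.ode, odeForm_apply]
    · rw [h.right φ hφ, rightForm_apply]; ring
    · rw [h.left φ hφ, leftForm_apply]; ring
  · rintro ⟨h1, h2, h3⟩
    refine ⟨fun j => ?_, fun φ hφ i => ?_, fun φ hφ => ?_⟩
    · rw [h1, odeForm_apply]
    · rw [h2 φ hφ, rightForm_apply]; ring
    · rw [h3 φ hφ, leftForm_apply]; ring

/-- The generator relation with traces is closed. -/
lemma IsGenerator.of_tendsto {Y G : ℕ → StateSpace} {z0 : ℕ → ℝ} {w1 : ℕ → Fin 3 → ℝ}
    {Y' G' : StateSpace} {z0' : ℝ} {w1' : Fin 3 → ℝ}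
    (h : ∀ n, IsGenerator S k (Y n) (G n) (z0 n) (w1 n))
    (hY : Tendsto Y atTop (𝓝 Y')) (hG : Tendsto G atTop (𝓝 G')) (hz : Tendsto z0 atTop (𝓝 z0'))
    (hw : ∀ i, Tendsto (fun n => w1 n i) atTop (𝓝 (w1' i))) : IsGenerator S k Y' G' z0' w1' := by
  simp only [isGenerator_iff] at h ⊢
  have hc : ∀ (L : StateSpace →L[ℝ] ℝ) {Z : ℕ → StateSpace} {Z' : StateSpace},
      Tendsto Z atTop (𝓝 Z') → Tendsto (fun n => L (Z n)) atTop (𝓝 (L Z')) := fun L _ _ hZ =>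
    (L.continuous.tendsto _).comp hZ
  refine ⟨fun j => ?_, fun φ hφ i => ?_, fun φ hφ => ?_⟩
  · exact tendsto_nhds_unique (hc (odeCoord j) hG) (by
      simp only [(h _).1]; exact (hc _ hY).add (hz.const_mul _))
  · exact tendsto_nhds_unique (hc ((pairing φ).comp (rightCoord i)) hG) (by
      simp only [ContinuousLinearMap.comp_apply, (h _).2.1 φ hφ]
      exact ((hc _ hY).add (hz.const_mul _)).add ((hw i).const_mul _))
  · exact tendsto_nhds_unique (hc ((pairing φ).comp leftCoord) hG) (by
      simp only [ContinuousLinearMap.comp_apply, (h _).2.2 φ hφ]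
      exact (hc _ hY).add (hz.const_mul _))

lemma integral_affine (L : StateSpace →L[ℝ] ℝ) (a b : ℝ) {Y : ℝ → StateSpace} {f g : ℝ → ℝ}
    {s t : ℝ} (hY : IntervalIntegrable Y volume s t) (hf : IntervalIntegrable f volume s t)
    (hg : IntervalIntegrable g volume s t) :
    ∫ r in s..t, (L (Y r) + a * f r + b * g r)
      = L (∫ r in s..t, Y r) + a * (∫ r in s..t, f r) + b * ∫ r in s..t, g r := by
  have hL : IntervalIntegrable (fun r => L (Y r)) volume s t :=
    ⟨L.integrable_comp hY.1, L.integrable_comp hY.2⟩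
  rw [intervalIntegral.integral_add (hL.add (hf.const_mul a)) (hg.const_mul b),
    intervalIntegral.integral_add hL (hf.const_mul a), intervalIntegral.integral_const_mul,
    intervalIntegral.integral_const_mul, L.intervalIntegral_comp_comm hY]

/-- Closed-loop solutions in time-integrated form, with the boundary values `z(0) = τ₀` and
`w(1) = τ₁`. -/
structure IsIntegratedSolution (S : NominalSystem) (k : BacksteppingKernels) (Y : ℝ → StateSpace)
    (τ₀ : ℝ → ℝ) (τ₁ : ℝ → Fin 3 → ℝ) : Prop where
  cont : ContinuousOn Y (Ici 0)
  zero_L2 : IsLocallyL2 τ₀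
  one_L2 : ∀ i, IsLocallyL2 fun t => τ₁ t i
  gen : ∀ t, 0 ≤ t → IsGenerator S k (∫ s in (0 : ℝ)..t, Y s) (Y t - Y 0)
    (∫ s in (0 : ℝ)..t, τ₀ s) fun i => ∫ s in (0 : ℝ)..t, τ₁ s i

lemma IsLocallyL2.intervalIntegrable {f : ℝ → ℝ} (hf : IsLocallyL2 f) {s t : ℝ} (hs : 0 ≤ s)
    (ht : 0 ≤ t) : IntervalIntegrable f volume s t := by
  have h : IntegrableOn f (Icc 0 (max s t)) := (hf (max s t)).integrable (by norm_num)
  rw [intervalIntegrable_iff]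
  exact h.mono_set fun x hx => ⟨(le_min hs ht).trans hx.1.le, hx.2⟩

lemma isLocallyL2_of_continuousOn {f : ℝ → ℝ} (hf : ContinuousOn f (Ici 0)) : IsLocallyL2 f := by
  intro T
  have hf' : ContinuousOn f (Icc 0 T) := hf.mono Icc_subset_Ici_self
  obtain ⟨C, hC⟩ := isCompact_Icc.exists_bound_of_continuousOn hf'
  refine MemLp.of_bound (hf'.aestronglyMeasurable measurableSet_Icc) C ?_
  rw [ae_restrict_iff' measurableSet_Icc]
  exact Eventually.of_forall hC

lemma intervalIntegrable_of_continuousOn_Ici {E : Type*} [NormedAddCommGroup E] {Y : ℝ → E}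
    (hY : ContinuousOn Y (Ici 0)) {s t : ℝ} (hs : 0 ≤ s) (ht : 0 ≤ t) :
    IntervalIntegrable Y volume s t :=
  (hY.mono fun _ hx => (le_min hs ht).trans hx.1).intervalIntegrable

lemma integral_right_eq {φ : ℝ → ℝ} (hφ : ContDiff ℝ 1 φ) (i : Fin 3) (X : OdeState)
    (w : RightState) (z : LeftState) :
    ∫ x, (S.lamP i * w x i * deriv φ x
        + (∑ j, S.sigPP i j * w x j + S.sigPM i * z x) * φ x) ∂unitMeasure
      = S.lamP i * pairing (deriv φ) (component i w)
        + pairing φ (rightSource S i (mkState X w z)) := by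
  rw [pairing_apply (memLp_deriv hφ), pairing_apply (memLp_contDiff hφ), ← integral_const_mul,
    ← integral_add ((integrable_leftState_mul _ (memLp_deriv hφ)).const_mul _)
      (integrable_leftState_mul _ (memLp_contDiff hφ))]
  refine integral_congr_ae ?_
  filter_upwards [coeFn_component 0 w, coeFn_component 1 w, coeFn_component 2 w, coeFn_component i w,
    coeFn_rightSource (S := S) i (mkState X w z)] with x h0 h1 h2 hi h
  rw [h, hi]
  simp only [rightCoord_mkState, leftCoord_mkState, Fin.sum_univ_three, h0, h1, h2]
  ring

lemma integral_left_eq {φ : ℝ → ℝ} (hφ : ContDiff ℝ 1 φ) (X : OdeState)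
    (w : RightState) (z : LeftState) :
    ∫ x, (-(S.lamM * z x * deriv φ x)
        + (∑ j, S.sigMP j * w x j + S.sigMM * z x) * φ x) ∂unitMeasure
      = -(S.lamM * pairing (deriv φ) z) + pairing φ (leftSource S (mkState X w z)) := by
  rw [pairing_apply (memLp_deriv hφ), pairing_apply (memLp_contDiff hφ), ← neg_mul,
    ← integral_const_mul,
    ← integral_add ((integrable_leftState_mul _ (memLp_deriv hφ)).const_mul _)
      (integrable_leftState_mul _ (memLp_contDiff hφ))]
  refine integral_congr_ae ?_
  filter_upwards [coeFn_component 0 w, coeFn_component 1 w, coeFn_component 2 w,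
    coeFn_leftSource (S := S) (mkState X w z)] with x h0 h1 h2 h
  rw [h]
  simp only [rightCoord_mkState, leftCoord_mkState, Fin.sum_univ_three, h0, h1, h2]
  ring

/-- The feedback cancels the reflection R w(1), so z(1) becomes a bounded functional of the state,
whatever the trace w(1) is. -/
lemma closedLoopTrace_mkState (hk : IsKernelSolution S κ k) (w1 : Fin 3 → ℝ) (X : OdeState)
    (w : RightState) (z : LeftState) :
    closedLoopTrace k (mkState X w z)
      = ∑ i, S.R i * w1 i + backsteppingControl S k w1 X w z := by
  have hK : ∀ i, MemLp (fun ξ => k.K (1, ξ) i) 2 unitMeasure := fun i =>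
    memLp_of_continuousOn (continuousOn_top_slice (hk.contDiff_K i).continuousOn) 2
  have hN : MemLp (fun ξ => k.N (1, ξ)) 2 unitMeasure :=
    memLp_of_continuousOn (continuousOn_top_slice hk.contDiff_N.continuousOn) 2
  have h1 : ∫ ξ, (∑ i, k.K (1, ξ) i * w ξ i) ∂unitMeasure
      = ∑ i, pairing (fun ξ => k.K (1, ξ) i) (component i w) := by
    simp only [fun i => pairing_apply (hK i)]
    rw [← integral_finsetSum _ fun i _ => integrable_leftState_mul _ (hK i)]
    refine integral_congr_ae ?_
    filter_upwards [coeFn_component 0 w, coeFn_component 1 w, coeFn_component 2 w] with x h0 h1 h2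
    simp only [Fin.sum_univ_three, h0, h1, h2]
    ring
  have h2 : ∫ ξ, k.N (1, ξ) * z ξ ∂unitMeasure = pairing (fun ξ => k.N (1, ξ)) z := by
    rw [pairing_apply hN]
    simp only [mul_comm]
  rw [backsteppingControl, h1, h2]
  simp only [closedLoopTrace, add_apply, sum_apply, ContinuousLinearMap.comp_apply, smul_apply,
    smul_eq_mul, rightCoord_mkState, leftCoord_mkState, odeCoord_mkState]
  ring

lemma integral_right_pairing {φ : ℝ → ℝ} (hφ : ContDiff ℝ 1 φ) (i : Fin 3) (w : RightState) :
    ∫ x, w x i * φ x ∂unitMeasure = pairing φ (component i w) := by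
  rw [pairing_apply (memLp_contDiff hφ)]
  refine integral_congr_ae ?_
  filter_upwards [coeFn_component i w] with x h
  rw [h]

lemma intervalIntegral_congr_ae_Ici {f g : ℝ → ℝ} {t : ℝ} (ht : 0 ≤ t)
    (h : ∀ᵐ s ∂(volume.restrict (Ici (0 : ℝ))), f s = g s) :
    ∫ s in (0 : ℝ)..t, f s = ∫ s in (0 : ℝ)..t, g s := by
  refine intervalIntegral.integral_congr_ae ?_
  rw [ae_restrict_iff' measurableSet_Ici] at h
  filter_upwards [h] with s hs hs'
  rw [uIoc_of_le ht] at hs'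
  exact hs hs'.1.le

lemma continuousOn_mkState {X : ℝ → OdeState} {w : ℝ → RightState} {z : ℝ → LeftState} {s : Set ℝ}
    (hX : ContinuousOn X s) (hw : ContinuousOn w s) (hz : ContinuousOn z s) :
    ContinuousOn (fun t => mkState (X t) (w t) (z t)) s :=
  (WithLp.prod_continuous_toLp 2 _ _).comp_continuousOn
    (hX.prodMk ((WithLp.prod_continuous_toLp 2 _ _).comp_continuousOn (hw.prodMk hz)))

/-- Bounded functionals commute with the time integral, so the integrated weak equations are the
generator relation for ∫Y. The boundary conditions are needed only almost everywhere because they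
occur under an integral. -/
lemma IsClosedLoopSolution.exists_isIntegratedSolution (hk : IsKernelSolution S κ k)
    {X : ℝ → OdeState} {w : ℝ → RightState} {z : ℝ → LeftState}
    (h : IsClosedLoopSolution S k X w z) :
    ∃ τ₀ τ₁, IsIntegratedSolution S k (fun t => mkState (X t) (w t) (z t)) τ₀ τ₁ := by
  obtain ⟨w0, w1, z0, z1, h, hb0, hb1⟩ := h
  have hc := continuousOn_mkState h.cont_X h.cont_w h.cont_z
  refine ⟨z0, w1, hc, h.zZero_L2, h.wOne_L2, fun t ht => isGenerator_iff.2 ⟨fun j => ?_,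
    fun φ hφ i => ?_, fun φ hφ => ?_⟩⟩
  all_goals
    have iY := intervalIntegrable_of_continuousOn_Ici hc le_rfl ht
    have i0 := h.zZero_L2.intervalIntegrable le_rfl ht
    have i1 := fun i => (h.wOne_L2 i).intervalIntegrable le_rfl ht
  · have e := integral_affine (odeForm S j) (S.B j) 0 iY i0 i0
    simp only [zero_mul, add_zero] at e
    rw [map_sub, odeCoord_mkState, odeCoord_mkState, h.eq_X t ht, add_sub_cancel_left, ← e]
    simp only [odeForm_apply, odeCoord_mkState]
  · have e := integral_affine (rightForm S φ i) (S.lamP i * S.Q i * φ 0) (-(S.lamP i * φ 1)) iY i0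
      (i1 i)
    rw [map_sub, map_sub, rightCoord_mkState, rightCoord_mkState, ← integral_right_pairing hφ,
      ← integral_right_pairing hφ, h.eq_w φ hφ t ht, add_sub_cancel_left, ← e]
    refine intervalIntegral_congr_ae_Ici ht ?_
    filter_upwards [hb0] with s hs
    rw [integral_right_eq hφ i (X s), hs i, rightForm_apply]
    simp only [odeCoord_mkState, rightCoord_mkState]
    ring
  · have e := integral_affine (leftForm S k φ) (-(S.lamM * φ 0)) 0 iY i0 i0
    simp only [zero_mul, add_zero] at e
    rw [map_sub, map_sub, leftCoord_mkState, leftCoord_mkState, pairing_apply (memLp_contDiff hφ),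
      pairing_apply (memLp_contDiff hφ), h.eq_z φ hφ t ht, add_sub_cancel_left, ← e]
    refine intervalIntegral_congr_ae_Ici ht ?_
    filter_upwards [hb1] with s hs
    rw [integral_left_eq hφ (X s), hs, ← closedLoopTrace_mkState hk, leftForm_apply]
    simp only [leftCoord_mkState]
    ring

lemma IsIntegratedSolution.isClosedLoopSolution (hk : IsKernelSolution S κ k)
    {X : ℝ → OdeState} {w : ℝ → RightState} {z : ℝ → LeftState} {τ₀ : ℝ → ℝ} {τ₁ : ℝ → Fin 3 → ℝ}
    (hX : ContinuousOn X (Ici 0)) (hw : ContinuousOn w (Ici 0)) (hz : ContinuousOn z (Ici 0))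
    (h : IsIntegratedSolution S k (fun t => mkState (X t) (w t) (z t)) τ₀ τ₁) :
    IsClosedLoopSolution S k X w z := by
  set Y : ℝ → StateSpace := fun t => mkState (X t) (w t) (z t) with hY
  refine ⟨fun t i => S.Q i * τ₀ t + ∑ j, S.C i j * X t j, τ₁, τ₀, fun t => closedLoopTrace k (Y t),
    ⟨hX, hw, hz, fun i T => ?_, h.one_L2, h.zero_L2, ?_, fun t ht j => ?_, fun φ hφ t ht i => ?_,
      fun φ hφ t ht => ?_⟩, Eventually.of_forall fun t i => rfl,
    Eventually.of_forall fun t => closedLoopTrace_mkState hk (τ₁ t) (X t) (w t) (z t)⟩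
  · refine ((h.zero_L2 T).const_mul (S.Q i)).add (isLocallyL2_of_continuousOn ?_ T)
    have : ∀ j, ContinuousOn (fun t => odeCoord j (Y t)) (Ici 0) := fun j =>
      (odeCoord j).continuous.comp_continuousOn h.cont
    exact continuousOn_finsetSum _ fun j _ => (this j).const_mul _
  · exact isLocallyL2_of_continuousOn ((closedLoopTrace k).continuous.comp_continuousOn h.cont)
  all_goals
    have iY := intervalIntegrable_of_continuousOn_Ici h.cont le_rfl ht
    have i0 := h.zero_L2.intervalIntegrable le_rfl ht
    have i1 := fun i => (h.one_L2 i).intervalIntegrable le_rfl ht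
    have hg := isGenerator_iff.1 (h.gen t ht)
  · have e := integral_affine (odeForm S j) (S.B j) 0 iY i0 i0
    simp only [zero_mul, add_zero] at e
    have h1 := hg.1 j
    rw [map_sub, ← e] at h1
    simp only [odeForm_apply, hY, odeCoord_mkState] at h1
    linarith
  · have e := integral_affine (rightForm S φ i) (S.lamP i * S.Q i * φ 0) (-(S.lamP i * φ 1)) iY i0
      (i1 i)
    have h1 := hg.2.1 φ hφ i
    rw [← e, map_sub, map_sub, sub_eq_iff_eq_add'] at h1
    rw [integral_right_pairing hφ, integral_right_pairing hφ]
    refine h1.trans ?_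
    congr 1
    refine intervalIntegral.integral_congr fun s _ => ?_
    dsimp only
    rw [integral_right_eq hφ i (X s), rightForm_apply]
    simp only [hY, odeCoord_mkState, rightCoord_mkState]
    ring
  · have e := integral_affine (leftForm S k φ) (-(S.lamM * φ 0)) 0 iY i0 i0
    simp only [zero_mul, add_zero] at e
    have h1 := hg.2.2 φ hφ
    rw [← e, map_sub, map_sub, sub_eq_iff_eq_add'] at h1
    rw [← pairing_apply (memLp_contDiff hφ), ← pairing_apply (memLp_contDiff hφ)]
    refine h1.trans ?_
    congr 1
    refine intervalIntegral.integral_congr fun s _ => ?_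
    dsimp only
    rw [integral_left_eq hφ (X s), leftForm_apply]
    simp only [hY, leftCoord_mkState]
    ring

end IntegratedSolutions

/-! ### Decay of averages, energy bounds for traces and limits. -/

section WellPosedness

open Filter Topology

variable {S : NominalSystem} {κ : Fin 2 → ℝ} {k : BacksteppingKernels}

/-- Exponential decay of a quadratic Lyapunov functional along integrated solutions. -/
theorem IsIntegratedSolution.lyapunov_decay {V : StateSpace →L[ℝ] StateSpace →L[ℝ] ℝ}
    (hsymm : ∀ Y Y', V Y Y' = V Y' Y) {c : ℝ}
    (hdiss : ∀ Y G z0 w1, IsGenerator S k Y G z0 w1 → V Y G ≤ -c * V Y Y)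
    {Y : ℝ → StateSpace} {τ₀ : ℝ → ℝ} {τ₁ : ℝ → Fin 3 → ℝ} (h : IsIntegratedSolution S k Y τ₀ τ₁)
    {t : ℝ} (ht : 0 ≤ t) : V (Y t) (Y t) ≤ Real.exp (-(2 * c) * t) * V (Y 0) (Y 0) := by
  set Z : ℝ → StateSpace := fun s => Y (max s 0) with hZ
  have hZc : Continuous Z := h.cont.comp_continuous (by fun_prop) fun s =>
    mem_Ici.2 (le_max_right _ _)
  have hZY : ∀ s, 0 ≤ s → Z s = Y s := fun s hs => by rw [hZ]; simp [hs]
  set P : ℝ → StateSpace := fun s => ∫ r in (0 : ℝ)..s, Z r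
  have hPd : ∀ s, HasDerivAt P (Z s) s := fun s => (hZc.integral_hasStrictDerivAt 0 s).hasDerivAt
  have hPY : ∀ s, 0 ≤ s → P s = ∫ r in (0 : ℝ)..s, Y r := fun s hs =>
    intervalIntegral.integral_congr fun r hr => hZY r (by rw [uIcc_of_le hs] at hr; exact hr.1)
  have key : ∀ δ, 0 < δ → V (δ⁻¹ • (P (t + δ) - P t)) (δ⁻¹ • (P (t + δ) - P t))
      ≤ Real.exp (-(2 * c) * t) * V (δ⁻¹ • (P (0 + δ) - P 0)) (δ⁻¹ • (P (0 + δ) - P 0)) := by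
    intro δ hδ
    -- The integral over a sliding window is differentiable, and subtracting two instances of the
    -- integrated equation shows that its derivative is the generator applied to it. So V can be
    -- differentiated along it, although not along Y.
    set I : ℝ → StateSpace := fun s => P (s + δ) - P s with hI
    have hId : ∀ s, HasDerivAt I (Z (s + δ) - Z s) s := fun s =>
      ((hPd (s + δ)).comp_add_const s δ).sub (hPd s)
    have hΦ : ∀ s, HasDerivAt (fun s => Real.exp (2 * c * s) * V (I s) (I s))
        (2 * c * Real.exp (2 * c * s) * V (I s) (I s)
          + Real.exp (2 * c * s) * (2 * V (I s) (Z (s + δ) - Z s))) s := fun s => by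
      have h1 := ((hasDerivAt_id s).const_mul (2 * c)).exp
      refine (h1.mul (HasDerivAt.quadratic hsymm (hId s))).congr_deriv ?_
      simp only [id, mul_one]
      ring
    have hanti : AntitoneOn (fun s => Real.exp (2 * c * s) * V (I s) (I s)) (Ici 0) := by
      refine antitoneOn_of_deriv_nonpos (convex_Ici 0)
        (fun s _ => (hΦ s).continuousAt.continuousWithinAt)
        (fun s _ => (hΦ s).differentiableAt.differentiableWithinAt) fun s hs => ?_
      rw [interior_Ici] at hs
      have hs0 : 0 ≤ s := le_of_lt hs
      have hsδ : 0 ≤ s + δ := by linarith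
      have hg := (h.gen (s + δ) hsδ).add ((h.gen s hs0).smul (-1))
      have hd := hdiss _ _ _ _ hg
      rw [← hPY _ hs0, ← hPY _ hsδ, ← hZY _ hs0, ← hZY _ hsδ] at hd
      have e1 : P (s + δ) + (-1 : ℝ) • P s = I s := by rw [hI]; module
      have e2 : Z (s + δ) - Y 0 + (-1 : ℝ) • (Z s - Y 0) = Z (s + δ) - Z s := by module
      rw [e1, e2] at hd
      rw [(hΦ s).deriv]
      have := mul_le_mul_of_nonneg_left hd (Real.exp_pos (2 * c * s)).le
      linarith
    have h0 := hanti (mem_Ici.2 le_rfl) (mem_Ici.2 ht) ht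
    simp only [mul_zero, Real.exp_zero, one_mul] at h0
    have h1 : V (I t) (I t) ≤ Real.exp (-(2 * c) * t) * V (I 0) (I 0) := by
      have := mul_le_mul_of_nonneg_left h0 (Real.exp_pos (-(2 * c) * t)).le
      rwa [← mul_assoc, ← Real.exp_add, neg_mul, neg_add_cancel, Real.exp_zero, one_mul,
        ← neg_mul] at this
    simp only [map_smul, smul_apply, smul_eq_mul]
    have h2 := mul_le_mul_of_nonneg_left h1 (mul_self_nonneg δ⁻¹)
    linarith
  -- Shrinking the window recovers the solution itself, by continuity in time.
  have hlim : ∀ s, Tendsto (fun δ : ℝ => V (δ⁻¹ • (P (s + δ) - P s)) (δ⁻¹ • (P (s + δ) - P s)))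
      (𝓝[>] 0) (𝓝 (V (Z s) (Z s))) := fun s => by
    have hc : Continuous fun x : StateSpace => V x x := by fun_prop
    exact (hc.tendsto _).comp (hPd s).tendsto_slope_zero_right
  rw [← hZY t ht, ← hZY 0 le_rfl]
  exact le_of_tendsto_of_tendsto (hlim t) ((hlim 0).const_mul _)
    (by filter_upwards [self_mem_nhdsWithin] with δ hδ using key δ hδ)

variable (S k) in
/-- The boundary value `z(0)` as a functional on the graph of the generator. -/
noncomputable def zeroTrace : StateSpace × StateSpace →L[ℝ] ℝ :=
  S.lamM⁻¹ • ((leftForm S k fun _ => 1).comp (ContinuousLinearMap.fst ℝ _ _)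
    - ((pairing fun _ => 1).comp leftCoord).comp (ContinuousLinearMap.snd ℝ _ _))

variable (S) in
/-- The boundary values `w(1)` as functionals on the graph of the generator. -/
noncomputable def oneTrace (i : Fin 3) : StateSpace × StateSpace →L[ℝ] ℝ :=
  (S.lamP i)⁻¹ • ((rightForm S (fun x => x) i).comp (ContinuousLinearMap.fst ℝ _ _)
    - ((pairing fun x => x).comp (rightCoord i)).comp (ContinuousLinearMap.snd ℝ _ _))

/-- The test function 1 in the leftward equation isolates z(0), and the test function x, which
vanishes at 0, isolates w(1). So the traces are unique and continuous in the graph norm. -/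
lemma isGenerator_trace (hP : ∀ i, 0 < S.lamP i) (hM : 0 < S.lamM) {p : StateSpace × StateSpace}
    (hp : p ∈ generatorGraph S k) :
    IsGenerator S k p.1 p.2 (zeroTrace S k p) fun i => oneTrace S i p := by
  obtain ⟨z0, w1, h⟩ := hp
  have h' := isGenerator_iff.1 h
  have e0 : zeroTrace S k p = z0 := by
    have := h'.2.2 (fun _ => 1) contDiff_const
    simp only [zeroTrace, smul_apply, sub_apply, ContinuousLinearMap.comp_apply,
      ContinuousLinearMap.coe_fst', ContinuousLinearMap.coe_snd', this, smul_eq_mul]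
    field_simp
    ring
  have e1 : (fun i => oneTrace S i p) = w1 := by
    ext i
    have := h'.2.1 (fun x => x) contDiff_id i
    have := (hP i).ne'
    simp only [oneTrace, smul_apply, sub_apply, ContinuousLinearMap.comp_apply,
      ContinuousLinearMap.coe_fst', ContinuousLinearMap.coe_snd', *, smul_eq_mul]
    field_simp
    ring
  rw [e0, e1]
  exact h

/-- A differentiable solution: a continuous curve in the graph of the generator. -/
structure IsStrictSolution (S : NominalSystem) (k : BacksteppingKernels)
    (p : ℝ → StateSpace × StateSpace) : Prop where
  cont : Continuous p
  mem : ∀ t, p t ∈ generatorGraph S k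
  eq : ∀ t, 0 ≤ t → (p t).1 = (p 0).1 + ∫ s in (0 : ℝ)..t, (p s).2

lemma IsStrictSolution.sub {p q : ℝ → StateSpace × StateSpace} (hp : IsStrictSolution S k p)
    (hq : IsStrictSolution S k q) : IsStrictSolution S k fun t => p t - q t := by
  refine ⟨hp.cont.sub hq.cont, fun t => sub_mem (hp.mem t) (hq.mem t), fun t ht => ?_⟩
  simp only [Prod.fst_sub, Prod.snd_sub]
  have i1 : IntervalIntegrable (fun s => (p s).2) volume 0 t :=
    (continuous_snd.comp hp.cont).intervalIntegrable _ _
  have i2 : IntervalIntegrable (fun s => (q s).2) volume 0 t :=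
    (continuous_snd.comp hq.cont).intervalIntegrable _ _
  rw [intervalIntegral.integral_sub i1 i2, hp.eq t ht, hq.eq t ht]
  abel

lemma IsStrictSolution.gen (hP : ∀ i, 0 < S.lamP i) (hM : 0 < S.lamM)
    {p : ℝ → StateSpace × StateSpace} (hp : IsStrictSolution S k p) {t : ℝ} (ht : 0 ≤ t) :
    IsGenerator S k (∫ s in (0 : ℝ)..t, (p s).1) ((p t).1 - (p 0).1)
      (∫ s in (0 : ℝ)..t, zeroTrace S k (p s)) fun i => ∫ s in (0 : ℝ)..t, oneTrace S i (p s) := by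
  have hg := fun s => isGenerator_iff.1 (isGenerator_trace hP hM (hp.mem s))
  have i1 : IntervalIntegrable (fun s => (p s).1) volume 0 t :=
    (continuous_fst.comp hp.cont).intervalIntegrable _ _
  have i2 : IntervalIntegrable (fun s => (p s).2) volume 0 t :=
    (continuous_snd.comp hp.cont).intervalIntegrable _ _
  have i3 : IntervalIntegrable (fun s => zeroTrace S k (p s)) volume 0 t :=
    ((zeroTrace S k).continuous.comp hp.cont).intervalIntegrable _ _
  have i4 : ∀ i, IntervalIntegrable (fun s => oneTrace S i (p s)) volume 0 t := fun i =>
    ((oneTrace S i).continuous.comp hp.cont).intervalIntegrable _ _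
  rw [hp.eq t ht, add_sub_cancel_left]
  refine isGenerator_iff.2 ⟨fun j => ?_, fun φ hφ i => ?_, fun φ hφ => ?_⟩
  · have e := integral_affine (odeForm S j) (S.B j) 0 i1 i3 i3
    rw [zero_mul, add_zero] at e
    rw [← (odeCoord j).intervalIntegral_comp_comm i2, ← e]
    simp only [(hg _).1, zero_mul, add_zero]
  · rw [← integral_affine _ _ _ i1 i3 (i4 i), ← ContinuousLinearMap.comp_apply,
      ← ((pairing φ).comp (rightCoord i)).intervalIntegral_comp_comm i2]
    simp only [ContinuousLinearMap.comp_apply, (hg _).2.1 φ hφ]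
  · have e := integral_affine (leftForm S k φ) (-(S.lamM * φ 0)) 0 i1 i3 i3
    rw [zero_mul, add_zero] at e
    rw [← ContinuousLinearMap.comp_apply,
      ← ((pairing φ).comp leftCoord).intervalIntegral_comp_comm i2, ← e]
    simp only [ContinuousLinearMap.comp_apply, (hg _).2.2 φ hφ, zero_mul, add_zero]

/-- The dissipated energy bounds the boundary values. -/
lemma IsStrictSolution.energy (hP : ∀ i, 0 < S.lamP i) (hM : 0 < S.lamM)
    {V : StateSpace →L[ℝ] StateSpace →L[ℝ] ℝ} (hsymm : ∀ Y Y', V Y Y' = V Y' Y) {c : ℝ} (hc : 0 < c)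
    (hV : ∀ Y, 0 ≤ V Y Y)
    (hdiss : ∀ Y G z0 w1, IsGenerator S k Y G z0 w1 →
      V Y G ≤ -c * (V Y Y + (z0 ^ 2 + ∑ i, w1 i ^ 2)))
    {p : ℝ → StateSpace × StateSpace} (hp : IsStrictSolution S k p) {t : ℝ} (ht : 0 ≤ t) :
    V (p t).1 (p t).1 + 2 * c * ∫ s in (0 : ℝ)..t, (zeroTrace S k (p s) ^ 2
      + ∑ i, oneTrace S i (p s) ^ 2) ≤ V (p 0).1 (p 0).1 := by
  have c2 : Continuous fun s => (p s).2 := continuous_snd.comp hp.cont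
  have c1 : Continuous fun s => (p s).1 := continuous_fst.comp hp.cont
  have c3 : Continuous fun s => zeroTrace S k (p s) := (zeroTrace S k).continuous.comp hp.cont
  have c4 : ∀ i, Continuous fun s => oneTrace S i (p s) := fun i =>
    (oneTrace S i).continuous.comp hp.cont
  set Y : ℝ → StateSpace := fun s => (p 0).1 + ∫ r in (0 : ℝ)..s, (p r).2 with hY
  have hYd : ∀ s, HasDerivAt Y (p s).2 s := fun s =>
    ((c2.integral_hasStrictDerivAt 0 s).hasDerivAt).const_add _
  have hYp : ∀ s, 0 ≤ s → Y s = (p s).1 := fun s hs => (hp.eq s hs).symm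
  have hYc : Continuous Y := continuous_iff_continuousAt.2 fun s => (hYd s).continuousAt
  have hV2 : Continuous fun s => 2 * V (Y s) (p s).2 := by fun_prop
  have h1 := intervalIntegral.integral_eq_sub_of_hasDerivAt (a := 0) (b := t)
    (fun s _ => HasDerivAt.quadratic hsymm (hYd s)) (hV2.intervalIntegrable _ _)
  have h2 : ∫ s in (0 : ℝ)..t, 2 * V (Y s) (p s).2
      ≤ ∫ s in (0 : ℝ)..t, -(2 * c) * (zeroTrace S k (p s) ^ 2 + ∑ i, oneTrace S i (p s) ^ 2) := by
    refine intervalIntegral.integral_mono_on ht (hV2.intervalIntegrable _ _)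
      (Continuous.intervalIntegrable (by fun_prop) _ _) fun s hs => ?_
    rw [hYp s hs.1]
    have := hdiss _ _ _ _ (isGenerator_trace hP hM (hp.mem s))
    have := mul_nonneg hc.le (hV (p s).1)
    linarith
  rw [h1, intervalIntegral.integral_const_mul, hYp t ht, hYp 0 le_rfl] at h2
  linarith

/-- The bounds do not depend on t, so the traces form a Cauchy sequence in L²(0,∞); their integrals
over [0, t] are inner products with an indicator and converge. -/
lemma exists_limit_locallyL2 {E : Type*} [NormedAddCommGroup E] {x : ℕ → E} (hx : CauchySeq x)
    {τ : ℕ → ℝ → ℝ} (hτ : ∀ n, Continuous (τ n)) {C : ℝ}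
    (h0 : ∀ n, ∃ D, ∀ t, 0 ≤ t → ∫ s in (0 : ℝ)..t, τ n s ^ 2 ≤ D)
    (h : ∀ n m t, 0 ≤ t → ∫ s in (0 : ℝ)..t, (τ n s - τ m s) ^ 2 ≤ C * ‖x n - x m‖ ^ 2) :
    ∃ f, IsLocallyL2 f ∧ ∀ t, 0 ≤ t →
      Tendsto (fun n => ∫ s in (0 : ℝ)..t, τ n s) atTop (𝓝 (∫ s in (0 : ℝ)..t, f s)) := by
  set ν : Measure ℝ := volume.restrict (Ioi 0) with hν
  have hint : ∀ n, MemLp (τ n) 2 ν := fun n => by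
    rw [memLp_two_iff_integrable_sq (hτ n).aestronglyMeasurable]
    obtain ⟨D, hD⟩ := h0 n
    refine integrableOn_Ioi_of_intervalIntegral_norm_bounded (b := fun t : ℝ => t) (l := atTop) D 0
      (fun t => ((hτ n).pow 2).integrableOn_Ioc) tendsto_id ?_
    filter_upwards [eventually_ge_atTop 0] with t ht
    simp only [norm_pow, Real.norm_eq_abs, sq_abs]
    exact hD t ht
  set F : ℕ → Lp ℝ 2 ν := fun n => (hint n).toLp
  have hdist : ∀ n m, ‖F n - F m‖ ^ 2 ≤ C * ‖x n - x m‖ ^ 2 := fun n m => by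
    have e : ‖F n - F m‖ ^ 2 = ∫ s in Ioi 0, (τ n s - τ m s) ^ 2 := by
      rw [← real_inner_self_eq_norm_sq, L2.inner_def]
      refine integral_congr_ae ?_
      filter_upwards [Lp.coeFn_sub (F n) (F m), (hint n).coeFn_toLp, (hint m).coeFn_toLp]
        with s h1 h2 h3
      rw [h1, Pi.sub_apply, h2, h3]
      simp [sq]
    rw [e]
    refine le_of_tendsto (intervalIntegral_tendsto_integral_Ioi 0
      ((hint n).sub (hint m)).integrable_sq (tendsto_id (α := ℝ))) ?_
    filter_upwards [eventually_ge_atTop 0] with t ht using h n m t ht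
  have hF : CauchySeq F := by
    rw [Metric.cauchySeq_iff] at hx ⊢
    intro ε hε
    have hD : 0 < √(max C 0) + 1 := by positivity
    obtain ⟨N, hN⟩ := hx (ε / (√(max C 0) + 1)) (by positivity)
    refine ⟨N, fun n hn m hm => ?_⟩
    have h1 := hN n hn m hm
    rw [dist_eq_norm, lt_div_iff₀ hD] at h1
    rw [dist_eq_norm]
    have h2 : ‖F n - F m‖ ≤ √(max C 0) * ‖x n - x m‖ := by
      refine le_of_sq_le_sq ((hdist n m).trans ?_) (by positivity)
      rw [mul_pow, Real.sq_sqrt (le_max_right _ _)]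
      gcongr
      exact le_max_left _ _
    nlinarith [norm_nonneg (x n - x m)]
  obtain ⟨f, hf⟩ := cauchySeq_tendsto_of_complete hF
  refine ⟨f, fun T => ?_, fun t ht => ?_⟩
  · rw [Measure.restrict_congr_set Ioc_ae_eq_Icc.symm]
    exact (Lp.memLp f).mono_measure (Measure.restrict_mono Ioc_subset_Ioi_self le_rfl)
  · have hmt : ν (Ioc 0 t) ≠ ∞ := by
      rw [hν, Measure.restrict_apply measurableSet_Ioc]
      exact ((measure_mono inter_subset_left).trans_lt measure_Ioc_lt_top).ne
    have e : ∀ g : ℝ → ℝ, ∫ s in (0 : ℝ)..t, g s = ∫ s in Ioc 0 t, g s ∂ν := fun g => by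
      rw [intervalIntegral.integral_of_le ht, hν, Measure.restrict_restrict measurableSet_Ioc,
        inter_eq_left.2 Ioc_subset_Ioi_self]
    have h1 : ∀ g : Lp ℝ 2 ν, ∫ s in Ioc 0 t, g s ∂ν
        = inner ℝ (indicatorConstLp 2 measurableSet_Ioc hmt (1 : ℝ)) g := fun g =>
      (L2.inner_indicatorConstLp_one measurableSet_Ioc hmt g).symm
    have h2 : ∀ n, ∫ s in (0 : ℝ)..t, τ n s = ∫ s in Ioc 0 t, F n s ∂ν := fun n => by
      rw [e]
      exact integral_congr_ae (ae_restrict_of_ae (hint n).coeFn_toLp.symm)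
    simp only [h2]
    rw [e]
    simp only [h1]
    exact tendsto_const_nhds.inner hf

end WellPosedness

/-! ### Solutions for arbitrary initial states. -/

section ClosedLoop

open Filter Topology

variable {S : NominalSystem} {κ : Fin 2 → ℝ} {k : BacksteppingKernels}

/-- Every initial state starts a solution. -/
theorem exists_isIntegratedSolution (hP : ∀ i, 0 < S.lamP i) (hM : 0 < S.lamM)
    {V : StateSpace →L[ℝ] StateSpace →L[ℝ] ℝ} (hsymm : ∀ Y Y', V Y Y' = V Y' Y) {c : ℝ} (hc : 0 < c)
    (hcoer : ∀ Y, c * ‖Y‖ ^ 2 ≤ V Y Y)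
    (hdiss : ∀ Y G z0 w1, IsGenerator S k Y G z0 w1 →
      V Y G ≤ -c * (V Y Y + (z0 ^ 2 + ∑ i, w1 i ^ 2))) (Y₀ : StateSpace) :
    ∃ Y τ₀ τ₁, IsIntegratedSolution S k Y τ₀ τ₁ ∧ Y 0 = Y₀ := by
  have hmd := isMaxDissipative_generatorGraph hP hM hsymm hc hcoer hdiss
  have hV : ∀ Y, 0 ≤ V Y Y := fun Y => le_trans (by positivity) (hcoer Y)
  -- Approximation by initial states in the domain. By linearity differences of strict solutions are
  -- strict solutions, so the energy bound `hen` gives Cauchy estimates for states and traces alike.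
  obtain ⟨x, hxD, hx⟩ := mem_closure_iff_seq_limit.1 (hmd.dense_domain Y₀)
  choose y hy using hxD
  have hstrict : ∀ n, ∃ p : ℝ → StateSpace × StateSpace, IsStrictSolution S k p ∧ (p 0).1 = x n := by
    intro n
    obtain ⟨Y, Yd, h1, h2, h3, h4, h5⟩ := hmd.exists_strict_solution (hy n)
    exact ⟨fun t => (Y t, Yd t), ⟨h1.prodMk h2, h4, fun t ht => by simpa only [h3] using h5 t ht⟩, h3⟩
  choose p hp hp0 using hstrict
  have hen : ∀ {q : ℝ → StateSpace × StateSpace}, IsStrictSolution S k q → ∀ t, 0 ≤ t →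
      V (q t).1 (q t).1 ≤ V (q 0).1 (q 0).1 ∧
      (∫ s in (0 : ℝ)..t, zeroTrace S k (q s) ^ 2 ≤ ‖V‖ / (2 * c) * ‖(q 0).1‖ ^ 2) ∧
      ∀ i, ∫ s in (0 : ℝ)..t, oneTrace S i (q s) ^ 2 ≤ ‖V‖ / (2 * c) * ‖(q 0).1‖ ^ 2 := by
    intro q hq t ht
    have h1 := hq.energy hP hM hsymm hc hV hdiss ht
    have c0 : Continuous fun s => zeroTrace S k (q s) := (zeroTrace S k).continuous.comp hq.cont
    have c1 : ∀ i, Continuous fun s => oneTrace S i (q s) := fun i =>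
      (oneTrace S i).continuous.comp hq.cont
    have h2 : V (q 0).1 (q 0).1 ≤ ‖V‖ * ‖(q 0).1‖ ^ 2 := by
      have := (Real.le_norm_self _).trans (V.le_opNorm₂ (q 0).1 (q 0).1)
      rw [sq, ← mul_assoc]; exact this
    have h3 : ∀ f : ℝ → ℝ, Continuous f → (∀ s, f s ≤ zeroTrace S k (q s) ^ 2
        + ∑ i, oneTrace S i (q s) ^ 2) →
        ∫ s in (0 : ℝ)..t, f s ≤ ‖V‖ / (2 * c) * ‖(q 0).1‖ ^ 2 := by
      intro f hf hle
      have h4 : ∫ s in (0 : ℝ)..t, f s ≤ ∫ s in (0 : ℝ)..t, (zeroTrace S k (q s) ^ 2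
          + ∑ i, oneTrace S i (q s) ^ 2) :=
        intervalIntegral.integral_mono_on ht (hf.intervalIntegrable _ _)
          (Continuous.intervalIntegrable (by fun_prop) _ _) fun s _ => hle s
      rw [div_mul_eq_mul_div, le_div_iff₀ (by positivity)]
      have := mul_le_mul_of_nonneg_left h4 (show 0 ≤ 2 * c by positivity)
      linarith [hV (q t).1]
    refine ⟨?_, h3 _ (c0.pow 2) fun s => ?_, fun i => h3 _ ((c1 i).pow 2) fun s => ?_⟩
    · have : 0 ≤ ∫ s in (0 : ℝ)..t, (zeroTrace S k (q s) ^ 2 + ∑ i, oneTrace S i (q s) ^ 2) :=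
        intervalIntegral.integral_nonneg ht fun s _ => by positivity
      have := mul_nonneg hc.le this
      linarith
    · have : 0 ≤ ∑ i, oneTrace S i (q s) ^ 2 := by positivity
      linarith
    · have := Finset.single_le_sum (f := fun i => oneTrace S i (q s) ^ 2) (fun i _ => sq_nonneg _)
        (Finset.mem_univ i)
      linarith [sq_nonneg (zeroTrace S k (q s))]
  have hcont0 : ∀ n, Continuous fun s => zeroTrace S k (p n s) := fun n =>
    (zeroTrace S k).continuous.comp (hp n).cont
  have hcont1 : ∀ i n, Continuous fun s => oneTrace S i (p n s) := fun i n =>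
    (oneTrace S i).continuous.comp (hp n).cont
  have hdiff0 : ∀ n m, ((p n 0 - p m 0).1) = x n - x m := fun n m => by
    rw [Prod.fst_sub, hp0, hp0]
  obtain ⟨τ₀, hτ₀, hτ₀lim⟩ := exists_limit_locallyL2 hx.cauchySeq
    (τ := fun n s => zeroTrace S k (p n s)) hcont0 (C := ‖V‖ / (2 * c))
    (fun n => ⟨_, fun t ht => (hen (hp n) t ht).2.1⟩) (fun n m t ht => by
      have := (hen ((hp n).sub (hp m)) t ht).2.1
      simpa only [map_sub, hdiff0] using this)
  have hone : ∀ i, ∃ f, IsLocallyL2 f ∧ ∀ t, 0 ≤ t →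
      Tendsto (fun n => ∫ s in (0 : ℝ)..t, oneTrace S i (p n s)) atTop
        (𝓝 (∫ s in (0 : ℝ)..t, f s)) := fun i =>
    exists_limit_locallyL2 hx.cauchySeq
      (τ := fun n s => oneTrace S i (p n s)) (hcont1 i) (C := ‖V‖ / (2 * c))
      (fun n => ⟨_, fun t ht => (hen (hp n) t ht).2.2 i⟩) (fun n m t ht => by
        have := (hen ((hp n).sub (hp m)) t ht).2.2 i
        simpa only [map_sub, hdiff0] using this)
  choose τ₁ hτ₁ hτ₁lim using hone
  obtain ⟨M, hM0, hMb⟩ := hmd.exists_norm_bound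
  have hYdiff : ∀ n m t, 0 ≤ t → ‖(p n t).1 - (p m t).1‖ ≤ M * ‖x n - x m‖ := fun n m t ht => by
    have := hMb _ _ (hen ((hp n).sub (hp m)) t ht).1
    simpa only [hdiff0, Prod.fst_sub, hp0] using this
  have hUC : UniformCauchySeqOn (fun n t => (p n t).1) atTop (Ici 0) := by
    rw [Metric.uniformCauchySeqOn_iff]
    intro ε hε
    obtain ⟨N, hN⟩ := Metric.cauchySeq_iff.1 hx.cauchySeq (ε / M) (by positivity)
    refine ⟨N, fun m hm n hn t ht => ?_⟩
    rw [dist_eq_norm]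
    have h1 := hN m hm n hn
    rw [dist_eq_norm, lt_div_iff₀ hM0] at h1
    have := hYdiff m n t ht
    linarith
  have hlim : ∀ t : ℝ, ∃ Y, 0 ≤ t → Tendsto (fun n => (p n t).1) atTop (𝓝 Y) := fun t => by
    by_cases ht : 0 ≤ t
    · obtain ⟨Y, hY⟩ := cauchySeq_tendsto_of_complete (hUC.cauchySeq ht)
      exact ⟨Y, fun _ => hY⟩
    · exact ⟨0, fun h => absurd h ht⟩
  choose Y hY using hlim
  have hU := hUC.tendstoUniformlyOn_of_tendsto fun t ht => hY t ht
  have hYc : ContinuousOn Y (Ici 0) := hU.continuousOn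
    (Frequently.of_forall fun n => (continuous_fst.comp (hp n).cont).continuousOn)
  have hY0 : Y 0 = Y₀ := tendsto_nhds_unique (hY 0 le_rfl) (by simpa only [hp0] using hx)
  refine ⟨Y, τ₀, fun t i => τ₁ i t, ⟨hYc, hτ₀, hτ₁, fun t ht => ?_⟩, hY0⟩
  -- The integrated equation of each approximation passes to the limit because the generator
  -- relation with its traces is closed.
  refine IsGenerator.of_tendsto (fun n => (hp n).gen hP hM ht) ?_ ((hY t ht).sub (hY 0 le_rfl))
    (hτ₀lim t ht) fun i => hτ₁lim i t ht
  refine TendstoUniformlyOn.tendsto_intervalIntegral_of_continuousOn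
    (Eventually.of_forall fun n => (continuous_fst.comp (hp n).cont).continuousOn) (hU.mono ?_)
  rw [uIcc_of_le ht]
  exact Icc_subset_Ici_self

lemma norm_le_norm_mkState (X : OdeState) (w : RightState) (z : LeftState) :
    ‖w‖ + ‖z‖ + ‖X‖ ≤ 3 * ‖mkState X w z‖ := by
  have h := norm_sq_mkState X w z
  have h1 : ‖X‖ ≤ ‖mkState X w z‖ := le_of_sq_le_sq (by nlinarith [sq_nonneg ‖w‖, sq_nonneg ‖z‖])
    (norm_nonneg _)
  have h2 : ‖w‖ ≤ ‖mkState X w z‖ := le_of_sq_le_sq (by nlinarith [sq_nonneg ‖X‖, sq_nonneg ‖z‖])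
    (norm_nonneg _)
  have h3 : ‖z‖ ≤ ‖mkState X w z‖ := le_of_sq_le_sq (by nlinarith [sq_nonneg ‖w‖, sq_nonneg ‖X‖])
    (norm_nonneg _)
  linarith

lemma norm_mkState_le (X : OdeState) (w : RightState) (z : LeftState) :
    ‖mkState X w z‖ ≤ ‖w‖ + ‖z‖ + ‖X‖ := by
  refine le_of_sq_le_sq ?_ (by positivity)
  rw [norm_sq_mkState]
  nlinarith [mul_nonneg (norm_nonneg w) (norm_nonneg z), mul_nonneg (norm_nonneg w) (norm_nonneg X),
    mul_nonneg (norm_nonneg X) (norm_nonneg z)]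

lemma isIntegratedSolution_zero :
    IsIntegratedSolution S k (fun _ => mkState 0 0 0) (fun _ => 0) (fun _ _ => 0) := by
  have h0 : IsLocallyL2 fun _ => 0 := fun T => MemLp.zero
  have e : mkState 0 0 0 = 0 := rfl
  refine ⟨continuousOn_const, h0, fun _ => h0, fun t _ => ?_⟩
  simp only [e, intervalIntegral.integral_zero, sub_zero]
  exact IsGenerator.zero

end ClosedLoop

/-! ### The closed-loop theorem. -/

theorem mainTheorem3 (S : NominalSystem) (hP : ∀ i, 0 < S.lamP i) (hM : 0 < S.lamM)
    (hstab : IsStabilizable S.A S.B)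
    (κ : Fin 2 → ℝ) (hκ : IsHurwitz (feedbackMatrix S.A S.B κ)) :
    (∃ k : BacksteppingKernels, IsKernelSolution S κ k) ∧
    ∀ k : BacksteppingKernels, IsKernelSolution S κ k →
      -- the zero state is an equilibrium of the closed loop
      IsClosedLoopSolution S k (fun _ => 0) (fun _ => 0) (fun _ => 0) ∧
      -- every initial state in `ℝ² × L²` starts a global solution
      (∀ (X₀ : OdeState) (w₀ : RightState) (z₀ : LeftState),
        ∃ (X : ℝ → OdeState) (w : ℝ → RightState) (z : ℝ → LeftState),
          IsClosedLoopSolution S k X w z ∧ X 0 = X₀ ∧ w 0 = w₀ ∧ z 0 = z₀) ∧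
      -- every solution decays, with constants that do not depend on the solution
      ∃ M η : ℝ, 0 < M ∧ 0 < η ∧
        ∀ (X : ℝ → OdeState) (w : ℝ → RightState) (z : ℝ → LeftState),
          IsClosedLoopSolution S k X w z → ∀ t : ℝ, 0 ≤ t →
            ‖w t‖ + ‖z t‖ + ‖X t‖ ≤ M * Real.exp (-η * t) * (‖w 0‖ + ‖z 0‖ + ‖X 0‖) := by
  refine ⟨exists_isKernelSolution S hP hM κ, fun k hk => ?_⟩
  obtain ⟨V, hsymm, c, hc, hcoer, hdiss⟩ := exists_lyapunov_functional hP hM hk hκ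
  have hV : ∀ Y, 0 ≤ V Y Y := fun Y => le_trans (by positivity) (hcoer Y)
  refine ⟨isIntegratedSolution_zero.isClosedLoopSolution hk continuousOn_const continuousOn_const
    continuousOn_const, fun X₀ w₀ z₀ => ?_, ?_⟩
  · obtain ⟨Y, τ₀, τ₁, hY, hY0⟩ :=
      exists_isIntegratedSolution hP hM hsymm hc hcoer hdiss (mkState X₀ w₀ z₀)
    have h2 := (WithLp.sndL 2 ℝ OdeState (WithLp 2 (RightState × LeftState))).continuous
    refine ⟨fun t => (Y t).fst, fun t => (Y t).snd.fst, fun t => (Y t).snd.snd,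
      hY.isClosedLoopSolution hk ?_ ?_ ?_, ?_, ?_, ?_⟩
    · exact (WithLp.fstL 2 ℝ OdeState (WithLp 2 (RightState × LeftState))).continuous.comp_continuousOn
        hY.cont
    · exact ((WithLp.fstL 2 ℝ RightState LeftState).continuous.comp h2).comp_continuousOn hY.cont
    · exact ((WithLp.sndL 2 ℝ RightState LeftState).continuous.comp h2).comp_continuousOn hY.cont
    all_goals simp only [hY0]; rfl
  · have hdiss' : ∀ Y G z0 w1, IsGenerator S k Y G z0 w1 → V Y G ≤ -c * V Y Y :=
      fun Y G z0 w1 h => by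
        have h1 := hdiss Y G z0 w1 h
        have : 0 ≤ c * (z0 ^ 2 + ∑ i, w1 i ^ 2) := by positivity
        linarith
    obtain ⟨M, hM0, hMb⟩ :=
      (isMaxDissipative_generatorGraph hP hM hsymm hc hcoer hdiss).exists_norm_bound
    refine ⟨3 * M, c, by positivity, hc, fun X w z h t ht => ?_⟩
    obtain ⟨τ₀, τ₁, hY⟩ := h.exists_isIntegratedSolution hk
    have h1 := hY.lyapunov_decay hsymm hdiss' ht
    -- V is quadratic, so the factor exp(-2ct) in the decay of V is absorbed by scaling the initial
    -- state by exp(-ct). The comparison of V with the norm then gives the rate η = c.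
    have h2 := hMb (mkState (X t) (w t) (z t)) (Real.exp (-c * t) • mkState (X 0) (w 0) (z 0)) (by
      refine h1.trans (le_of_eq ?_)
      simp only [map_smul, smul_apply, smul_eq_mul]
      rw [← mul_assoc, ← Real.exp_add]
      ring_nf)
    rw [norm_smul, Real.norm_of_nonneg (Real.exp_pos _).le] at h2
    calc ‖w t‖ + ‖z t‖ + ‖X t‖ ≤ 3 * ‖mkState (X t) (w t) (z t)‖ := norm_le_norm_mkState _ _ _
      _ ≤ 3 * (M * (Real.exp (-c * t) * ‖mkState (X 0) (w 0) (z 0)‖)) := by gcongr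
      _ ≤ 3 * (M * (Real.exp (-c * t) * (‖w 0‖ + ‖z 0‖ + ‖X 0‖))) := by
          gcongr; exact norm_mkState_le _ _ _
      _ = _ := by ring
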